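/- **Calculus.** Types and expressions form one syntactic class (a hat marks oblivious forms; $b$ ranges over Booleans, $\mathrm{ite}(b,x,y)$ is $x$ if $b$ is true and $y$ otherwise, and $\pi_b,\mathrm{inj}_b$ are first/left for $b$ true, second/right for $b$ false): $$e,\tau ::= \mathtt{unit}\mid\mathtt{bool}\mid\widehat{\mathtt{bool}}\mid\tau\times\tau\mid\tau\,\hat+\,\tau\mid\Pi x{:}\tau,\tau\mid\Psi\hat T\mid T\mid\hat T\,e\mid x\mid()\mid b\mid\lambda x{:}\tau.e\mid\mathtt{let}\ x=e\ \mathtt{in}\ e\mid e\,e\mid C\,e\mid\mathtt{if}\ e\ \mathtt{then}\ e\ \mathtt{else}\ e\mid\mathtt{mux}\ e\ e\ e\mid(e,e)\mid\langle e,e\rangle\mid\pi_b e\mid\widehat{\mathrm{inj}}_b\langle\tau\rangle e\mid\widehat{\mathtt{match}}\ e\ \mathtt{with}\ x\Rightarrow e\mid x\Rightarrow e\mid\mathtt{match}\ e\ \mathtt{with}\ \overline{C\,x\Rightarrow e}\mid\mathtt{sec}\ e\mid[b]\mid[\mathrm{inj}_b\langle\hat\omega\rangle\hat v].$$ Oblivious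 type values are $\hat\omega::=\mathtt{unit}\mid\widehat{\mathtt{bool}}\mid\hat\omega\times\hat\omega\mid\hat\omega\hat+\hat\omega$, oblivious values are $\hat v::=()\mid[b]\mid(\hat v,\hat v)\mid[\mathrm{inj}_b\langle\hat\omega\rangle\hat v]$, and values are $v::=\hat v\mid b\mid(v,v)\mid\langle v,v\rangle\mid\lambda x{:}\tau.e\mid C\,v$. A global context $\Sigma$ maps names to definitions $\mathtt{data}\ T=\overline{C\,\tau}$ (an ADT), $\mathtt{obliv}\ \hat T(x{:}\tau)=\tau'$ (an OADT with public view type $\tau$) and $\mathtt{fn}\ x{:}\tau=e$; definitions may be mutually recursive. Each function is either *secure* or *leaky*. *Semantics.* $e\to e'$ is the call-by-value small-step relation (arguments before functions; all three components of $\mathtt{mux}$ are evaluated to values first; annotations of $\widehat{\mathrm{inj}}$ are evaluated before payloads; no reduction under binders or in branches of $\mathtt{if}$, $\mathtt{match}$, $\widehat{\mathtt{match}}$) generated by: $x\to e$ if $\mathtt{fn}\ x{:}\tau=e\in\Sigma$; $\hat T\,v\to[v/x]\tau'$; $(\lambda x{:}\tau.e)\,v\to[v/x]e$; $\mathtt{let}\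 x=v\ \mathtt{in}\ e\to[v/x]e$; $\mathtt{if}\ b\ \mathtt{then}\ e_1\ \mathtt{else}\ e_2\to\mathrm{ite}(b,e_1,e_2)$; $\mathtt{mux}\ [b]\ v_1\ v_2\to\mathrm{ite}(b,v_1,v_2)$; $\mathtt{match}\ C_iv\ \mathtt{with}\ \overline{C\,x\Rightarrow e}\to[v/x]e_i$; $\pi_b(v_1,v_2)\to\mathrm{ite}(b,v_1,v_2)$ and $\pi_b\langle v_1,v_2\rangle\to\mathrm{ite}(b,v_1,v_2)$; $\mathtt{sec}\ b\to[b]$; $\widehat{\mathrm{inj}}_b\langle\hat\omega\rangle\hat v\to[\mathrm{inj}_b\langle\hat\omega\rangle\hat v]$; and $\widehat{\mathtt{match}}\ [\mathrm{inj}_b\langle\hat\omega_1\hat+\hat\omega_2\rangle\hat v]\ \mathtt{with}\ x\Rightarrow e_1\mid x\Rightarrow e_2\;\to\;\mathtt{mux}\ [b]\ \mathrm{ite}(b,[\hat v/x]e_1,[\hat v_1/x]e_1)\ \mathrm{ite}(b,[\hat v_2/x]e_2,[\hat v/x]e_2)$ for arbitrary oblivious values $\hat v_i$ of type $\hat\omega_i$.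 Write $\to^i$ and $\to^*$ for exactly $i$ steps and any number of steps. *Typing.* Kinds are $A,P,O,M$ (any, public, oblivious, mixed) with $A\sqsubseteq P,O\sqsubseteq M$ and subsumption. $\mathtt{unit}$ has kind $A$; $\mathtt{bool}$ and ADTs have kind $P$; $\widehat{\mathtt{bool}}$ has kind $O$, as do $\hat T\,e$ (with $e$ of the view type of $\hat T$), $\tau_1\hat+\tau_2$ with both $\tau_i$ of kind $O$, and well-typed type-level $\mathtt{let}$, $\mathtt{if}$, $\mathtt{match}$ with branches of kind $O$; a product has any kind that both factors have; $\Pi$-types of well-kinded types and $\Psi\hat T$ have kind $M$. Typing $\Gamma\vdash e:\tau$ is the standard dependent typing (dependent motives for $\mathtt{if}$ and $\mathtt{match}$, conversion along the equivalence generated by parallel reduction), with: $\langle e_1,e_2\rangle:\Psi\hat T$ if $e_1$ has the view type of $\hat T$ and $e_2:\hat T\,e_1$; if $e:\Psi\hat T$ then $\pi_1e$ has the view type and $\pi_2e:\hat T(\pi_1e)$; $\mathtt{sec}$ maps $\mathtt{bool}$ to $\widehat{\mathtt{bool}}$; and the result type of $\mathtt{mux}$ and of $\widehat{\mathtt{match}}$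 must have kind $O$. A second, *leaky* mode of the judgments drops only this last requirement (the type must merely be well-kinded); secure code may refer only to secure functions. Unless said otherwise typing is in secure mode. $\Sigma$ is *well-typed* if every function body has its declared well-kinded type in the empty context, in the function's mode; all constructor argument types are closed of kind $P$; and for every OADT, the view type is closed of kind $P$ and the body has kind $O$ in context $x{:}\tau$. **$\Psi$-structures.** Specification types are $\theta::=\mathtt{unit}\mid\mathtt{bool}\mid\widehat{\mathtt{bool}}\mid T\mid\Psi\hat T\mid\theta\times\theta\mid\theta\to\theta$, required to be well-kinded; those without $\widehat{\mathtt{bool}}$ and $\Psi\hat T$ are simple. A $\Psi$-structure context $\mathcal S$ consists of the following (closed, well-typed) data satisfying the following axioms. * Every OADT $\hat T$ with view type $\tau$ has one OADT-structure: an ADT $T$ (one says that $\hat T$ is an OADT for $T$), $s:\Pi k{:}\tau,T\to\hat T\,k$, $r:\Pi k{:}\tau,\hat T\,k\to T$ (typed in leaky mode), $\nu:T\to\tau$ and a relation $v\preccurlyeq k$ on values, such that for all values $v:T$, $k:\tau$, $\hat v:\hat T\,k$: if $v\preccurlyeq k$ and $s\,k\,v\to^*\hat v$ then $r\,k\,\hat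 v\to^*v$; if $r\,k\,\hat v\to^*v$ then $v\preccurlyeq k$; if $\nu\,v\to^*k$ then $v\preccurlyeq k$. * Join-structures of $\hat T$: a partial order $\sqsubseteq$ on values of type $\tau$, ${\sqcup}:\tau\to\tau\to\tau$ and $\rho:\Pi k{:}\tau,\Pi k'{:}\tau,\hat T\,k\to\hat T\,k'$, such that $k_1\sqcup k_2\to^*k$ implies $k_1,k_2\sqsubseteq k$; $v\preccurlyeq k\sqsubseteq k'$ implies $v\preccurlyeq k'$; and $r\,k\,\hat v\to^*v$, $v\preccurlyeq k'$, $\rho\,k\,k'\,\hat v\to^*\hat v'$ imply $r\,k'\,\hat v'\to^*v$ (for all values of the appropriate types). * Intro-methods $\hat C_i:\theta_i\to\Psi\hat T$ for constructors $C_i$ of $T$, with $\lfloor\theta_i\rfloor$ the argument type of $C_i$, such that $(v,v')\in\mathcal V_n[\theta_i]$ implies $(C_iv,\hat C_iv')\in\mathcal E_n[\Psi\hat T]$ for all $n$. * Elim-methods $m:\Psi\hat T\to\overline{(\theta\to\alpha)}\to\alpha$, with one $\theta_j$ for each constructor $C_j$ of $T$, $\lfloor\theta_j\rfloor$ being its argument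 type, such that for all $n$, all values $v_i:\lfloor\theta_i\rfloor$ and $\langle k,\hat v\rangle:\Psi\hat T$: if $r\,k\,\hat v\to^*C_iv_i$ and $(\lambda x{:}\lfloor\theta_j\rfloor.e_j,\lambda x{:}\theta_j.e_j')\in\mathcal V_n[\theta_j\to\alpha]$ for every $j$, then $([v_i/x]e_i,\;m\,\langle k,\hat v\rangle\,\overline{(\lambda x{:}\theta.e')})\in\mathcal E_n[\alpha]$. * Coercion-structures $c:\Psi\hat T\to\Psi\hat T'$ between OADTs for the same $T$, such that for all values of the appropriate types, $r\,k\,\hat v\to^*v$ and $c\,\langle k,\hat v\rangle\to^*\langle k',\hat v'\rangle$ imply $r'\,k'\,\hat v'\to^*v$. Here *erasure* $\lfloor\theta\rfloor$ replaces $\widehat{\mathtt{bool}}$ by $\mathtt{bool}$ and $\Psi\hat T$ by its $T$, and the *refinement relations* are defined by recursion on $\theta$; all pairs are closed and typed by $\lfloor\theta\rfloor$ and $\theta$ respectively, the pairs in $\mathcal V_n$ are pairs of values, and - $\mathcal V_n[\theta]=\{(v,v')\mid 0<n\Rightarrow v=v'\}$ for $\theta\in\{\mathtt{unit},\mathtt{bool},T\}$;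 $\mathcal V_n[\widehat{\mathtt{bool}}]=\{(b,[b'])\mid 0<n\Rightarrow b=b'\}$; - $\mathcal V_n[\Psi\hat T]=\{(v,\langle k,\hat v\rangle)\mid 0<n\Rightarrow r\,k\,\hat v\to^*v\}$; $\mathcal V_n[\theta_1\times\theta_2]$ is componentwise; - $\mathcal V_n[\theta_1\to\theta_2]$ is the set of pairs of abstractions with bodies $e,e'$ such that $([u/x]e,[u'/x]e')\in\mathcal E_i[\theta_2]$ for all $i<n$ and $(u,u')\in\mathcal V_i[\theta_1]$; - $\mathcal E_n[\theta]=\{(e,e')\mid\forall i<n,\ \forall$ value $v'$, $e'\to^iv'\Rightarrow\exists$ value $v$, $e\to^*v$ and $(v,v')\in\mathcal V_{n-i}[\theta]\}$. **Lifting.** A type $\theta$ is *mergeable* with witness $\widehat{\mathrm{ite}}:\widehat{\mathtt{bool}}\to\theta\to\theta\to\theta$ as follows: $\lambda\hat b\,x\,y.\,\mathtt{mux}\ \hat b\ x\ y$ for $\mathtt{unit}$ and $\widehat{\mathtt{bool}}$; $\lambda\hat b\,x\,y.\,\mathtt{let}\ k=\pi_1x\sqcup\pi_1y\ \mathtt{in}\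 \langle k,\mathtt{mux}\ \hat b\ (\rho\,(\pi_1x)\,k\,(\pi_2x))\ (\rho\,(\pi_1y)\,k\,(\pi_2y))\rangle$ for $\Psi\hat T$ with a join-structure; componentwise for products of mergeable types; $\lambda\hat b\,x\,y.\lambda z.\,\widehat{\mathrm{ite}}_2\,\hat b\,(x\,z)\,(y\,z)$ for $\theta_1\to\theta_2$ with $\theta_2$ mergeable. *Coercibility* $\theta\leadsto\theta'$ with witness of type $\theta\to\theta'$ is generated by: $\theta\leadsto\theta$ by $\lambda x.x$; $\mathtt{bool}\leadsto\widehat{\mathtt{bool}}$ by $\lambda x.\mathtt{sec}\ x$; $T\leadsto\Psi\hat T$ for an OADT $\hat T$ for $T$ by $\lambda x.\langle\nu\,x,s\,(\nu\,x)\,x\rangle$; coercion-structures; componentwise on products; and, if $\theta_1'\leadsto\theta_1$ by $c_1$ and $\theta_2\leadsto\theta_2'$ by $c_2$, then $\theta_1\to\theta_2\leadsto\theta_1'\to\theta_2'$ by $\lambda x.\lambda y.c_2(x(c_1y))$. A *lifting context* $\mathcal L$ is a set of entries $x:\theta\rhd\hat x$ pairing global functions. The *declarative lifting* judgment $\Gamma\vdash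 e:\theta\rhd e'$ ($\Gamma$ maps local variables to specification types) is generated by: $()$, Boolean constants (at type $\mathtt{bool}$) and local variables lift to themselves; $x:\theta\rhd\hat x$ for entries of $\mathcal L$; $\lambda x{:}\lfloor\theta_1\rfloor.e:\theta_1\to\theta_2\rhd\lambda x{:}\theta_1.e'$ if $\Gamma,x{:}\theta_1\vdash e:\theta_2\rhd e'$; the congruence rules for application, $\mathtt{let}$, pairs, projections, $\mathtt{if}$ with condition lifted at $\mathtt{bool}$, constructors $C_i$ at type $T$ (argument lifted at the declared type) and $\mathtt{match}$ with scrutinee lifted at an ADT $T$ (pattern variables at the declared types); and - $\mathtt{if}\ e_0\ \mathtt{then}\ e_1\ \mathtt{else}\ e_2:\theta\rhd\widehat{\mathrm{ite}}\,e_0'\,e_1'\,e_2'$ if $e_0:\widehat{\mathtt{bool}}\rhd e_0'$, $\theta$ is mergeable with witness $\widehat{\mathrm{ite}}$, and $e_i:\theta\rhd e_i'$ for $i=1,2$; - $C_ie:\Psi\hat T\rhd\hat C_ie'$ if $\hat C_i:\theta_i\to\Psi\hat T$ is an intro-method of $\mathcal S$ and $e:\theta_i\rhd e'$; - $\mathtt{match}\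 e_0\ \mathtt{with}\ \overline{C\,x\Rightarrow e}:\alpha\rhd m\,e_0'\,\overline{(\lambda x{:}\theta.e')}$ if $m:\Psi\hat T\to\overline{(\theta\to\alpha)}\to\alpha$ is an elim-method of $\mathcal S$, $e_0:\Psi\hat T\rhd e_0'$, and $\Gamma,x{:}\theta_i\vdash e_i:\alpha\rhd e_i'$ for all $i$; - $e:\theta'\rhd c\,e'$ if $e:\theta\rhd e'$ and $\theta\leadsto\theta'$ with witness $c$. $\mathcal L$ is *derivable* if for every entry $x:\theta\rhd\hat x$ in $\mathcal L$ there are secure definitions $\mathtt{fn}\ x{:}\lfloor\theta\rfloor=e$ and $\mathtt{fn}\ \hat x{:}\theta=e'$ in $\Sigma$ with $\cdot\vdash e:\theta\rhd e'$ under $\mathcal L$ itself; it is *valid* if for all $n$ and all entries $x:\theta\rhd\hat x$ in $\mathcal L$, $(x,\hat x)\in\mathcal E_n[\theta]$. **Theorem (correctness of declarative lifting).** Let $\Sigma$ be a well-typed global context, $\mathcal S$ a $\Psi$-structure context over $\Sigma$, and $\mathcal L$ a lifting context. If $\mathcal L$ is derivable, then $\mathcal L$ is valid. -/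

import Mathlib

/-!
A dependently typed core calculus with oblivious algebraic data types (OADTs) and Psi-types,
Psi-structures, the declarative lifting relation, and the step-indexed refinement relation.

Local variables are de Bruijn indices; global functions, algebraic data types (ADTs) and OADTs
are referred to by name.
-/

namespace OADT

/-- Names of global functions, of ADTs and of OADTs (three separate name spaces). -/
abbrev Name := ℕ

/-! ### Terms -/

/-- Oblivious type values. -/
inductive OTy : Type
  | unit : OTy
  | obool : OTy
  | prod : OTy → OTy → OTy
  | osum : OTy → OTy → OTy

/-- Oblivious values. -/
inductive OVal : Type
  | tt : OVal
  | boxedLit : Bool → OVal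
  | pair : OVal → OVal → OVal
  | boxedInj : Bool → OTy → OVal → OVal

/-- Types and expressions live in one syntactic class. In every Boolean-indexed former, `true`
means "first / left". The constructor named `C_i` of the ADT `T` is the pair `(T, i)`, and
`ematch T n e bs` is the match on `T` with the `n` alternatives `bs`. The second argument of
`pi`, `abs`, `letE`, both branches of `omatch` and all alternatives of `ematch` bind one local
variable. -/
inductive Expr : Type
  | unitT : Expr
  | boolT : Expr
  | oboolT : Expr
  | prodT : Expr → Expr → Expr
  | osumT : Expr → Expr → Expr
  | pi : Expr → Expr → Expr
  | psiT : Name → Expr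
  | adt : Name → Expr
  | oadt : Name → Expr → Expr
  | bvar : ℕ → Expr
  | gvar : Name → Expr
  | tt : Expr
  | lit : Bool → Expr
  | abs : Expr → Expr → Expr
  | letE : Expr → Expr → Expr
  | app : Expr → Expr → Expr
  | ctor : Name → ℕ → Expr → Expr
  | ite : Expr → Expr → Expr → Expr
  | mux : Expr → Expr → Expr → Expr
  | pair : Expr → Expr → Expr
  | psiPair : Expr → Expr → Expr
  | proj : Bool → Expr → Expr
  | oinj : Bool → Expr → Expr → Expr
  | omatch : Expr → Expr → Expr → Expr
  | ematch : Name → (n : ℕ) → Expr → (Fin n → Expr) → Expr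
  | sec : Expr → Expr
  | boxedLit : Bool → Expr
  | boxedInj : Bool → OTy → OVal → Expr

/-- Oblivious type values as types. -/
def OTy.toExpr : OTy → Expr
  | .unit => .unitT
  | .obool => .oboolT
  | .prod a b => .prodT a.toExpr b.toExpr
  | .osum a b => .osumT a.toExpr b.toExpr

/-- Oblivious values as expressions. -/
def OVal.toExpr : OVal → Expr
  | .tt => .tt
  | .boxedLit b => .boxedLit b
  | .pair v w => .pair v.toExpr w.toExpr
  | .boxedInj b w v => .boxedInj b w v

/-- Extend a renaming under a binder. -/
def upRen (ξ : ℕ → ℕ) : ℕ → ℕ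
  | 0 => 0
  | n + 1 => ξ n + 1

/-- Renaming of local variables. -/
def Expr.rename : (ℕ → ℕ) → Expr → Expr
  | _, .unitT => .unitT
  | _, .boolT => .boolT
  | _, .oboolT => .oboolT
  | ξ, .prodT a b => .prodT (a.rename ξ) (b.rename ξ)
  | ξ, .osumT a b => .osumT (a.rename ξ) (b.rename ξ)
  | ξ, .pi a b => .pi (a.rename ξ) (b.rename (upRen ξ))
  | _, .psiT T => .psiT T
  | _, .adt T => .adt T
  | ξ, .oadt T e => .oadt T (e.rename ξ)
  | ξ, .bvar n => .bvar (ξ n)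
  | _, .gvar f => .gvar f
  | _, .tt => .tt
  | _, .lit b => .lit b
  | ξ, .abs a e => .abs (a.rename ξ) (e.rename (upRen ξ))
  | ξ, .letE a e => .letE (a.rename ξ) (e.rename (upRen ξ))
  | ξ, .app f e => .app (f.rename ξ) (e.rename ξ)
  | ξ, .ctor T i e => .ctor T i (e.rename ξ)
  | ξ, .ite c a b => .ite (c.rename ξ) (a.rename ξ) (b.rename ξ)
  | ξ, .mux c a b => .mux (c.rename ξ) (a.rename ξ) (b.rename ξ)
  | ξ, .pair a b => .pair (a.rename ξ) (b.rename ξ)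
  | ξ, .psiPair a b => .psiPair (a.rename ξ) (b.rename ξ)
  | ξ, .proj b e => .proj b (e.rename ξ)
  | ξ, .oinj b a e => .oinj b (a.rename ξ) (e.rename ξ)
  | ξ, .omatch c a b => .omatch (c.rename ξ) (a.rename (upRen ξ)) (b.rename (upRen ξ))
  | ξ, .ematch T n e bs => .ematch T n (e.rename ξ) (fun i => (bs i).rename (upRen ξ))
  | ξ, .sec e => .sec (e.rename ξ)
  | _, .boxedLit b => .boxedLit b
  | _, .boxedInj b w v => .boxedInj b w v

/-- Weakening by one variable. -/
def Expr.shift (e : Expr) : Expr := e.rename Nat.succ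

/-- Extend a substitution under a binder. -/
def upSub (σ : ℕ → Expr) : ℕ → Expr
  | 0 => .bvar 0
  | n + 1 => (σ n).shift

/-- Simultaneous capture-avoiding substitution. -/
def Expr.subst : (ℕ → Expr) → Expr → Expr
  | _, .unitT => .unitT
  | _, .boolT => .boolT
  | _, .oboolT => .oboolT
  | σ, .prodT a b => .prodT (a.subst σ) (b.subst σ)
  | σ, .osumT a b => .osumT (a.subst σ) (b.subst σ)
  | σ, .pi a b => .pi (a.subst σ) (b.subst (upSub σ))
  | _, .psiT T => .psiT T
  | _, .adt T => .adt T
  | σ, .oadt T e => .oadt T (e.subst σ)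
  | σ, .bvar n => σ n
  | _, .gvar f => .gvar f
  | _, .tt => .tt
  | _, .lit b => .lit b
  | σ, .abs a e => .abs (a.subst σ) (e.subst (upSub σ))
  | σ, .letE a e => .letE (a.subst σ) (e.subst (upSub σ))
  | σ, .app f e => .app (f.subst σ) (e.subst σ)
  | σ, .ctor T i e => .ctor T i (e.subst σ)
  | σ, .ite c a b => .ite (c.subst σ) (a.subst σ) (b.subst σ)
  | σ, .mux c a b => .mux (c.subst σ) (a.subst σ) (b.subst σ)
  | σ, .pair a b => .pair (a.subst σ) (b.subst σ)
  | σ, .psiPair a b => .psiPair (a.subst σ) (b.subst σ)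
  | σ, .proj b e => .proj b (e.subst σ)
  | σ, .oinj b a e => .oinj b (a.subst σ) (e.subst σ)
  | σ, .omatch c a b => .omatch (c.subst σ) (a.subst (upSub σ)) (b.subst (upSub σ))
  | σ, .ematch T n e bs => .ematch T n (e.subst σ) (fun i => (bs i).subst (upSub σ))
  | σ, .sec e => .sec (e.subst σ)
  | _, .boxedLit b => .boxedLit b
  | _, .boxedInj b w v => .boxedInj b w v

/-- The substitution that replaces the innermost variable by `u`. -/
def instSub (u : Expr) : ℕ → Expr
  | 0 => u
  | n + 1 => .bvar n

/-- `e.inst u` is `[u/x]e` for the innermost variable `x` of `e`. -/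
def Expr.inst (e u : Expr) : Expr := e.subst (instSub u)

/-- The substitution `[C_i x/y]` from a context ending in `y` to one ending in `x`. -/
def ctorSub (T : Name) (i : ℕ) : ℕ → Expr
  | 0 => .ctor T i (.bvar 0)
  | n + 1 => .bvar (n + 1)

/-- Values. Oblivious values are values. -/
inductive IsVal : Expr → Prop
  | tt : IsVal .tt
  | lit (b : Bool) : IsVal (.lit b)
  | boxedLit (b : Bool) : IsVal (.boxedLit b)
  | boxedInj (b : Bool) (w : OTy) (v : OVal) : IsVal (.boxedInj b w v)
  | pair {v w : Expr} : IsVal v → IsVal w → IsVal (.pair v w)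
  | psiPair {v w : Expr} : IsVal v → IsVal w → IsVal (.psiPair v w)
  | abs (τ e : Expr) : IsVal (.abs τ e)
  | ctor (T : Name) (i : ℕ) {v : Expr} : IsVal v → IsVal (.ctor T i v)

/-! ### Global definitions -/

/-- `secure` functions obey all security side conditions; `leaky` functions (such as retractions)
are exempt from the obliviousness conditions on `mux` and `omatch`. -/
inductive Mode : Type
  | secure : Mode
  | leaky : Mode

/-- `fn x : ty = body`, with the mode in which it is checked. -/
structure FnDef where
  mode : Mode
  ty : Expr
  body : Expr

/-- `data T = C_0 (arg 0) | ... | C_(n-1) (arg (n-1))`. -/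
structure ADTDef where
  n : ℕ
  arg : Fin n → Expr

/-- `obliv T (x : view) = body`; the variable `x` is the only local variable of `body`. -/
structure OADTDef where
  view : Expr
  body : Expr

/-- A global context maps names to global definitions. -/
structure GCtx where
  fn : Name → Option FnDef
  adt : Name → Option ADTDef
  oadt : Name → Option OADTDef

/-! ### Operational semantics -/

/-- Synthesis of oblivious values of an oblivious type value. -/
inductive OValTy : OVal → OTy → Prop
  | unit : OValTy .tt .unit
  | obool (b : Bool) : OValTy (.boxedLit b) .obool
  | prod {v₁ v₂ : OVal} {w₁ w₂ : OTy} :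
      OValTy v₁ w₁ → OValTy v₂ w₂ → OValTy (.pair v₁ v₂) (.prod w₁ w₂)
  | osum {b : Bool} {v : OVal} {w₁ w₂ : OTy} :
      OValTy v (cond b w₁ w₂) → OValTy (.boxedInj b (.osum w₁ w₂) v) (.osum w₁ w₂)

/-- Call-by-value small-step semantics; applications are evaluated from right to left. -/
inductive Step (G : GCtx) : Expr → Expr → Prop
  -- reductions
  | fn {f : Name} {d : FnDef} : G.fn f = some d → Step G (.gvar f) d.body
  | oadt {T : Name} {d : OADTDef} {v : Expr} :
      G.oadt T = some d → IsVal v → Step G (.oadt T v) (d.body.inst v)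
  | beta {τ e v : Expr} : IsVal v → Step G (.app (.abs τ e) v) (e.inst v)
  | letV {v e : Expr} : IsVal v → Step G (.letE v e) (e.inst v)
  | iteLit {b : Bool} {e₁ e₂ : Expr} : Step G (.ite (.lit b) e₁ e₂) (cond b e₁ e₂)
  | muxLit {b : Bool} {v₁ v₂ : Expr} :
      IsVal v₁ → IsVal v₂ → Step G (.mux (.boxedLit b) v₁ v₂) (cond b v₁ v₂)
  | matchCtor {T : Name} {n : ℕ} {i : Fin n} {v : Expr} {bs : Fin n → Expr} :
      IsVal v → Step G (.ematch T n (.ctor T i v) bs) ((bs i).inst v)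
  | projPair {b : Bool} {v₁ v₂ : Expr} :
      IsVal v₁ → IsVal v₂ → Step G (.proj b (.pair v₁ v₂)) (cond b v₁ v₂)
  | projPsi {b : Bool} {v₁ v₂ : Expr} :
      IsVal v₁ → IsVal v₂ → Step G (.proj b (.psiPair v₁ v₂)) (cond b v₁ v₂)
  | secLit {b : Bool} : Step G (.sec (.lit b)) (.boxedLit b)
  | oinjVal {b : Bool} {w : OTy} {v : OVal} :
      Step G (.oinj b w.toExpr v.toExpr) (.boxedInj b w v)
  | omatchInj {b : Bool} {w₁ w₂ : OTy} {v v₁ v₂ : OVal} {e₁ e₂ : Expr} :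
      OValTy v₁ w₁ → OValTy v₂ w₂ →
      Step G (.omatch (.boxedInj b (.osum w₁ w₂) v) e₁ e₂)
        (.mux (.boxedLit b)
          (cond b (e₁.inst v.toExpr) (e₁.inst v₁.toExpr))
          (cond b (e₂.inst v₂.toExpr) (e₂.inst v.toExpr)))
  -- evaluation contexts
  | prodL {a a' b : Expr} : Step G a a' → Step G (.prodT a b) (.prodT a' b)
  | prodR {w : OTy} {b b' : Expr} :
      Step G b b' → Step G (.prodT w.toExpr b) (.prodT w.toExpr b')
  | osumL {a a' b : Expr} : Step G a a' → Step G (.osumT a b) (.osumT a' b)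
  | osumR {w : OTy} {b b' : Expr} :
      Step G b b' → Step G (.osumT w.toExpr b) (.osumT w.toExpr b')
  | letC {e e' f : Expr} : Step G e e' → Step G (.letE e f) (.letE e' f)
  | appR {f e e' : Expr} : Step G e e' → Step G (.app f e) (.app f e')
  | appL {f f' v : Expr} : IsVal v → Step G f f' → Step G (.app f v) (.app f' v)
  | ctorC {T : Name} {i : ℕ} {e e' : Expr} : Step G e e' → Step G (.ctor T i e) (.ctor T i e')
  | oadtC {T : Name} {e e' : Expr} : Step G e e' → Step G (.oadt T e) (.oadt T e')
  | iteC {e e' e₁ e₂ : Expr} : Step G e e' → Step G (.ite e e₁ e₂) (.ite e' e₁ e₂)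
  | mux₀ {e e' e₁ e₂ : Expr} : Step G e e' → Step G (.mux e e₁ e₂) (.mux e' e₁ e₂)
  | mux₁ {v e e' e₂ : Expr} : IsVal v → Step G e e' → Step G (.mux v e e₂) (.mux v e' e₂)
  | mux₂ {v v₁ e e' : Expr} :
      IsVal v → IsVal v₁ → Step G e e' → Step G (.mux v v₁ e) (.mux v v₁ e')
  | pairL {e e' f : Expr} : Step G e e' → Step G (.pair e f) (.pair e' f)
  | pairR {v f f' : Expr} : IsVal v → Step G f f' → Step G (.pair v f) (.pair v f')
  | psiL {e e' f : Expr} : Step G e e' → Step G (.psiPair e f) (.psiPair e' f)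
  | psiR {v f f' : Expr} : IsVal v → Step G f f' → Step G (.psiPair v f) (.psiPair v f')
  | projC {b : Bool} {e e' : Expr} : Step G e e' → Step G (.proj b e) (.proj b e')
  | oinjT {b : Bool} {τ τ' e : Expr} : Step G τ τ' → Step G (.oinj b τ e) (.oinj b τ' e)
  | oinjC {b : Bool} {w : OTy} {e e' : Expr} :
      Step G e e' → Step G (.oinj b w.toExpr e) (.oinj b w.toExpr e')
  | omatchC {e e' e₁ e₂ : Expr} : Step G e e' → Step G (.omatch e e₁ e₂) (.omatch e' e₁ e₂)
  | ematchC {T : Name} {n : ℕ} {e e' : Expr} {bs : Fin n → Expr} :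
      Step G e e' → Step G (.ematch T n e bs) (.ematch T n e' bs)
  | secC {e e' : Expr} : Step G e e' → Step G (.sec e) (.sec e')

/-- Reduction in any number of steps. -/
def Steps (G : GCtx) : Expr → Expr → Prop := Relation.ReflTransGen (Step G)

/-- Reduction in exactly `n` steps. -/
inductive StepN (G : GCtx) : ℕ → Expr → Expr → Prop
  | zero (e : Expr) : StepN G 0 e e
  | succ {n : ℕ} {e e' e'' : Expr} : Step G e e' → StepN G n e' e'' → StepN G (n + 1) e e''

/-! ### Type equivalence -/

/-- Parallel reduction. -/
inductive ParRed (G : GCtx) : Expr → Expr → Prop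
  | refl (e : Expr) : ParRed G e e
  -- reductions
  | fn {f : Name} {d : FnDef} : G.fn f = some d → ParRed G (.gvar f) d.body
  | oadtR {T : Name} {d : OADTDef} {e e' : Expr} :
      G.oadt T = some d → ParRed G e e' → ParRed G (.oadt T e) (d.body.inst e')
  | beta {τ e e' u u' : Expr} :
      ParRed G e e' → ParRed G u u' → ParRed G (.app (.abs τ e) u) (e'.inst u')
  | letR {e e' u u' : Expr} :
      ParRed G u u' → ParRed G e e' → ParRed G (.letE u e) (e'.inst u')
  | iteR {b : Bool} {e₁ e₁' e₂ e₂' : Expr} :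
      ParRed G e₁ e₁' → ParRed G e₂ e₂' → ParRed G (.ite (.lit b) e₁ e₂) (cond b e₁' e₂')
  | muxR {b : Bool} {e₁ e₁' e₂ e₂' : Expr} :
      ParRed G e₁ e₁' → ParRed G e₂ e₂' → ParRed G (.mux (.boxedLit b) e₁ e₂) (cond b e₁' e₂')
  | ematchR {T : Name} {n : ℕ} {i : Fin n} {e e' : Expr} {bs bs' : Fin n → Expr} :
      ParRed G e e' → (∀ j, ParRed G (bs j) (bs' j)) →
      ParRed G (.ematch T n (.ctor T i e) bs) ((bs' i).inst e')
  | projPair {b : Bool} {e₁ e₁' e₂ e₂' : Expr} :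
      ParRed G e₁ e₁' → ParRed G e₂ e₂' → ParRed G (.proj b (.pair e₁ e₂)) (cond b e₁' e₂')
  | projPsi {b : Bool} {e₁ e₁' e₂ e₂' : Expr} :
      ParRed G e₁ e₁' → ParRed G e₂ e₂' → ParRed G (.proj b (.psiPair e₁ e₂)) (cond b e₁' e₂')
  | secR {b : Bool} : ParRed G (.sec (.lit b)) (.boxedLit b)
  | oinjR {b : Bool} {w : OTy} {v : OVal} :
      ParRed G (.oinj b w.toExpr v.toExpr) (.boxedInj b w v)
  | omatchR {b : Bool} {w₁ w₂ : OTy} {v v₁ v₂ : OVal} {e₁ e₁' e₂ e₂' : Expr} :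
      OValTy v₁ w₁ → OValTy v₂ w₂ → ParRed G e₁ e₁' → ParRed G e₂ e₂' →
      ParRed G (.omatch (.boxedInj b (.osum w₁ w₂) v) e₁ e₂)
        (.mux (.boxedLit b)
          (cond b (e₁'.inst v.toExpr) (e₁'.inst v₁.toExpr))
          (cond b (e₂'.inst v₂.toExpr) (e₂'.inst v.toExpr)))
  -- congruences
  | prodT {a a' b b' : Expr} :
      ParRed G a a' → ParRed G b b' → ParRed G (.prodT a b) (.prodT a' b')
  | osumT {a a' b b' : Expr} :
      ParRed G a a' → ParRed G b b' → ParRed G (.osumT a b) (.osumT a' b')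
  | pi {a a' b b' : Expr} : ParRed G a a' → ParRed G b b' → ParRed G (.pi a b) (.pi a' b')
  | oadt {T : Name} {e e' : Expr} : ParRed G e e' → ParRed G (.oadt T e) (.oadt T e')
  | abs {a a' b b' : Expr} : ParRed G a a' → ParRed G b b' → ParRed G (.abs a b) (.abs a' b')
  | letE {a a' b b' : Expr} : ParRed G a a' → ParRed G b b' → ParRed G (.letE a b) (.letE a' b')
  | app {a a' b b' : Expr} : ParRed G a a' → ParRed G b b' → ParRed G (.app a b) (.app a' b')
  | ctor {T : Name} {i : ℕ} {e e' : Expr} : ParRed G e e' → ParRed G (.ctor T i e) (.ctor T i e')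
  | ite {c c' a a' b b' : Expr} :
      ParRed G c c' → ParRed G a a' → ParRed G b b' → ParRed G (.ite c a b) (.ite c' a' b')
  | mux {c c' a a' b b' : Expr} :
      ParRed G c c' → ParRed G a a' → ParRed G b b' → ParRed G (.mux c a b) (.mux c' a' b')
  | pair {a a' b b' : Expr} : ParRed G a a' → ParRed G b b' → ParRed G (.pair a b) (.pair a' b')
  | psiPair {a a' b b' : Expr} :
      ParRed G a a' → ParRed G b b' → ParRed G (.psiPair a b) (.psiPair a' b')
  | proj {b : Bool} {e e' : Expr} : ParRed G e e' → ParRed G (.proj b e) (.proj b e')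
  | oinj {b : Bool} {a a' e e' : Expr} :
      ParRed G a a' → ParRed G e e' → ParRed G (.oinj b a e) (.oinj b a' e')
  | omatch {c c' a a' b b' : Expr} :
      ParRed G c c' → ParRed G a a' → ParRed G b b' → ParRed G (.omatch c a b) (.omatch c' a' b')
  | ematch {T : Name} {n : ℕ} {e e' : Expr} {bs bs' : Fin n → Expr} :
      ParRed G e e' → (∀ j, ParRed G (bs j) (bs' j)) →
      ParRed G (.ematch T n e bs) (.ematch T n e' bs')
  | sec {e e' : Expr} : ParRed G e e' → ParRed G (.sec e) (.sec e')

/-- Type equivalence: the equivalence relation generated by parallel reduction. -/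
def TyEquiv (G : GCtx) : Expr → Expr → Prop := Relation.EqvGen (ParRed G)

/-! ### Kinding and typing -/

/-- Kinds: any, public, oblivious, mixed. -/
inductive Kind : Type
  | any : Kind
  | pub : Kind
  | obl : Kind
  | mixed : Kind

/-- The order on kinds: `any` is least, `mixed` is greatest, `pub` and `obl` are incomparable. -/
def Kind.le (κ κ' : Kind) : Prop := κ = κ' ∨ κ = .any ∨ κ' = .mixed

/-- A typing context lists the types of the local variables, innermost first; the type of a
variable lives in the context of the variables declared before it. -/
abbrev Ctx := List Expr

/-- A function of mode `f` may be used in code of mode `m`: secure code never uses leaky code. -/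
def Mode.usable (f m : Mode) : Prop := m = .secure → f = .secure

mutual

/-- `Kinding G m Γ τ κ` : the type `τ` has kind `κ` in the context `Γ`. Components of global
definitions are closed up to their own parameter, so they are used in `Γ` without shifting. -/
inductive Kinding (G : GCtx) : Mode → Ctx → Expr → Kind → Prop
  | sub {m : Mode} {Γ : Ctx} {τ : Expr} {κ κ' : Kind} :
      Kinding G m Γ τ κ → κ.le κ' → Kinding G m Γ τ κ'
  | unit {m : Mode} {Γ : Ctx} : Kinding G m Γ .unitT .any
  | bool {m : Mode} {Γ : Ctx} : Kinding G m Γ .boolT .pub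
  | obool {m : Mode} {Γ : Ctx} : Kinding G m Γ .oboolT .obl
  | adt {m : Mode} {Γ : Ctx} {T : Name} {d : ADTDef} :
      G.adt T = some d → Kinding G m Γ (.adt T) .pub
  | oadt {m : Mode} {Γ : Ctx} {T : Name} {d : OADTDef} {e : Expr} :
      G.oadt T = some d → Typing G m Γ e d.view → Kinding G m Γ (.oadt T e) .obl
  | pi {m : Mode} {Γ : Ctx} {τ₁ τ₂ : Expr} {κ₁ κ₂ : Kind} :
      Kinding G m Γ τ₁ κ₁ → Kinding G m (τ₁ :: Γ) τ₂ κ₂ → Kinding G m Γ (.pi τ₁ τ₂) .mixed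
  | prod {m : Mode} {Γ : Ctx} {τ₁ τ₂ : Expr} {κ : Kind} :
      Kinding G m Γ τ₁ κ → Kinding G m Γ τ₂ κ → Kinding G m Γ (.prodT τ₁ τ₂) κ
  | osum {m : Mode} {Γ : Ctx} {τ₁ τ₂ : Expr} :
      Kinding G m Γ τ₁ .obl → Kinding G m Γ τ₂ .obl → Kinding G m Γ (.osumT τ₁ τ₂) .obl
  | psi {m : Mode} {Γ : Ctx} {T : Name} {d : OADTDef} :
      G.oadt T = some d → Kinding G m Γ (.psiT T) .mixed
  | letE {m : Mode} {Γ : Ctx} {e τ τ' : Expr} :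
      Typing G m Γ e τ → Kinding G m (τ :: Γ) τ' .obl → Kinding G m Γ (.letE e τ') .obl
  | ite {m : Mode} {Γ : Ctx} {e τ₁ τ₂ : Expr} :
      Typing G m Γ e .boolT → Kinding G m Γ τ₁ .obl → Kinding G m Γ τ₂ .obl →
      Kinding G m Γ (.ite e τ₁ τ₂) .obl
  | ematch {m : Mode} {Γ : Ctx} {T : Name} {n : ℕ} {arg bs : Fin n → Expr} {e : Expr} :
      G.adt T = some ⟨n, arg⟩ → Typing G m Γ e (.adt T) →
      (∀ i, Kinding G m (arg i :: Γ) (bs i) .obl) → Kinding G m Γ (.ematch T n e bs) .obl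

/-- `Typing G m Γ e τ` : the expression `e` has type `τ` in the context `Γ`. -/
inductive Typing (G : GCtx) : Mode → Ctx → Expr → Expr → Prop
  | conv {m : Mode} {Γ : Ctx} {e τ τ' : Expr} {κ : Kind} :
      Typing G m Γ e τ → TyEquiv G τ τ' → Kinding G m Γ τ' κ → Typing G m Γ e τ'
  | tt {m : Mode} {Γ : Ctx} : Typing G m Γ .tt .unitT
  | lit {m : Mode} {Γ : Ctx} {b : Bool} : Typing G m Γ (.lit b) .boolT
  | bvar {m : Mode} {Γ : Ctx} {x : ℕ} {τ : Expr} {κ : Kind} :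
      Γ[x]? = some τ → Kinding G m Γ (τ.rename (fun y => y + (x + 1))) κ →
      Typing G m Γ (.bvar x) (τ.rename (fun y => y + (x + 1)))
  | gvar {m : Mode} {Γ : Ctx} {f : Name} {d : FnDef} :
      G.fn f = some d → d.mode.usable m → Typing G m Γ (.gvar f) d.ty
  | abs {m : Mode} {Γ : Ctx} {τ₁ τ₂ e : Expr} {κ : Kind} :
      Kinding G m Γ τ₁ κ → Typing G m (τ₁ :: Γ) e τ₂ → Typing G m Γ (.abs τ₁ e) (.pi τ₁ τ₂)
  | app {m : Mode} {Γ : Ctx} {τ₁ τ₂ f e : Expr} :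
      Typing G m Γ f (.pi τ₁ τ₂) → Typing G m Γ e τ₁ → Typing G m Γ (.app f e) (τ₂.inst e)
  | letE {m : Mode} {Γ : Ctx} {τ₁ τ₂ e₁ e₂ : Expr} :
      Typing G m Γ e₁ τ₁ → Typing G m (τ₁ :: Γ) e₂ τ₂ →
      Typing G m Γ (.letE e₁ e₂) (τ₂.inst e₁)
  | pair {m : Mode} {Γ : Ctx} {τ₁ τ₂ e₁ e₂ : Expr} :
      Typing G m Γ e₁ τ₁ → Typing G m Γ e₂ τ₂ → Typing G m Γ (.pair e₁ e₂) (.prodT τ₁ τ₂)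
  | proj {m : Mode} {Γ : Ctx} {b : Bool} {τ₁ τ₂ e : Expr} :
      Typing G m Γ e (.prodT τ₁ τ₂) → Typing G m Γ (.proj b e) (cond b τ₁ τ₂)
  | ite {m : Mode} {Γ : Ctx} {e₀ e₁ e₂ τ : Expr} {κ : Kind} :
      Typing G m Γ e₀ .boolT → Typing G m Γ e₁ (τ.inst (.lit true)) →
      Typing G m Γ e₂ (τ.inst (.lit false)) → Kinding G m Γ (τ.inst e₀) κ →
      Typing G m Γ (.ite e₀ e₁ e₂) (τ.inst e₀)
  | ctor {m : Mode} {Γ : Ctx} {T : Name} {n : ℕ} {arg : Fin n → Expr} {i : Fin n} {e : Expr} :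
      G.adt T = some ⟨n, arg⟩ → Typing G m Γ e (arg i) → Typing G m Γ (.ctor T i e) (.adt T)
  | ematch {m : Mode} {Γ : Ctx} {T : Name} {n : ℕ} {arg bs : Fin n → Expr} {e₀ τ : Expr}
      {κ : Kind} :
      G.adt T = some ⟨n, arg⟩ → Typing G m Γ e₀ (.adt T) →
      (∀ i : Fin n, Typing G m (arg i :: Γ) (bs i) (τ.subst (ctorSub T i))) →
      Kinding G m Γ (τ.inst e₀) κ → Typing G m Γ (.ematch T n e₀ bs) (τ.inst e₀)
  | psiPair {m : Mode} {Γ : Ctx} {T : Name} {d : OADTDef} {e₁ e₂ : Expr} :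
      G.oadt T = some d → Typing G m Γ e₁ d.view → Typing G m Γ e₂ (.oadt T e₁) →
      Typing G m Γ (.psiPair e₁ e₂) (.psiT T)
  | psiProj₁ {m : Mode} {Γ : Ctx} {T : Name} {d : OADTDef} {e : Expr} :
      G.oadt T = some d → Typing G m Γ e (.psiT T) → Typing G m Γ (.proj true e) d.view
  | psiProj₂ {m : Mode} {Γ : Ctx} {T : Name} {d : OADTDef} {e : Expr} :
      G.oadt T = some d → Typing G m Γ e (.psiT T) →
      Typing G m Γ (.proj false e) (.oadt T (.proj true e))
  | mux {m : Mode} {Γ : Ctx} {e₀ e₁ e₂ τ : Expr} {κ : Kind} :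
      Typing G m Γ e₀ .oboolT → Kinding G m Γ τ κ → (m = .secure → κ = .obl) →
      Typing G m Γ e₁ τ → Typing G m Γ e₂ τ → Typing G m Γ (.mux e₀ e₁ e₂) τ
  | oinj {m : Mode} {Γ : Ctx} {b : Bool} {τ₁ τ₂ e : Expr} :
      Typing G m Γ e (cond b τ₁ τ₂) → Kinding G m Γ (.osumT τ₁ τ₂) .obl →
      Typing G m Γ (.oinj b (.osumT τ₁ τ₂) e) (.osumT τ₁ τ₂)
  | omatch {m : Mode} {Γ : Ctx} {e₀ e₁ e₂ τ₁ τ₂ τ : Expr} {κ : Kind} :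
      Typing G m Γ e₀ (.osumT τ₁ τ₂) → Kinding G m Γ τ κ → (m = .secure → κ = .obl) →
      Typing G m (τ₁ :: Γ) e₁ τ.shift → Typing G m (τ₂ :: Γ) e₂ τ.shift →
      Typing G m Γ (.omatch e₀ e₁ e₂) τ
  | sec {m : Mode} {Γ : Ctx} {e : Expr} : Typing G m Γ e .boolT → Typing G m Γ (.sec e) .oboolT
  | boxedLit {m : Mode} {Γ : Ctx} {b : Bool} : Typing G m Γ (.boxedLit b) .oboolT
  | boxedInj {m : Mode} {Γ : Ctx} {b : Bool} {w : OTy} {v : OVal} :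
      OValTy (.boxedInj b w v) w → Typing G m Γ (.boxedInj b w v) w.toExpr

end

/-- All global definitions are well-typed. -/
structure GCtx.WellTyped (G : GCtx) : Prop where
  fn : ∀ f d, G.fn f = some d →
    (∃ κ, Kinding G d.mode [] d.ty κ) ∧ Typing G d.mode [] d.body d.ty
  adt : ∀ T n arg, G.adt T = some ⟨n, arg⟩ → ∀ i, Kinding G .secure [] (arg i) .pub
  oadt : ∀ T d, G.oadt T = some d →
    Kinding G .secure [] d.view .pub ∧ Kinding G .secure [d.view] d.body .obl

/-- `v` is a closed value of type `τ`. -/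
def ValOf (G : GCtx) (v τ : Expr) : Prop := IsVal v ∧ Typing G .secure [] v τ

/-! ### Specification types and Psi-structures -/

/-- Specification types. The simple types are those without `obool` and `psi`. -/
inductive SpecTy : Type
  | unit : SpecTy
  | bool : SpecTy
  | obool : SpecTy
  | adt : Name → SpecTy
  | psi : Name → SpecTy
  | prod : SpecTy → SpecTy → SpecTy
  | arrow : SpecTy → SpecTy → SpecTy

/-- Specification types as types. They have no local variables, so the arrow needs no shift. -/
def SpecTy.toExpr : SpecTy → Expr
  | .unit => .unitT
  | .bool => .boolT
  | .obool => .oboolT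
  | .adt T => .adt T
  | .psi T => .psiT T
  | .prod a b => .prodT a.toExpr b.toExpr
  | .arrow a b => .pi a.toExpr b.toExpr

/-- Specification types have to be well-kinded: all their ADTs and OADTs are defined. -/
def SpecTy.WF (G : GCtx) (θ : SpecTy) : Prop := ∃ κ, Kinding G .secure [] θ.toExpr κ

/-- The data of an OADT-structure: the public ADT, section, retraction, view function, and the
relation `hasView v k` ("`v` has public view `k`"). -/
structure OADTStr where
  pub : Name
  s : Expr
  r : Expr
  view : Expr
  hasView : Expr → Expr → Prop

/-- The data of a join-structure of the OADT `oadt`. -/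
structure JoinStr where
  oadt : Name
  le : Expr → Expr → Prop
  join : Expr
  reshape : Expr

/-- One method of an intro-structure of `oadt`: the counterpart of the constructor with index
`idx`, of type `arg → psi oadt`. -/
structure IntroStr where
  oadt : Name
  idx : ℕ
  arg : SpecTy
  fn : Expr

/-- One method of an elim-structure of `oadt`: the counterpart of pattern matching with `n`
alternatives and return type `ret`. -/
structure ElimStr where
  oadt : Name
  n : ℕ
  arg : Fin n → SpecTy
  ret : SpecTy
  fn : Expr

/-- The data of a coercion-structure. -/
structure CoerStr where
  src : Name
  tgt : Name
  fn : Expr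

/-- A Psi-structure context. Every OADT has one OADT-structure (the value of `oadt` at a name that
is not a defined OADT is irrelevant); the other structures are optional. -/
structure PsiCtx where
  oadt : Name → OADTStr
  join : Set JoinStr
  intro : Set IntroStr
  elim : Set ElimStr
  coer : Set CoerStr

/-- Erasure of a specification type to its underlying simple type. -/
def SpecTy.erase (S : PsiCtx) : SpecTy → SpecTy
  | .unit => .unit
  | .bool => .bool
  | .obool => .bool
  | .adt T => .adt T
  | .psi T => .adt (S.oadt T).pub
  | .prod a b => .prod (a.erase S) (b.erase S)
  | .arrow a b => .arrow (a.erase S) (b.erase S)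

/-! ### Logical refinement -/

/-- The expression interpretation at step `n` for target type `θ`, given the value
interpretation `V` of `θ`. -/
def liftE (G : GCtx) (S : PsiCtx) (θ : SpecTy) (V : ℕ → Expr → Expr → Prop) (n : ℕ)
    (e e' : Expr) : Prop :=
  Typing G .secure [] e (θ.erase S).toExpr ∧ Typing G .secure [] e' θ.toExpr ∧
    ∀ i < n, ∀ v', IsVal v' → StepN G i e' v' →
      ∃ v, IsVal v ∧ Steps G e v ∧ V (n - i) v v'

/-- The requirement common to all value interpretations: both components are closed values of the
appropriate types. -/
def valPair (G : GCtx) (S : PsiCtx) (θ : SpecTy) (v v' : Expr) : Prop :=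
  ValOf G v (θ.erase S).toExpr ∧ ValOf G v' θ.toExpr

/-- The value interpretation of specification types. -/
def interpV (G : GCtx) (S : PsiCtx) : SpecTy → ℕ → Expr → Expr → Prop
  | .unit, n, v, v' => valPair G S .unit v v' ∧ (0 < n → v = v')
  | .bool, n, v, v' => valPair G S .bool v v' ∧ (0 < n → v = v')
  | .adt T, n, v, v' => valPair G S (.adt T) v v' ∧ (0 < n → v = v')
  | .obool, n, v, v' => valPair G S .obool v v' ∧
      ∃ b b', v = .lit b ∧ v' = .boxedLit b' ∧ (0 < n → b = b')
  | .psi T, n, v, v' => valPair G S (.psi T) v v' ∧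
      ∃ k u, v' = .psiPair k u ∧ (0 < n → Steps G (.app (.app (S.oadt T).r k) u) v)
  | .prod a b, n, v, v' => valPair G S (.prod a b) v v' ∧
      ∃ v₁ v₂ v₁' v₂', v = .pair v₁ v₂ ∧ v' = .pair v₁' v₂' ∧
        interpV G S a n v₁ v₁' ∧ interpV G S b n v₂ v₂'
  | .arrow a b, n, v, v' => valPair G S (.arrow a b) v v' ∧
      ∃ τ e τ' e', v = .abs τ e ∧ v' = .abs τ' e' ∧
        ∀ i < n, ∀ u u', interpV G S a i u u' →
          liftE G S b (fun j => interpV G S b j) i (e.inst u) (e'.inst u')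

/-- The expression interpretation of specification types. -/
def interpE (G : GCtx) (S : PsiCtx) (θ : SpecTy) (n : ℕ) (e e' : Expr) : Prop :=
  liftE G S θ (fun j => interpV G S θ j) n e e'

/-! ### Validity of Psi-structures

The view type of an OADT and the operations of the structures are closed (they are typed in the
empty context), so they are placed under binders without shifting. -/

/-- Typing and axioms of the OADT-structure `o` of an OADT `T` with definition `d`. -/
structure OADTStr.Valid (G : GCtx) (T : Name) (d : OADTDef) (o : OADTStr) : Prop where
  pub_kind : Kinding G .secure [] (.adt o.pub) .pub
  s_ty : Typing G .secure [] o.s (.pi d.view (.pi (.adt o.pub) (.oadt T (.bvar 1))))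
  r_ty : Typing G .leaky [] o.r (.pi d.view (.pi (.oadt T (.bvar 0)) (.adt o.pub)))
  view_ty : Typing G .secure [] o.view (.pi (.adt o.pub) d.view)
  ret_sec : ∀ v k u, ValOf G v (.adt o.pub) → ValOf G k d.view → ValOf G u (.oadt T k) →
    o.hasView v k → Steps G (.app (.app o.s k) v) u → Steps G (.app (.app o.r k) u) v
  ret_view : ∀ v k u, ValOf G v (.adt o.pub) → ValOf G k d.view → ValOf G u (.oadt T k) →
    Steps G (.app (.app o.r k) u) v → o.hasView v k
  view_view : ∀ v k, ValOf G v (.adt o.pub) → ValOf G k d.view →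
    Steps G (.app o.view v) k → o.hasView v k

/-- Typing and axioms of a join-structure of an OADT with definition `d` and OADT-structure `o`. -/
structure JoinStr.Valid (G : GCtx) (d : OADTDef) (o : OADTStr) (j : JoinStr) : Prop where
  join_ty : Typing G .secure [] j.join (.pi d.view (.pi d.view d.view))
  reshape_ty : Typing G .secure [] j.reshape
    (.pi d.view (.pi d.view (.pi (.oadt j.oadt (.bvar 1)) (.oadt j.oadt (.bvar 1)))))
  le_refl : ∀ k, ValOf G k d.view → j.le k k
  le_trans : ∀ k₁ k₂ k₃, ValOf G k₁ d.view → ValOf G k₂ d.view → ValOf G k₃ d.view →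
    j.le k₁ k₂ → j.le k₂ k₃ → j.le k₁ k₃
  le_antisymm : ∀ k₁ k₂, ValOf G k₁ d.view → ValOf G k₂ d.view →
    j.le k₁ k₂ → j.le k₂ k₁ → k₁ = k₂
  join_upper : ∀ k₁ k₂ k, ValOf G k₁ d.view → ValOf G k₂ d.view → ValOf G k d.view →
    Steps G (.app (.app j.join k₁) k₂) k → j.le k₁ k ∧ j.le k₂ k
  view_mono : ∀ v k k', ValOf G v (.adt o.pub) → ValOf G k d.view → ValOf G k' d.view →
    o.hasView v k → j.le k k' → o.hasView v k'
  reshape_ret : ∀ v k k' u u', ValOf G v (.adt o.pub) → ValOf G k d.view → ValOf G k' d.view →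
    ValOf G u (.oadt j.oadt k) → ValOf G u' (.oadt j.oadt k') →
    Steps G (.app (.app o.r k) u) v → o.hasView v k' →
    Steps G (.app (.app (.app j.reshape k) k') u) u' → Steps G (.app (.app o.r k') u') v

/-- Typing and axiom of an intro-structure method: it refines the constructor. -/
structure IntroStr.Valid (G : GCtx) (S : PsiCtx) (c : IntroStr) : Prop where
  oadt_def : ∃ d, G.oadt c.oadt = some d
  compat : ∃ n arg, ∃ i : Fin n, G.adt (S.oadt c.oadt).pub = some ⟨n, arg⟩ ∧
    c.idx = i ∧ (c.arg.erase S).toExpr = arg i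
  fn_ty : Typing G .secure [] c.fn (SpecTy.arrow c.arg (.psi c.oadt)).toExpr
  refines : ∀ n v v', interpV G S c.arg n v v' →
    interpE G S (.psi c.oadt) n (.ctor (S.oadt c.oadt).pub c.idx v) (.app c.fn v')

/-- The curried application of `f` to finitely many arguments. -/
def apps {n : ℕ} (f : Expr) (as : Fin n → Expr) : Expr := (List.ofFn as).foldl Expr.app f

/-- The type `psi T → (θ_0 → α) → ... → (θ_(n-1) → α) → α` of an elim-structure method. -/
def ElimStr.ty (m : ElimStr) : SpecTy :=
  .arrow (.psi m.oadt)
    ((List.ofFn fun i => SpecTy.arrow (m.arg i) m.ret).foldr SpecTy.arrow m.ret)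

/-- Typing and axiom of an elim-structure method: it refines pattern matching. -/
structure ElimStr.Valid (G : GCtx) (S : PsiCtx) (m : ElimStr) : Prop where
  oadt_def : ∃ d, G.oadt m.oadt = some d
  compat : ∃ arg, G.adt (S.oadt m.oadt).pub = some ⟨m.n, arg⟩ ∧
    ∀ i, ((m.arg i).erase S).toExpr = arg i
  fn_ty : Typing G .secure [] m.fn m.ty.toExpr
  refines : ∀ (n : ℕ) (i : Fin m.n) (v k u : Expr) (es es' : Fin m.n → Expr),
    ValOf G v ((m.arg i).erase S).toExpr → ValOf G (.psiPair k u) (.psiT m.oadt) →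
    Steps G (.app (.app (S.oadt m.oadt).r k) u) (.ctor (S.oadt m.oadt).pub i v) →
    (∀ j, interpV G S (.arrow (m.arg j) m.ret) n
      (.abs ((m.arg j).erase S).toExpr (es j)) (.abs (m.arg j).toExpr (es' j))) →
    interpE G S m.ret n ((es i).inst v)
      (apps (.app m.fn (.psiPair k u)) fun j => .abs (m.arg j).toExpr (es' j))

/-- Typing and axiom of a coercion-structure between two compatible OADTs. -/
structure CoerStr.Valid (G : GCtx) (S : PsiCtx) (c : CoerStr) : Prop where
  src_def : ∃ d, G.oadt c.src = some d
  tgt_def : ∃ d, G.oadt c.tgt = some d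
  compat : (S.oadt c.src).pub = (S.oadt c.tgt).pub
  fn_ty : Typing G .secure [] c.fn (SpecTy.arrow (.psi c.src) (.psi c.tgt)).toExpr
  coerces : ∀ v k u k' u', ValOf G v (.adt (S.oadt c.src).pub) →
    ValOf G (.psiPair k u) (.psiT c.src) → ValOf G (.psiPair k' u') (.psiT c.tgt) →
    Steps G (.app (.app (S.oadt c.src).r k) u) v →
    Steps G (.app c.fn (.psiPair k u)) (.psiPair k' u') →
    Steps G (.app (.app (S.oadt c.tgt).r k') u') v

/-- All structures of a Psi-structure context are what they claim to be. -/
structure PsiCtx.Valid (G : GCtx) (S : PsiCtx) : Prop where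
  oadt : ∀ T d, G.oadt T = some d → (S.oadt T).Valid G T d
  join : ∀ j ∈ S.join, ∃ d, G.oadt j.oadt = some d ∧ j.Valid G d (S.oadt j.oadt)
  intro : ∀ c ∈ S.intro, c.Valid G S
  elim : ∀ m ∈ S.elim, m.Valid G S
  coer : ∀ c ∈ S.coer, c.Valid G S

/-! ### Mergeability, coercion, lifting -/

/-- `λ b : obool. λ x : θ. λ y : θ. body`; in `body`, `b`, `x`, `y` are variables `2`, `1`, `0`. -/
def iteFun (θ : SpecTy) (body : Expr) : Expr :=
  .abs .oboolT (.abs θ.toExpr (.abs θ.toExpr body))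

/-- `app3 f a b c` is `f a b c`. -/
def app3 (f a b c : Expr) : Expr := .app (.app (.app f a) b) c

/-- `Mergeable S θ ite` : the type `θ` is mergeable with witness `ite`. -/
inductive Mergeable (S : PsiCtx) : SpecTy → Expr → Prop
  | unit : Mergeable S .unit (iteFun .unit (.mux (.bvar 2) (.bvar 1) (.bvar 0)))
  | obool : Mergeable S .obool (iteFun .obool (.mux (.bvar 2) (.bvar 1) (.bvar 0)))
  | psi {j : JoinStr} : j ∈ S.join →
      Mergeable S (.psi j.oadt) (iteFun (.psi j.oadt)
        (.letE (.app (.app j.join (.proj true (.bvar 1))) (.proj true (.bvar 0)))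
          (.psiPair (.bvar 0)
            (.mux (.bvar 3)
              (app3 j.reshape (.proj true (.bvar 2)) (.bvar 0) (.proj false (.bvar 2)))
              (app3 j.reshape (.proj true (.bvar 1)) (.bvar 0) (.proj false (.bvar 1)))))))
  | prod {θ₁ θ₂ : SpecTy} {ite₁ ite₂ : Expr} :
      Mergeable S θ₁ ite₁ → Mergeable S θ₂ ite₂ →
      Mergeable S (.prod θ₁ θ₂) (iteFun (.prod θ₁ θ₂)
        (.pair
          (app3 ite₁ (.bvar 2) (.proj true (.bvar 1)) (.proj true (.bvar 0)))
          (app3 ite₂ (.bvar 2) (.proj false (.bvar 1)) (.proj false (.bvar 0)))))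
  | arrow {θ₁ θ₂ : SpecTy} {ite₂ : Expr} :
      Mergeable S θ₂ ite₂ →
      Mergeable S (.arrow θ₁ θ₂) (iteFun (.arrow θ₁ θ₂)
        (.abs θ₁.toExpr
          (app3 ite₂ (.bvar 3) (.app (.bvar 2) (.bvar 0)) (.app (.bvar 1) (.bvar 0)))))

/-- `Coercible G S θ θ' c` : the type `θ` is coercible to `θ'` with witness `c`. -/
inductive Coercible (G : GCtx) (S : PsiCtx) : SpecTy → SpecTy → Expr → Prop
  | refl (θ : SpecTy) : Coercible G S θ θ (.abs θ.toExpr (.bvar 0))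
  | bool : Coercible G S .bool .obool (.abs .boolT (.sec (.bvar 0)))
  | adt {T : Name} {d : OADTDef} : G.oadt T = some d →
      Coercible G S (.adt (S.oadt T).pub) (.psi T)
        (.abs (.adt (S.oadt T).pub)
          (.psiPair (.app (S.oadt T).view (.bvar 0))
            (.app (.app (S.oadt T).s (.app (S.oadt T).view (.bvar 0))) (.bvar 0))))
  | psi {c : CoerStr} : c ∈ S.coer → Coercible G S (.psi c.src) (.psi c.tgt) c.fn
  | prod {θ₁ θ₂ θ₁' θ₂' : SpecTy} {c₁ c₂ : Expr} :
      Coercible G S θ₁ θ₁' c₁ → Coercible G S θ₂ θ₂' c₂ →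
      Coercible G S (.prod θ₁ θ₂) (.prod θ₁' θ₂')
        (.abs (SpecTy.prod θ₁ θ₂).toExpr
          (.pair (.app c₁ (.proj true (.bvar 0))) (.app c₂ (.proj false (.bvar 0)))))
  | arrow {θ₁ θ₂ θ₁' θ₂' : SpecTy} {c₁ c₂ : Expr} :
      Coercible G S θ₁' θ₁ c₁ → Coercible G S θ₂ θ₂' c₂ →
      Coercible G S (.arrow θ₁ θ₂) (.arrow θ₁' θ₂')
        (.abs (SpecTy.arrow θ₁ θ₂).toExpr
          (.abs θ₁'.toExpr (.app c₂ (.app (.bvar 1) (.app c₁ (.bvar 0))))))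

/-- An entry `src :: ty ▷ tgt` of a lifting context: the global function `src` is lifted to the
generated global function `tgt` of specification type `ty`. -/
structure LiftEntry where
  src : Name
  ty : SpecTy
  tgt : Name

/-- `Lifts G S L Γ e θ e'` : under the contexts, the expression `e` of type `θ.erase S` is lifted to
`e'` of type `θ`. The local context `Γ` lists the target types of the local variables. -/
inductive Lifts (G : GCtx) (S : PsiCtx) (L : Set LiftEntry) :
    List SpecTy → Expr → SpecTy → Expr → Prop
  | unit {Γ : List SpecTy} : Lifts G S L Γ .tt .unit .tt
  | lit {Γ : List SpecTy} {b : Bool} : Lifts G S L Γ (.lit b) .bool (.lit b)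
  | var {Γ : List SpecTy} {x : ℕ} {θ : SpecTy} :
      Γ[x]? = some θ → Lifts G S L Γ (.bvar x) θ (.bvar x)
  | fn {Γ : List SpecTy} {l : LiftEntry} :
      l ∈ L → Lifts G S L Γ (.gvar l.src) l.ty (.gvar l.tgt)
  | abs {Γ : List SpecTy} {θ₁ θ₂ : SpecTy} {e e' : Expr} :
      θ₁.WF G → Lifts G S L (θ₁ :: Γ) e θ₂ e' →
      Lifts G S L Γ (.abs (θ₁.erase S).toExpr e) (.arrow θ₁ θ₂) (.abs θ₁.toExpr e')
  | app {Γ : List SpecTy} {θ₁ θ₂ : SpecTy} {e₁ e₁' e₂ e₂' : Expr} :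
      Lifts G S L Γ e₂ (.arrow θ₁ θ₂) e₂' → Lifts G S L Γ e₁ θ₁ e₁' →
      Lifts G S L Γ (.app e₂ e₁) θ₂ (.app e₂' e₁')
  | letE {Γ : List SpecTy} {θ₁ θ₂ : SpecTy} {e₁ e₁' e₂ e₂' : Expr} :
      Lifts G S L Γ e₁ θ₁ e₁' → Lifts G S L (θ₁ :: Γ) e₂ θ₂ e₂' →
      Lifts G S L Γ (.letE e₁ e₂) θ₂ (.letE e₁' e₂')
  | pair {Γ : List SpecTy} {θ₁ θ₂ : SpecTy} {e₁ e₁' e₂ e₂' : Expr} :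
      Lifts G S L Γ e₁ θ₁ e₁' → Lifts G S L Γ e₂ θ₂ e₂' →
      Lifts G S L Γ (.pair e₁ e₂) (.prod θ₁ θ₂) (.pair e₁' e₂')
  | proj {Γ : List SpecTy} {b : Bool} {θ₁ θ₂ : SpecTy} {e e' : Expr} :
      Lifts G S L Γ e (.prod θ₁ θ₂) e' →
      Lifts G S L Γ (.proj b e) (cond b θ₁ θ₂) (.proj b e')
  | ite₁ {Γ : List SpecTy} {θ : SpecTy} {e₀ e₀' e₁ e₁' e₂ e₂' : Expr} :
      Lifts G S L Γ e₀ .bool e₀' → Lifts G S L Γ e₁ θ e₁' → Lifts G S L Γ e₂ θ e₂' →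
      Lifts G S L Γ (.ite e₀ e₁ e₂) θ (.ite e₀' e₁' e₂')
  | ite₂ {Γ : List SpecTy} {θ : SpecTy} {e₀ e₀' e₁ e₁' e₂ e₂' ite : Expr} :
      Lifts G S L Γ e₀ .obool e₀' → Mergeable S θ ite →
      Lifts G S L Γ e₁ θ e₁' → Lifts G S L Γ e₂ θ e₂' →
      Lifts G S L Γ (.ite e₀ e₁ e₂) θ (app3 ite e₀' e₁' e₂')
  | ctor₁ {Γ : List SpecTy} {T : Name} {n : ℕ} {arg : Fin n → Expr} {i : Fin n} {η : SpecTy}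
      {e e' : Expr} :
      G.adt T = some ⟨n, arg⟩ → η.toExpr = arg i → Lifts G S L Γ e η e' →
      Lifts G S L Γ (.ctor T i e) (.adt T) (.ctor T i e')
  | ctor₂ {Γ : List SpecTy} {c : IntroStr} {e e' : Expr} :
      c ∈ S.intro → Lifts G S L Γ e c.arg e' →
      Lifts G S L Γ (.ctor (S.oadt c.oadt).pub c.idx e) (.psi c.oadt) (.app c.fn e')
  | ematch₁ {Γ : List SpecTy} {T : Name} {n : ℕ} {arg : Fin n → Expr} {η : Fin n → SpecTy}
      {θ : SpecTy} {e₀ e₀' : Expr} {bs bs' : Fin n → Expr} :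
      G.adt T = some ⟨n, arg⟩ → (∀ i, (η i).toExpr = arg i) → θ.WF G →
      Lifts G S L Γ e₀ (.adt T) e₀' → (∀ i, Lifts G S L (η i :: Γ) (bs i) θ (bs' i)) →
      Lifts G S L Γ (.ematch T n e₀ bs) θ (.ematch T n e₀' bs')
  | ematch₂ {Γ : List SpecTy} {m : ElimStr} {e₀ e₀' : Expr} {bs bs' : Fin m.n → Expr} :
      m ∈ S.elim → Lifts G S L Γ e₀ (.psi m.oadt) e₀' →
      (∀ i, Lifts G S L (m.arg i :: Γ) (bs i) m.ret (bs' i)) →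
      Lifts G S L Γ (.ematch (S.oadt m.oadt).pub m.n e₀ bs) m.ret
        (apps (.app m.fn e₀') fun i => .abs (m.arg i).toExpr (bs' i))
  | coerce {Γ : List SpecTy} {θ θ' : SpecTy} {e e' c : Expr} :
      Lifts G S L Γ e θ e' → Coercible G S θ θ' c → Lifts G S L Γ e θ' (.app c e')

/-- A lifting context is derivable if the body of every target function is a lifting of the body of
its source function, under this very lifting context. -/
def Derivable (G : GCtx) (S : PsiCtx) (L : Set LiftEntry) : Prop :=
  ∀ l ∈ L, ∃ e e', G.fn l.src = some ⟨.secure, (l.ty.erase S).toExpr, e⟩ ∧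
    G.fn l.tgt = some ⟨.secure, l.ty.toExpr, e'⟩ ∧ Lifts G S L [] e l.ty e'

/-- A lifting context is `n`-valid if every target function refines its source at step `n`. -/
def NValid (G : GCtx) (S : PsiCtx) (n : ℕ) (L : Set LiftEntry) : Prop :=
  ∀ l ∈ L, interpE G S l.ty n (.gvar l.src) (.gvar l.tgt)

/-- A lifting context is valid if it is `n`-valid for all `n`. -/
def ValidCtx (G : GCtx) (S : PsiCtx) (L : Set LiftEntry) : Prop := ∀ n, NValid G S n L

end OADT

-- The proof is a step-indexed logical-relations argument. The fundamental theorem `Lifts.refines`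
-- says that if `L` is `N`-valid, then a lifting judgment sends closing substitutions related at an
-- index `n ≤ N` to expressions related at `n`. Validity of `L` follows by induction on the index:
-- everything is vacuous at `0`, and at `n + 1` the generated name unfolds to its body in one target
-- step, so the remaining budget is `n` and the fundamental theorem under `n`-validity applies.
-- Counting only the steps of the target is what breaks the circularity of mutually recursive
-- functions lifted under `L` itself.
--
-- The relation pairs typed closed terms, so its closure under evaluation needs subject reduction.
-- Since types depend on terms and conversion is available, that requires injectivity and
-- disjointness of type formers, hence confluence. Plain parallel reduction has no complete
-- developments: an oblivious match becomes a `mux` containing arbitrarily chosen dummy values, and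
-- different choices are not reducts of one another. `ExtRed` adds the direct jump to the selected
-- branch. That branch is a common target of all choices, so Takahashi's triangle property holds
-- (`ExtRed.triangle`). A jump is two ordinary parallel steps (`ExtRed.exists_parRed`), so the
-- generated equivalence is unchanged. From this come `TyEquiv.head_eq`, `TyEquiv.pi_inj` and its
-- analogues, then `Judgment.preservation` and canonical forms (`IsVal.canon`).
--
-- The dummy values also make evaluation nondeterministic, so the refinement has to handle every
-- target reduction. Two tools suffice: a reduction to a value can be cut at an evaluation context
-- (`StepN.ctx_inv`), and a prefix of steps with unique reducts can be removed (`Dets.steps_inv`).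
-- On the level of the relation they become `Refines.bind` and `Refines.det_pred`.
--
-- The rules specific to lifting rest on `Coercible.refines` and `Mergeable.refines`. A coercion
-- relates its result to the same source value. A merge evaluates both branches on the target and
-- selects one, and the source value selected by the same Boolean refines it; for Psi-types both
-- branches are first reshaped to the join of their views, and the axioms carry the retractions
-- along. The coercion from an ADT to a Psi-type computes the view twice. The two results agree even
-- though reduction is nondeterministic, because convertible values of a public type are equal
-- (`IsVal.pub_eq`).

namespace OADT

/-! ### Algebra of renamings and substitutions -/

theorem upRen_id : upRen (fun n => n) = fun n => n := by
  funext n; cases n <;> rfl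

theorem upSub_bvar : upSub Expr.bvar = Expr.bvar := by
  funext n; cases n <;> rfl

theorem upRen_comp (ξ ζ : ℕ → ℕ) : (fun n => upRen ζ (upRen ξ n)) = upRen fun n => ζ (ξ n) := by
  funext n; cases n <;> rfl

theorem upSub_upRen (σ : ℕ → Expr) (ξ : ℕ → ℕ) :
    (fun n => upSub σ (upRen ξ n)) = upSub fun n => σ (ξ n) := by
  funext n; cases n <;> rfl

theorem upSub_bvar_comp (ξ : ℕ → ℕ) :
    upSub (fun n => .bvar (ξ n)) = fun n => .bvar (upRen ξ n) := by
  funext n; cases n <;> rfl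

/-- Renamings are substitutions by variables, so several renaming identities below are special cases
of substitution identities. -/
theorem Expr.rename_eq_subst (e : Expr) (ξ : ℕ → ℕ) :
    e.rename ξ = e.subst fun n => .bvar (ξ n) := by
  induction e generalizing ξ <;> simp_all [rename, subst, upSub_bvar_comp]

theorem Expr.subst_bvar (e : Expr) : e.subst .bvar = e := by
  induction e <;> simp_all [subst, upSub_bvar]

theorem Expr.rename_rename (e : Expr) (ξ ζ : ℕ → ℕ) :
    (e.rename ξ).rename ζ = e.rename fun n => ζ (ξ n) := by
  induction e generalizing ξ ζ <;> simp_all [rename, upRen_comp]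

theorem Expr.rename_subst (e : Expr) (ξ : ℕ → ℕ) (σ : ℕ → Expr) :
    (e.rename ξ).subst σ = e.subst fun n => σ (ξ n) := by
  induction e generalizing ξ σ <;> simp_all [rename, subst, upSub_upRen]

theorem upSub_rename (σ : ℕ → Expr) (ξ : ℕ → ℕ) :
    (fun n => (upSub σ n).rename (upRen ξ)) = upSub fun n => (σ n).rename ξ := by
  funext n; cases n with
  | zero => rfl
  | succ n => simp [upSub, Expr.shift, Expr.rename_rename, upRen]

theorem Expr.subst_rename (e : Expr) (σ : ℕ → Expr) (ξ : ℕ → ℕ) :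
    (e.subst σ).rename ξ = e.subst fun n => (σ n).rename ξ := by
  induction e generalizing ξ σ <;> simp_all [rename, subst, upSub_rename]

theorem upSub_subst (σ ρ : ℕ → Expr) :
    (fun n => (upSub σ n).subst (upSub ρ)) = upSub fun n => (σ n).subst ρ := by
  funext n; cases n with
  | zero => rfl
  | succ n => simp [upSub, Expr.shift, Expr.rename_subst, Expr.subst_rename]

theorem Expr.subst_subst (e : Expr) (σ ρ : ℕ → Expr) :
    (e.subst σ).subst ρ = e.subst fun n => (σ n).subst ρ := by
  induction e generalizing σ ρ <;> simp_all [subst, upSub_subst]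

theorem OTy.subst_toExpr (w : OTy) (σ : ℕ → Expr) : w.toExpr.subst σ = w.toExpr := by
  induction w <;> simp_all [toExpr, Expr.subst]

theorem OVal.subst_toExpr (v : OVal) (σ : ℕ → Expr) : v.toExpr.subst σ = v.toExpr := by
  induction v <;> simp_all [toExpr, Expr.subst]

theorem SpecTy.subst_toExpr (θ : SpecTy) (σ : ℕ → Expr) : θ.toExpr.subst σ = θ.toExpr := by
  induction θ generalizing σ <;> simp_all [toExpr, Expr.subst]

theorem SpecTy.rename_toExpr (θ : SpecTy) (ξ : ℕ → ℕ) : θ.toExpr.rename ξ = θ.toExpr := by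
  rw [Expr.rename_eq_subst, subst_toExpr]

theorem SpecTy.inst_toExpr (θ : SpecTy) (u : Expr) : θ.toExpr.inst u = θ.toExpr :=
  subst_toExpr _ _

theorem Expr.shift_subst_upSub (e : Expr) (σ : ℕ → Expr) :
    e.shift.subst (upSub σ) = (e.subst σ).shift := by
  simp [shift, rename_subst, subst_rename, upSub]

theorem Expr.shift_rename_upRen (e : Expr) (ξ : ℕ → ℕ) :
    e.shift.rename (upRen ξ) = (e.rename ξ).shift := by
  simp [shift, rename_rename, upRen]

theorem Expr.shift_inst (e u : Expr) : e.shift.inst u = e := by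
  simp only [shift, inst, rename_subst, instSub]
  exact e.subst_bvar

theorem Expr.inst_subst (e u : Expr) (σ : ℕ → Expr) :
    (e.inst u).subst σ = (e.subst (upSub σ)).inst (u.subst σ) := by
  simp only [inst, subst_subst]
  congr 1; funext n
  cases n with
  | zero => rfl
  | succ n =>
    simp only [upSub, instSub, subst]
    exact (shift_inst _ _).symm

theorem Expr.inst_rename (e u : Expr) (ξ : ℕ → ℕ) :
    (e.inst u).rename ξ = (e.rename (upRen ξ)).inst (u.rename ξ) := by
  simp only [rename_eq_subst, inst_subst, upSub_bvar_comp]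

/-- The substitution that maps the innermost variable to `u` and is `σ` elsewhere. -/
def consSub (u : Expr) (σ : ℕ → Expr) : ℕ → Expr
  | 0 => u
  | n + 1 => σ n

/-- Closing a term under a binder and then supplying the bound value amounts to extending the
closing substitution. The binder cases of the fundamental theorem rely on this identity. -/
theorem Expr.subst_upSub_inst (e u : Expr) (σ : ℕ → Expr) :
    (e.subst (upSub σ)).inst u = e.subst (consSub u σ) := by
  simp only [inst, subst_subst]
  congr 1; funext n
  cases n with
  | zero => rfl
  | succ n => exact shift_inst _ _

/-- A branch of a dependent match is typed by the motive at `C_i x`; this commutation lets the match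
rule survive substitution. -/
theorem Expr.ctorSub_subst (e : Expr) (T : Name) (i : ℕ) (σ : ℕ → Expr) :
    (e.subst (ctorSub T i)).subst (upSub σ) = (e.subst (upSub σ)).subst (ctorSub T i) := by
  simp only [subst_subst]
  congr 1; funext n
  cases n with
  | zero => rfl
  | succ n =>
    simp only [ctorSub, subst, upSub, shift, rename_subst]
    rw [rename_eq_subst]

theorem Expr.ctorSub_rename (e : Expr) (T : Name) (i : ℕ) (ξ : ℕ → ℕ) :
    (e.subst (ctorSub T i)).rename (upRen ξ) = (e.rename (upRen ξ)).subst (ctorSub T i) := by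
  simp only [rename_eq_subst, ← upSub_bvar_comp, ctorSub_subst]

theorem Expr.ctorSub_inst (e : Expr) (T : Name) (i : ℕ) (u : Expr) :
    (e.subst (ctorSub T i)).inst u = e.inst (.ctor T i u) := by
  simp only [inst, subst_subst]
  congr 1; funext n
  cases n <;> rfl

/-- Only the `k` innermost variables occur in `e`. -/
def Expr.Scoped (k : ℕ) (e : Expr) : Prop :=
  ∀ σ ρ : ℕ → Expr, (∀ x < k, σ x = ρ x) → e.subst σ = e.subst ρ

/-- No variables occur in `e`. -/
abbrev Expr.Closed (e : Expr) : Prop := e.Scoped 0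

/-- Scoping is defined by insensitivity to the substitution, so comparison with the identity
substitution suffices and no induction on `e` is needed. -/
theorem Expr.Closed.subst_eq {e : Expr} (h : e.Closed) (σ : ℕ → Expr) : e.subst σ = e := by
  rw [h σ .bvar (by simp), subst_bvar]

theorem Expr.Closed.rename_eq {e : Expr} (h : e.Closed) (ξ : ℕ → ℕ) : e.rename ξ = e := by
  rw [rename_eq_subst, h.subst_eq]

theorem Expr.Closed.shift_eq {e : Expr} (h : e.Closed) : e.shift = e := h.rename_eq _

theorem Expr.Closed.inst_eq {e : Expr} (h : e.Closed) (u : Expr) : e.inst u = e := h.subst_eq _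

theorem Expr.Scoped.inst_subst {e : Expr} (h : e.Scoped 1) (u : Expr) (σ : ℕ → Expr) :
    (e.inst u).subst σ = e.inst (u.subst σ) := by
  simp only [inst, subst_subst]
  apply h
  intro x hx
  obtain rfl : x = 0 := by omega
  rfl

theorem upSub_agree {k : ℕ} {σ ρ : ℕ → Expr} (h : ∀ x < k, σ x = ρ x) :
    ∀ x < k + 1, upSub σ x = upSub ρ x := by
  intro x hx
  cases x with
  | zero => rfl
  | succ x => simp [upSub, h x (by omega)]

/-! ### Closed global contexts -/

/-- The components of all global definitions have no free variables. -/
structure GCtx.Closed (G : GCtx) : Prop where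
  ty : ∀ f d, G.fn f = some d → d.ty.Closed
  body : ∀ f d, G.fn f = some d → d.body.Closed
  arg : ∀ T n arg, G.adt T = some ⟨n, arg⟩ → ∀ i, (arg i).Closed
  view : ∀ T d, G.oadt T = some d → d.view.Closed
  obody : ∀ T d, G.oadt T = some d → d.body.Scoped 1

/-! ### Parallel reduction that may skip the intermediate `mux` of an oblivious match -/

/-- Parallel reduction in which, if `x` holds, an oblivious match may reduce directly to the
chosen branch. -/
inductive ExtRed (G : GCtx) (x : Prop) : Expr → Expr → Prop
  | refl (e : Expr) : ExtRed G x e e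
  -- reductions
  | fn {f : Name} {d : FnDef} : G.fn f = some d → ExtRed G x (.gvar f) d.body
  | oadtR {T : Name} {d : OADTDef} {e e' : Expr} :
      G.oadt T = some d → ExtRed G x e e' → ExtRed G x (.oadt T e) (d.body.inst e')
  | beta {τ e e' u u' : Expr} :
      ExtRed G x e e' → ExtRed G x u u' → ExtRed G x (.app (.abs τ e) u) (e'.inst u')
  | letR {e e' u u' : Expr} :
      ExtRed G x u u' → ExtRed G x e e' → ExtRed G x (.letE u e) (e'.inst u')
  | iteR {b : Bool} {e₁ e₁' e₂ e₂' : Expr} :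
      ExtRed G x e₁ e₁' → ExtRed G x e₂ e₂' → ExtRed G x (.ite (.lit b) e₁ e₂) (cond b e₁' e₂')
  | muxR {b : Bool} {e₁ e₁' e₂ e₂' : Expr} :
      ExtRed G x e₁ e₁' → ExtRed G x e₂ e₂' → ExtRed G x (.mux (.boxedLit b) e₁ e₂) (cond b e₁' e₂')
  | ematchR {T : Name} {n : ℕ} {i : Fin n} {e e' : Expr} {bs bs' : Fin n → Expr} :
      ExtRed G x e e' → (∀ j, ExtRed G x (bs j) (bs' j)) →
      ExtRed G x (.ematch T n (.ctor T i e) bs) ((bs' i).inst e')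
  | projPair {b : Bool} {e₁ e₁' e₂ e₂' : Expr} :
      ExtRed G x e₁ e₁' → ExtRed G x e₂ e₂' → ExtRed G x (.proj b (.pair e₁ e₂)) (cond b e₁' e₂')
  | projPsi {b : Bool} {e₁ e₁' e₂ e₂' : Expr} :
      ExtRed G x e₁ e₁' → ExtRed G x e₂ e₂' → ExtRed G x (.proj b (.psiPair e₁ e₂)) (cond b e₁' e₂')
  | secR {b : Bool} : ExtRed G x (.sec (.lit b)) (.boxedLit b)
  | oinjR {b : Bool} {w : OTy} {v : OVal} :
      ExtRed G x (.oinj b w.toExpr v.toExpr) (.boxedInj b w v)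
  | omatchR {b : Bool} {w₁ w₂ : OTy} {v v₁ v₂ : OVal} {e₁ e₁' e₂ e₂' : Expr} :
      OValTy v₁ w₁ → OValTy v₂ w₂ → ExtRed G x e₁ e₁' → ExtRed G x e₂ e₂' →
      ExtRed G x (.omatch (.boxedInj b (.osum w₁ w₂) v) e₁ e₂)
        (.mux (.boxedLit b)
          (cond b (e₁'.inst v.toExpr) (e₁'.inst v₁.toExpr))
          (cond b (e₂'.inst v₂.toExpr) (e₂'.inst v.toExpr)))
  | omatchD {b : Bool} {w₁ w₂ : OTy} {v : OVal} {e₁ e₁' e₂ e₂' : Expr} :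
      x → ExtRed G x e₁ e₁' → ExtRed G x e₂ e₂' →
      ExtRed G x (.omatch (.boxedInj b (.osum w₁ w₂) v) e₁ e₂)
        (cond b (e₁'.inst v.toExpr) (e₂'.inst v.toExpr))
  -- congruences
  | prodT {a a' b b' : Expr} :
      ExtRed G x a a' → ExtRed G x b b' → ExtRed G x (.prodT a b) (.prodT a' b')
  | osumT {a a' b b' : Expr} :
      ExtRed G x a a' → ExtRed G x b b' → ExtRed G x (.osumT a b) (.osumT a' b')
  | pi {a a' b b' : Expr} : ExtRed G x a a' → ExtRed G x b b' → ExtRed G x (.pi a b) (.pi a' b')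
  | oadt {T : Name} {e e' : Expr} : ExtRed G x e e' → ExtRed G x (.oadt T e) (.oadt T e')
  | abs {a a' b b' : Expr} : ExtRed G x a a' → ExtRed G x b b' → ExtRed G x (.abs a b) (.abs a' b')
  | letE {a a' b b' : Expr} : ExtRed G x a a' → ExtRed G x b b' → ExtRed G x (.letE a b) (.letE a' b')
  | app {a a' b b' : Expr} : ExtRed G x a a' → ExtRed G x b b' → ExtRed G x (.app a b) (.app a' b')
  | ctor {T : Name} {i : ℕ} {e e' : Expr} : ExtRed G x e e' → ExtRed G x (.ctor T i e) (.ctor T i e')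
  | ite {c c' a a' b b' : Expr} :
      ExtRed G x c c' → ExtRed G x a a' → ExtRed G x b b' → ExtRed G x (.ite c a b) (.ite c' a' b')
  | mux {c c' a a' b b' : Expr} :
      ExtRed G x c c' → ExtRed G x a a' → ExtRed G x b b' → ExtRed G x (.mux c a b) (.mux c' a' b')
  | pair {a a' b b' : Expr} : ExtRed G x a a' → ExtRed G x b b' → ExtRed G x (.pair a b) (.pair a' b')
  | psiPair {a a' b b' : Expr} :
      ExtRed G x a a' → ExtRed G x b b' → ExtRed G x (.psiPair a b) (.psiPair a' b')
  | proj {b : Bool} {e e' : Expr} : ExtRed G x e e' → ExtRed G x (.proj b e) (.proj b e')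
  | oinj {b : Bool} {a a' e e' : Expr} :
      ExtRed G x a a' → ExtRed G x e e' → ExtRed G x (.oinj b a e) (.oinj b a' e')
  | omatch {c c' a a' b b' : Expr} :
      ExtRed G x c c' → ExtRed G x a a' → ExtRed G x b b' → ExtRed G x (.omatch c a b) (.omatch c' a' b')
  | ematch {T : Name} {n : ℕ} {e e' : Expr} {bs bs' : Fin n → Expr} :
      ExtRed G x e e' → (∀ j, ExtRed G x (bs j) (bs' j)) →
      ExtRed G x (.ematch T n e bs) (.ematch T n e' bs')
  | sec {e e' : Expr} : ExtRed G x e e' → ExtRed G x (.sec e) (.sec e')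

theorem ParRed.toExt {G : GCtx} {x : Prop} {e e' : Expr} (h : ParRed G e e') :
    ExtRed G x e e' := by
  induction h <;> constructor <;> assumption

/-- With `x := False` the extended relation is exactly parallel reduction, so stability under
renaming and substitution is proved once for both. Confluence uses `x := True`. -/
theorem ExtRed.toParRed {G : GCtx} {x : Prop} (hx : ¬ x) {e e' : Expr} (h : ExtRed G x e e') :
    ParRed G e e' := by
  induction h
  case omatchD h _ _ _ _ => exact absurd h hx
  all_goals constructor <;> assumption

theorem cond_subst (b : Bool) (e₁ e₂ : Expr) (σ : ℕ → Expr) :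
    (cond b e₁ e₂).subst σ = cond b (e₁.subst σ) (e₂.subst σ) := by cases b <;> rfl

theorem ExtRed.cond {G : GCtx} {x : Prop} {b : Bool} {e₁ e₁' e₂ e₂' : Expr}
    (h₁ : ExtRed G x e₁ e₁') (h₂ : ExtRed G x e₂ e₂') :
    ExtRed G x (cond b e₁ e₂) (cond b e₁' e₂') := by cases b <;> assumption

theorem OTy.rename_toExpr (w : OTy) (ξ : ℕ → ℕ) : w.toExpr.rename ξ = w.toExpr := by
  rw [Expr.rename_eq_subst, OTy.subst_toExpr]

theorem OVal.rename_toExpr (v : OVal) (ξ : ℕ → ℕ) : v.toExpr.rename ξ = v.toExpr := by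
  rw [Expr.rename_eq_subst, OVal.subst_toExpr]

theorem cond_rename (b : Bool) (e₁ e₂ : Expr) (ξ : ℕ → ℕ) :
    (cond b e₁ e₂).rename ξ = cond b (e₁.rename ξ) (e₂.rename ξ) := by cases b <;> rfl

theorem Expr.Scoped.inst_rename {e : Expr} (h : e.Scoped 1) (u : Expr) (ξ : ℕ → ℕ) :
    (e.inst u).rename ξ = e.inst (u.rename ξ) := by
  simp only [Expr.rename_eq_subst, h.inst_subst]

-- Stability of parallel reduction under renaming and substitution.

theorem ExtRed.rename {G : GCtx} (hG : G.Closed) {x : Prop} {e e' : Expr}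
    (h : ExtRed G x e e') (ξ : ℕ → ℕ) : ExtRed G x (e.rename ξ) (e'.rename ξ) := by
  induction h generalizing ξ
  case refl => exact .refl _
  case fn h => rw [(hG.body _ _ h).rename_eq]; exact .fn h
  case oadtR h _ ih => rw [(hG.obody _ _ h).inst_rename]; exact .oadtR h (ih _)
  all_goals
    simp only [Expr.rename, Expr.inst_rename, cond_rename, OVal.rename_toExpr, OTy.rename_toExpr]
  case omatchD hx _ _ ih₁ ih₂ => exact .omatchD hx (ih₁ _) (ih₂ _)
  case omatchR h₁ h₂ _ _ ih₁ ih₂ => exact .omatchR h₁ h₂ (ih₁ _) (ih₂ _)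
  case beta ih₁ ih₂ => exact .beta (ih₁ _) (ih₂ _)
  case letR ih₁ ih₂ => exact .letR (ih₁ _) (ih₂ _)
  case ematchR i _ _ _ _ _ _ ih₁ ih₂ =>
    exact ExtRed.ematchR (i := i) (bs' := fun j => Expr.rename (upRen ξ) _) (ih₁ _) fun j => ih₂ j _
  case iteR ih₁ ih₂ => exact .iteR (ih₁ _) (ih₂ _)
  case muxR ih₁ ih₂ => exact .muxR (ih₁ _) (ih₂ _)
  case projPair ih₁ ih₂ => exact .projPair (ih₁ _) (ih₂ _)
  case projPsi ih₁ ih₂ => exact .projPsi (ih₁ _) (ih₂ _)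
  case secR => exact .secR
  case oinjR => exact .oinjR
  all_goals constructor <;> simp_all only [implies_true]

theorem ExtRed.upSub {G : GCtx} (hG : G.Closed) {x : Prop} {σ ρ : ℕ → Expr}
    (h : ∀ n, ExtRed G x (σ n) (ρ n)) (n : ℕ) : ExtRed G x (upSub σ n) (upSub ρ n) := by
  cases n with
  | zero => exact .refl _
  | succ n => exact (h n).rename hG _

theorem ExtRed.subst_refl {G : GCtx} (hG : G.Closed) {x : Prop} (e : Expr) {σ ρ : ℕ → Expr}
    (h : ∀ n, ExtRed G x (σ n) (ρ n)) : ExtRed G x (e.subst σ) (e.subst ρ) := by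
  induction e generalizing σ ρ <;> simp only [Expr.subst]
  case bvar => exact h _
  all_goals first
    | exact .refl _
    | constructor <;> simp_all only [implies_true, ExtRed.upSub hG h]

theorem ExtRed.subst {G : GCtx} (hG : G.Closed) {x : Prop} {e e' : Expr}
    (h : ExtRed G x e e') {σ ρ : ℕ → Expr} (hσ : ∀ n, ExtRed G x (σ n) (ρ n)) :
    ExtRed G x (e.subst σ) (e'.subst ρ) := by
  induction h generalizing σ ρ
  case refl => exact .subst_refl hG _ hσ
  case fn h => rw [(hG.body _ _ h).subst_eq]; exact .fn h
  case oadtR h _ ih => rw [(hG.obody _ _ h).inst_subst]; exact .oadtR h (ih hσ)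
  all_goals
    have hσ' := ExtRed.upSub hG hσ
    simp only [Expr.subst, Expr.inst_subst, cond_subst, OVal.subst_toExpr, OTy.subst_toExpr]
  case omatchD hx _ _ ih₁ ih₂ => exact .omatchD hx (ih₁ hσ') (ih₂ hσ')
  case omatchR h₁ h₂ _ _ ih₁ ih₂ => exact .omatchR h₁ h₂ (ih₁ hσ') (ih₂ hσ')
  case beta ih₁ ih₂ => exact .beta (ih₁ hσ') (ih₂ hσ)
  case letR ih₁ ih₂ => exact .letR (ih₁ hσ) (ih₂ hσ')
  case ematchR i _ _ _ _ _ _ ih₁ ih₂ =>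
    exact ExtRed.ematchR (i := i) (bs' := fun j => Expr.subst (OADT.upSub ρ) _) (ih₁ hσ)
      fun j => ih₂ j hσ'
  case iteR ih₁ ih₂ => exact .iteR (ih₁ hσ) (ih₂ hσ)
  case muxR ih₁ ih₂ => exact .muxR (ih₁ hσ) (ih₂ hσ)
  case projPair ih₁ ih₂ => exact .projPair (ih₁ hσ) (ih₂ hσ)
  case projPsi ih₁ ih₂ => exact .projPsi (ih₁ hσ) (ih₂ hσ)
  case secR => exact .secR
  case oinjR => exact .oinjR
  all_goals constructor <;> simp_all only [implies_true]

theorem ExtRed.inst {G : GCtx} (hG : G.Closed) {x : Prop} {e e' u u' : Expr}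
    (h : ExtRed G x e e') (hu : ExtRed G x u u') : ExtRed G x (e.inst u) (e'.inst u') := by
  apply h.subst hG
  rintro (_ | n)
  exacts [hu, .refl _]

theorem ParRed.subst {G : GCtx} (hG : G.Closed) {e e' : Expr} (h : ParRed G e e')
    (σ : ℕ → Expr) : ParRed G (e.subst σ) (e'.subst σ) :=
  ((h.toExt (x := False)).subst hG fun _ => .refl _).toParRed id

theorem ParRed.rename {G : GCtx} (hG : G.Closed) {e e' : Expr} (h : ParRed G e e')
    (ξ : ℕ → ℕ) : ParRed G (e.rename ξ) (e'.rename ξ) :=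
  ((h.toExt (x := False)).rename hG ξ).toParRed id

theorem ParRed.inst {G : GCtx} (hG : G.Closed) {e e' u u' : Expr} (h : ParRed G e e')
    (hu : ParRed G u u') : ParRed G (e.inst u) (e'.inst u') :=
  ((h.toExt (x := False)).inst hG hu.toExt).toParRed id

theorem ParRed.mux_false {G : GCtx} {e₁ e₂ e : Expr} (h : ParRed G e₂ e) :
    ParRed G (.mux (.boxedLit false) e₁ e₂) e :=
  ParRed.muxR (b := false) (.refl e₁) h

theorem ParRed.mux_true {G : GCtx} {e₁ e₂ e : Expr} (h : ParRed G e₁ e) :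
    ParRed G (.mux (.boxedLit true) e₁ e₂) e :=
  ParRed.muxR (b := true) h (.refl e₂)

theorem ExtRed.mux_false {G : GCtx} {x : Prop} {e₁ e₂ e : Expr} (h : ExtRed G x e₂ e) :
    ExtRed G x (.mux (.boxedLit false) e₁ e₂) e :=
  ExtRed.muxR (b := false) (.refl e₁) h

theorem ExtRed.mux_true {G : GCtx} {x : Prop} {e₁ e₂ e : Expr} (h : ExtRed G x e₁ e) :
    ExtRed G x (.mux (.boxedLit true) e₁ e₂) e :=
  ExtRed.muxR (b := true) h (.refl e₂)

/-- Dummy values always exist, so an oblivious match on a well-formed injection can always fire. -/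
theorem OTy.exists_oValTy (w : OTy) : ∃ v, OValTy v w := by
  induction w with
  | unit => exact ⟨_, .unit⟩
  | obool => exact ⟨_, .obool true⟩
  | prod _ _ h₁ h₂ => exact ⟨_, .prod h₁.choose_spec h₂.choose_spec⟩
  | osum _ _ h₁ h₂ => exact ⟨_, .osum (b := true) h₁.choose_spec⟩

/-- A direct jump is an oblivious match reduction followed by the reduction of the resulting `mux`.
The other rules are spread over two steps as well, the components moving by congruence first and the
redex firing second, so that the steps of the components stay aligned. -/
theorem ExtRed.exists_parRed {G : GCtx} (hG : G.Closed) {x : Prop} {e e' : Expr}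
    (h : ExtRed G x e e') : ∃ e'', ParRed G e e'' ∧ ParRed G e'' e' := by
  induction h
  case refl => exact ⟨_, .refl _, .refl _⟩
  case fn h => exact ⟨_, .fn h, .refl _⟩
  case secR => exact ⟨_, .secR, .refl _⟩
  case oinjR => exact ⟨_, .oinjR, .refl _⟩
  case oadtR h _ ih => obtain ⟨_, h₁, h₂⟩ := ih; exact ⟨_, .oadt h₁, .oadtR h h₂⟩
  case beta ih ih' =>
    obtain ⟨_, h₁, h₂⟩ := ih; obtain ⟨_, h₁', h₂'⟩ := ih'
    exact ⟨_, .app (.abs (.refl _) h₁) h₁', .beta h₂ h₂'⟩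
  case letR ih ih' =>
    obtain ⟨_, h₁, h₂⟩ := ih; obtain ⟨_, h₁', h₂'⟩ := ih'
    exact ⟨_, .letE h₁ h₁', .letR h₂ h₂'⟩
  case iteR ih ih' =>
    obtain ⟨_, h₁, h₂⟩ := ih; obtain ⟨_, h₁', h₂'⟩ := ih'
    exact ⟨_, .ite (.refl _) h₁ h₁', .iteR h₂ h₂'⟩
  case muxR ih ih' =>
    obtain ⟨_, h₁, h₂⟩ := ih; obtain ⟨_, h₁', h₂'⟩ := ih'
    exact ⟨_, .mux (.refl _) h₁ h₁', .muxR h₂ h₂'⟩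
  case projPair ih ih' =>
    obtain ⟨_, h₁, h₂⟩ := ih; obtain ⟨_, h₁', h₂'⟩ := ih'
    exact ⟨_, .proj (.pair h₁ h₁'), .projPair h₂ h₂'⟩
  case projPsi ih ih' =>
    obtain ⟨_, h₁, h₂⟩ := ih; obtain ⟨_, h₁', h₂'⟩ := ih'
    exact ⟨_, .proj (.psiPair h₁ h₁'), .projPsi h₂ h₂'⟩
  case omatchR hv₁ hv₂ _ _ ih ih' =>
    obtain ⟨_, h₁, h₂⟩ := ih; obtain ⟨_, h₁', h₂'⟩ := ih'
    exact ⟨_, .omatch (.refl _) h₁ h₁', .omatchR hv₁ hv₂ h₂ h₂'⟩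
  case omatchD b w₁ w₂ _ _ _ _ _ _ _ _ ih ih' =>
    obtain ⟨_, h₁, h₂⟩ := ih; obtain ⟨_, h₁', h₂'⟩ := ih'
    obtain ⟨v₁, hv₁⟩ := w₁.exists_oValTy
    obtain ⟨v₂, hv₂⟩ := w₂.exists_oValTy
    -- Unlike the other redexes, the match fires in the first step, because its `mux` has to fire in
    -- the second.
    refine ⟨_, .omatchR hv₁ hv₂ h₁ h₁', ?_⟩
    cases b
    · exact ParRed.mux_false (h₂'.inst hG (.refl _))
    · exact ParRed.mux_true (h₂.inst hG (.refl _))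
  case ematchR ih ih' =>
    obtain ⟨_, h₁, h₂⟩ := ih; choose _ h₁' h₂' using ih'
    exact ⟨_, .ematch (.ctor h₁) h₁', .ematchR h₂ h₂'⟩
  case ematch ih ih' =>
    obtain ⟨_, h₁, h₂⟩ := ih; choose _ h₁' h₂' using ih'
    exact ⟨_, .ematch h₁ h₁', .ematch h₂ h₂'⟩
  case ite ih ih' ih'' =>
    obtain ⟨_, h₁, h₂⟩ := ih; obtain ⟨_, h₁', h₂'⟩ := ih'; obtain ⟨_, h₁'', h₂''⟩ := ih''
    exact ⟨_, .ite h₁ h₁' h₁'', .ite h₂ h₂' h₂''⟩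
  case mux ih ih' ih'' =>
    obtain ⟨_, h₁, h₂⟩ := ih; obtain ⟨_, h₁', h₂'⟩ := ih'; obtain ⟨_, h₁'', h₂''⟩ := ih''
    exact ⟨_, .mux h₁ h₁' h₁'', .mux h₂ h₂' h₂''⟩
  case omatch ih ih' ih'' =>
    obtain ⟨_, h₁, h₂⟩ := ih; obtain ⟨_, h₁', h₂'⟩ := ih'; obtain ⟨_, h₁'', h₂''⟩ := ih''
    exact ⟨_, .omatch h₁ h₁' h₁'', .omatch h₂ h₂' h₂''⟩
  case prodT ih ih' =>
    obtain ⟨_, h₁, h₂⟩ := ih; obtain ⟨_, h₁', h₂'⟩ := ih'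
    exact ⟨_, .prodT h₁ h₁', .prodT h₂ h₂'⟩
  case osumT ih ih' =>
    obtain ⟨_, h₁, h₂⟩ := ih; obtain ⟨_, h₁', h₂'⟩ := ih'
    exact ⟨_, .osumT h₁ h₁', .osumT h₂ h₂'⟩
  case pi ih ih' =>
    obtain ⟨_, h₁, h₂⟩ := ih; obtain ⟨_, h₁', h₂'⟩ := ih'
    exact ⟨_, .pi h₁ h₁', .pi h₂ h₂'⟩
  case abs ih ih' =>
    obtain ⟨_, h₁, h₂⟩ := ih; obtain ⟨_, h₁', h₂'⟩ := ih'
    exact ⟨_, .abs h₁ h₁', .abs h₂ h₂'⟩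
  case letE ih ih' =>
    obtain ⟨_, h₁, h₂⟩ := ih; obtain ⟨_, h₁', h₂'⟩ := ih'
    exact ⟨_, .letE h₁ h₁', .letE h₂ h₂'⟩
  case app ih ih' =>
    obtain ⟨_, h₁, h₂⟩ := ih; obtain ⟨_, h₁', h₂'⟩ := ih'
    exact ⟨_, .app h₁ h₁', .app h₂ h₂'⟩
  case pair ih ih' =>
    obtain ⟨_, h₁, h₂⟩ := ih; obtain ⟨_, h₁', h₂'⟩ := ih'
    exact ⟨_, .pair h₁ h₁', .pair h₂ h₂'⟩
  case psiPair ih ih' =>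
    obtain ⟨_, h₁, h₂⟩ := ih; obtain ⟨_, h₁', h₂'⟩ := ih'
    exact ⟨_, .psiPair h₁ h₁', .psiPair h₂ h₂'⟩
  case oinj ih ih' =>
    obtain ⟨_, h₁, h₂⟩ := ih; obtain ⟨_, h₁', h₂'⟩ := ih'
    exact ⟨_, .oinj h₁ h₁', .oinj h₂ h₂'⟩
  case oadt ih => obtain ⟨_, h₁, h₂⟩ := ih; exact ⟨_, .oadt h₁, .oadt h₂⟩
  case ctor ih => obtain ⟨_, h₁, h₂⟩ := ih; exact ⟨_, .ctor h₁, .ctor h₂⟩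
  case proj ih => obtain ⟨_, h₁, h₂⟩ := ih; exact ⟨_, .proj h₁, .proj h₂⟩
  case sec ih => obtain ⟨_, h₁, h₂⟩ := ih; exact ⟨_, .sec h₁, .sec h₂⟩

/-! ### Confluence and type equivalence -/

-- Reducts of terms whose outermost constructor survives reduction.

theorem ExtRed.abs_inv {G : GCtx} {x : Prop} {τ e y : Expr} (h : ExtRed G x (.abs τ e) y) :
    ∃ τ' e', y = .abs τ' e' ∧ ExtRed G x τ τ' ∧ ExtRed G x e e' := by
  cases h
  case refl => exact ⟨_, _, rfl, .refl _, .refl _⟩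
  case abs h₁ h₂ => exact ⟨_, _, rfl, h₁, h₂⟩

theorem ExtRed.pair_inv {G : GCtx} {x : Prop} {τ e y : Expr} (h : ExtRed G x (.pair τ e) y) :
    ∃ τ' e', y = .pair τ' e' ∧ ExtRed G x τ τ' ∧ ExtRed G x e e' := by
  cases h
  case refl => exact ⟨_, _, rfl, .refl _, .refl _⟩
  case pair h₁ h₂ => exact ⟨_, _, rfl, h₁, h₂⟩

theorem ExtRed.psiPair_inv {G : GCtx} {x : Prop} {τ e y : Expr}
    (h : ExtRed G x (.psiPair τ e) y) :
    ∃ τ' e', y = .psiPair τ' e' ∧ ExtRed G x τ τ' ∧ ExtRed G x e e' := by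
  cases h
  case refl => exact ⟨_, _, rfl, .refl _, .refl _⟩
  case psiPair h₁ h₂ => exact ⟨_, _, rfl, h₁, h₂⟩

theorem ExtRed.ctor_inv {G : GCtx} {x : Prop} {T : Name} {i : ℕ} {e y : Expr}
    (h : ExtRed G x (.ctor T i e) y) : ∃ e', y = .ctor T i e' ∧ ExtRed G x e e' := by
  cases h
  case refl => exact ⟨_, rfl, .refl _⟩
  case ctor h => exact ⟨_, rfl, h⟩

theorem ExtRed.prodT_inv {G : GCtx} {x : Prop} {τ e y : Expr} (h : ExtRed G x (.prodT τ e) y) :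
    ∃ τ' e', y = .prodT τ' e' ∧ ExtRed G x τ τ' ∧ ExtRed G x e e' := by
  cases h
  case refl => exact ⟨_, _, rfl, .refl _, .refl _⟩
  case prodT h₁ h₂ => exact ⟨_, _, rfl, h₁, h₂⟩

theorem ExtRed.osumT_inv {G : GCtx} {x : Prop} {τ e y : Expr} (h : ExtRed G x (.osumT τ e) y) :
    ∃ τ' e', y = .osumT τ' e' ∧ ExtRed G x τ τ' ∧ ExtRed G x e e' := by
  cases h
  case refl => exact ⟨_, _, rfl, .refl _, .refl _⟩
  case osumT h₁ h₂ => exact ⟨_, _, rfl, h₁, h₂⟩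

theorem ExtRed.pi_inv {G : GCtx} {x : Prop} {τ e y : Expr} (h : ExtRed G x (.pi τ e) y) :
    ∃ τ' e', y = .pi τ' e' ∧ ExtRed G x τ τ' ∧ ExtRed G x e e' := by
  cases h
  case refl => exact ⟨_, _, rfl, .refl _, .refl _⟩
  case pi h₁ h₂ => exact ⟨_, _, rfl, h₁, h₂⟩

theorem ExtRed.oinj_inv {G : GCtx} {x : Prop} {b : Bool} {τ e y : Expr}
    (h : ExtRed G x (.oinj b τ e) y) :
    (∃ τ' e', y = .oinj b τ' e' ∧ ExtRed G x τ τ' ∧ ExtRed G x e e') ∨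
      ∃ (w : OTy) (v : OVal), τ = w.toExpr ∧ e = v.toExpr ∧ y = .boxedInj b w v := by
  cases h
  case refl => exact .inl ⟨_, _, rfl, .refl _, .refl _⟩
  case oinj h₁ h₂ => exact .inl ⟨_, _, rfl, h₁, h₂⟩
  case oinjR => exact .inr ⟨_, _, rfl, rfl, rfl⟩

theorem ExtRed.ematch_inv {G : GCtx} {x : Prop} {T : Name} {n : ℕ} {e y : Expr}
    {bs : Fin n → Expr} (h : ExtRed G x (.ematch T n e bs) y) :
    (∃ e' bs', y = .ematch T n e' bs' ∧ ExtRed G x e e' ∧ ∀ j, ExtRed G x (bs j) (bs' j)) ∨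
      ∃ (i : Fin n) (u u' : Expr) (bs' : Fin n → Expr), e = .ctor T i u ∧ y = (bs' i).inst u' ∧
        ExtRed G x u u' ∧ ∀ j, ExtRed G x (bs j) (bs' j) := by
  cases h
  case refl => exact .inl ⟨_, _, rfl, .refl _, fun _ => .refl _⟩
  case ematch h₁ h₂ => exact .inl ⟨_, _, rfl, h₁, h₂⟩
  case ematchR h₁ _ _ h₂ => exact .inr ⟨_, _, _, _, rfl, rfl, h₁, h₂⟩

/-- Oblivious type values contain no redex. Together with the same fact for oblivious values this
keeps an `oinj` redex a redex when its components reduce. -/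
theorem ExtRed.oTy_inv {G : GCtx} {x : Prop} {w : OTy} {y : Expr}
    (h : ExtRed G x w.toExpr y) : y = w.toExpr := by
  induction w generalizing y
  case unit | obool => cases h; rfl
  case prod h₁ h₂ => obtain ⟨_, _, rfl, h, h'⟩ := h.prodT_inv; rw [h₁ h, h₂ h', OTy.toExpr]
  case osum h₁ h₂ => obtain ⟨_, _, rfl, h, h'⟩ := h.osumT_inv; rw [h₁ h, h₂ h', OTy.toExpr]

theorem ExtRed.oVal_inv {G : GCtx} {x : Prop} {v : OVal} {y : Expr}
    (h : ExtRed G x v.toExpr y) : y = v.toExpr := by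
  induction v generalizing y
  case tt | boxedLit | boxedInj => cases h; rfl
  case pair h₁ h₂ => obtain ⟨_, _, rfl, h, h'⟩ := h.pair_inv; rw [h₁ h, h₂ h', OVal.toExpr]

theorem OTy.toExpr_injective : Function.Injective OTy.toExpr := by
  intro w w' h
  induction w generalizing w' <;> cases w' <;> simp_all [OTy.toExpr] <;> aesop

theorem OVal.toExpr_injective : Function.Injective OVal.toExpr := by
  intro w w' h
  induction w generalizing w' <;> cases w' <;> simp_all [OVal.toExpr]; aesop

/-- Every expression has a complete development. -/
theorem ExtRed.triangle {G : GCtx} (hG : G.Closed) (e : Expr) :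
    ∃ d, ∀ e', ExtRed G True e e' → ExtRed G True e' d := by
  induction e
  case unitT | boolT | oboolT | psiT | adt | bvar | tt | lit | boxedLit | boxedInj =>
    exact ⟨_, fun e' h => by cases h; exact .refl _⟩
  case gvar f =>
    rcases hf : G.fn f with _ | d
    · refine ⟨.gvar f, fun e' h => ?_⟩
      cases h
      case refl => exact .refl _
      case fn h => simp [hf] at h
    · refine ⟨d.body, fun e' h => ?_⟩
      cases h
      case refl => exact .fn hf
      case fn h => obtain rfl := Option.some.inj (hf.symm.trans h); exact .refl _
  case prodT h₁ h₂ =>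
    obtain ⟨d₁, h₁⟩ := h₁; obtain ⟨d₂, h₂⟩ := h₂
    refine ⟨.prodT d₁ d₂, fun e' h => ?_⟩
    obtain ⟨_, _, rfl, h, h'⟩ := h.prodT_inv
    exact .prodT (h₁ _ h) (h₂ _ h')
  case osumT h₁ h₂ =>
    obtain ⟨d₁, h₁⟩ := h₁; obtain ⟨d₂, h₂⟩ := h₂
    refine ⟨.osumT d₁ d₂, fun e' h => ?_⟩
    obtain ⟨_, _, rfl, h, h'⟩ := h.osumT_inv
    exact .osumT (h₁ _ h) (h₂ _ h')
  case pi h₁ h₂ =>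
    obtain ⟨d₁, h₁⟩ := h₁; obtain ⟨d₂, h₂⟩ := h₂
    refine ⟨.pi d₁ d₂, fun e' h => ?_⟩
    obtain ⟨_, _, rfl, h, h'⟩ := h.pi_inv
    exact .pi (h₁ _ h) (h₂ _ h')
  case abs h₁ h₂ =>
    obtain ⟨d₁, h₁⟩ := h₁; obtain ⟨d₂, h₂⟩ := h₂
    refine ⟨.abs d₁ d₂, fun e' h => ?_⟩
    obtain ⟨_, _, rfl, h, h'⟩ := h.abs_inv
    exact .abs (h₁ _ h) (h₂ _ h')
  case pair h₁ h₂ =>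
    obtain ⟨d₁, h₁⟩ := h₁; obtain ⟨d₂, h₂⟩ := h₂
    refine ⟨.pair d₁ d₂, fun e' h => ?_⟩
    obtain ⟨_, _, rfl, h, h'⟩ := h.pair_inv
    exact .pair (h₁ _ h) (h₂ _ h')
  case psiPair h₁ h₂ =>
    obtain ⟨d₁, h₁⟩ := h₁; obtain ⟨d₂, h₂⟩ := h₂
    refine ⟨.psiPair d₁ d₂, fun e' h => ?_⟩
    obtain ⟨_, _, rfl, h, h'⟩ := h.psiPair_inv
    exact .psiPair (h₁ _ h) (h₂ _ h')
  case ctor T i _ h₁ =>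
    obtain ⟨d₁, h₁⟩ := h₁
    refine ⟨.ctor T i d₁, fun e' h => ?_⟩
    obtain ⟨_, rfl, h'⟩ := h.ctor_inv
    exact .ctor (h₁ _ h')
  case letE h₁ h₂ =>
    obtain ⟨d₁, h₁⟩ := h₁; obtain ⟨d₂, h₂⟩ := h₂
    refine ⟨d₂.inst d₁, fun e' h => ?_⟩
    cases h
    case refl => exact .letR (h₁ _ (.refl _)) (h₂ _ (.refl _))
    case letE h h' => exact .letR (h₁ _ h) (h₂ _ h')
    case letR h h' => exact (h₂ _ h').inst hG (h₁ _ h)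
  case oadt T e h₁ =>
    obtain ⟨d₁, h₁⟩ := h₁
    rcases hT : G.oadt T with _ | d
    · refine ⟨.oadt T d₁, fun e' h => ?_⟩
      cases h
      case refl => exact .oadt (h₁ _ (.refl _))
      case oadt h => exact .oadt (h₁ _ h)
      case oadtR h _ => simp [hT] at h
    · refine ⟨d.body.inst d₁, fun e' h => ?_⟩
      cases h
      case refl => exact .oadtR hT (h₁ _ (.refl _))
      case oadt h => exact .oadtR hT (h₁ _ h)
      case oadtR h' h =>
        obtain rfl := Option.some.inj (hT.symm.trans h')
        exact (ExtRed.refl _).inst hG (h₁ _ h)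
  case app f a h₁ h₂ =>
    obtain ⟨d₁, h₁⟩ := h₁; obtain ⟨d₂, h₂⟩ := h₂
    by_cases hf : ∃ τ b, f = .abs τ b
    · obtain ⟨τ, b, rfl⟩ := hf
      obtain ⟨τ', b', rfl, -, -⟩ := (h₁ _ (.refl _)).abs_inv
      -- The induction hypothesis concerns the whole abstraction. Applied to `abs τ c` and inverted,
      -- it shows that `b'` is a development of the body. Pairs and constructors below are treated
      -- in the same way.
      have hb : ∀ c, ExtRed G True b c → ExtRed G True c b' := fun c hc => by
        obtain ⟨_, _, he, -, h⟩ := (h₁ _ (.abs (.refl _) hc)).abs_inv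
        injection he with _ he; exact he ▸ h
      refine ⟨b'.inst d₂, fun e' h => ?_⟩
      cases h
      case refl => exact .beta (hb _ (.refl _)) (h₂ _ (.refl _))
      case beta h h' => exact (hb _ h).inst hG (h₂ _ h')
      case app h h' =>
        obtain ⟨_, _, rfl, -, h⟩ := h.abs_inv
        exact .beta (hb _ h) (h₂ _ h')
    · refine ⟨.app d₁ d₂, fun e' h => ?_⟩
      cases h
      case refl => exact .app (h₁ _ (.refl _)) (h₂ _ (.refl _))
      case beta => exact absurd ⟨_, _, rfl⟩ hf
      case app h h' => exact .app (h₁ _ h) (h₂ _ h')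
  case ite c a b h₀ h₁ h₂ =>
    obtain ⟨d₀, h₀⟩ := h₀; obtain ⟨d₁, h₁⟩ := h₁; obtain ⟨d₂, h₂⟩ := h₂
    by_cases hc : ∃ b, c = .lit b
    · obtain ⟨b, rfl⟩ := hc
      refine ⟨bif b then d₁ else d₂, fun e' h => ?_⟩
      cases h
      case refl => exact .iteR (h₁ _ (.refl _)) (h₂ _ (.refl _))
      case iteR h h' => exact (h₁ _ h).cond (h₂ _ h')
      case ite h h' h'' => cases h; exact .iteR (h₁ _ h') (h₂ _ h'')
    · refine ⟨.ite d₀ d₁ d₂, fun e' h => ?_⟩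
      cases h
      case refl => exact .ite (h₀ _ (.refl _)) (h₁ _ (.refl _)) (h₂ _ (.refl _))
      case iteR => exact absurd ⟨_, rfl⟩ hc
      case ite h h' h'' => exact .ite (h₀ _ h) (h₁ _ h') (h₂ _ h'')
  case mux c a b h₀ h₁ h₂ =>
    obtain ⟨d₀, h₀⟩ := h₀; obtain ⟨d₁, h₁⟩ := h₁; obtain ⟨d₂, h₂⟩ := h₂
    by_cases hc : ∃ b, c = .boxedLit b
    · obtain ⟨b, rfl⟩ := hc
      refine ⟨bif b then d₁ else d₂, fun e' h => ?_⟩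
      cases h
      case refl => exact .muxR (h₁ _ (.refl _)) (h₂ _ (.refl _))
      case muxR h h' => exact (h₁ _ h).cond (h₂ _ h')
      case mux h h' h'' => cases h; exact .muxR (h₁ _ h') (h₂ _ h'')
    · refine ⟨.mux d₀ d₁ d₂, fun e' h => ?_⟩
      cases h
      case refl => exact .mux (h₀ _ (.refl _)) (h₁ _ (.refl _)) (h₂ _ (.refl _))
      case muxR => exact absurd ⟨_, rfl⟩ hc
      case mux h h' h'' => exact .mux (h₀ _ h) (h₁ _ h') (h₂ _ h'')
  case omatch c a b h₀ h₁ h₂ =>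
    obtain ⟨d₀, h₀⟩ := h₀; obtain ⟨d₁, h₁⟩ := h₁; obtain ⟨d₂, h₂⟩ := h₂
    by_cases hc : ∃ b w₁ w₂ v, c = .boxedInj b (.osum w₁ w₂) v
    · obtain ⟨b, w₁, w₂, v, rfl⟩ := hc
      -- The development is the selected branch itself: no `mux` could serve, since its dummy values
      -- would have to match every choice made by `omatchR`. The unreduced match reaches it by
      -- `omatchD`.
      refine ⟨bif b then d₁.inst v.toExpr else d₂.inst v.toExpr, fun e' h => ?_⟩
      cases h
      case refl => exact .omatchD trivial (h₁ _ (.refl _)) (h₂ _ (.refl _))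
      case omatchD h h' =>
        exact ((h₁ _ h).inst hG (.refl _)).cond ((h₂ _ h').inst hG (.refl _))
      case omatchR h h' =>
        cases b
        · exact ExtRed.mux_false ((h₂ _ h').inst hG (.refl _))
        · exact ExtRed.mux_true ((h₁ _ h).inst hG (.refl _))
      case omatch h h' h'' => cases h; exact .omatchD trivial (h₁ _ h') (h₂ _ h'')
    · refine ⟨.omatch d₀ d₁ d₂, fun e' h => ?_⟩
      cases h
      case refl => exact .omatch (h₀ _ (.refl _)) (h₁ _ (.refl _)) (h₂ _ (.refl _))
      case omatchR => exact absurd ⟨_, _, _, _, rfl⟩ hc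
      case omatchD => exact absurd ⟨_, _, _, _, rfl⟩ hc
      case omatch h h' h'' => exact .omatch (h₀ _ h) (h₁ _ h') (h₂ _ h'')
  case sec e h₁ =>
    obtain ⟨d₁, h₁⟩ := h₁
    by_cases hc : ∃ b, e = .lit b
    · obtain ⟨b, rfl⟩ := hc
      refine ⟨.boxedLit b, fun e' h => ?_⟩
      cases h
      case refl => exact .secR
      case secR => exact .refl _
      case sec h => cases h; exact .secR
    · refine ⟨.sec d₁, fun e' h => ?_⟩
      cases h
      case refl => exact .sec (h₁ _ (.refl _))
      case secR => exact absurd ⟨_, rfl⟩ hc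
      case sec h => exact .sec (h₁ _ h)
  case proj b e h₁ =>
    obtain ⟨d₁, h₁⟩ := h₁
    by_cases hc : ∃ a c, e = .pair a c
    · obtain ⟨a, c, rfl⟩ := hc
      obtain ⟨a', c', rfl, -, -⟩ := (h₁ _ (.refl _)).pair_inv
      have hac : ∀ x y, ExtRed G True a x → ExtRed G True c y →
          ExtRed G True x a' ∧ ExtRed G True y c' := fun x y hx hy => by
        obtain ⟨_, _, he, h⟩ := (h₁ _ (.pair hx hy)).pair_inv
        injection he with he he'; exact he ▸ he' ▸ h
      refine ⟨bif b then a' else c', fun e' h => ?_⟩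
      cases h
      case refl => exact .projPair (hac _ _ (.refl _) (.refl _)).1 (hac _ _ (.refl _) (.refl _)).2
      case projPair h h' => exact (hac _ _ h h').1.cond (hac _ _ h h').2
      case proj h =>
        obtain ⟨_, _, rfl, h, h'⟩ := h.pair_inv
        exact .projPair (hac _ _ h h').1 (hac _ _ h h').2
    by_cases hc' : ∃ a c, e = .psiPair a c
    · obtain ⟨a, c, rfl⟩ := hc'
      obtain ⟨a', c', rfl, -, -⟩ := (h₁ _ (.refl _)).psiPair_inv
      have hac : ∀ x y, ExtRed G True a x → ExtRed G True c y →
          ExtRed G True x a' ∧ ExtRed G True y c' := fun x y hx hy => by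
        obtain ⟨_, _, he, h⟩ := (h₁ _ (.psiPair hx hy)).psiPair_inv
        injection he with he he'; exact he ▸ he' ▸ h
      refine ⟨bif b then a' else c', fun e' h => ?_⟩
      cases h
      case refl => exact .projPsi (hac _ _ (.refl _) (.refl _)).1 (hac _ _ (.refl _) (.refl _)).2
      case projPsi h h' => exact (hac _ _ h h').1.cond (hac _ _ h h').2
      case proj h =>
        obtain ⟨_, _, rfl, h, h'⟩ := h.psiPair_inv
        exact .projPsi (hac _ _ h h').1 (hac _ _ h h').2
    refine ⟨.proj b d₁, fun e' h => ?_⟩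
    cases h
    case refl => exact .proj (h₁ _ (.refl _))
    case projPair => exact absurd ⟨_, _, rfl⟩ hc
    case projPsi => exact absurd ⟨_, _, rfl⟩ hc'
    case proj h => exact .proj (h₁ _ h)
  case oinj b τ e h₁ h₂ =>
    obtain ⟨d₁, h₁⟩ := h₁; obtain ⟨d₂, h₂⟩ := h₂
    by_cases hc : ∃ (w : OTy) (v : OVal), τ = w.toExpr ∧ e = v.toExpr
    · obtain ⟨w, v, rfl, rfl⟩ := hc
      refine ⟨.boxedInj b w v, fun e' h => ?_⟩
      obtain ⟨_, _, rfl, h, h'⟩ | ⟨_, _, k, k', rfl⟩ := h.oinj_inv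
      · rw [h.oTy_inv, h'.oVal_inv]; exact .oinjR
      · rw [OTy.toExpr_injective k, OVal.toExpr_injective k']; exact .refl _
    · refine ⟨.oinj b d₁ d₂, fun e' h => ?_⟩
      obtain ⟨_, _, rfl, h, h'⟩ | ⟨_, _, k, k', rfl⟩ := h.oinj_inv
      · exact .oinj (h₁ _ h) (h₂ _ h')
      · exact absurd ⟨_, _, k, k'⟩ hc
  case ematch T n e bs h₁ h₂ =>
    obtain ⟨d₁, h₁⟩ := h₁; choose d₂ h₂ using h₂
    by_cases hc : ∃ (i : Fin n) (u : Expr), e = .ctor T i u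
    · obtain ⟨i, u, rfl⟩ := hc
      obtain ⟨u', rfl, -⟩ := (h₁ _ (.refl _)).ctor_inv
      have hu : ∀ x, ExtRed G True u x → ExtRed G True x u' := fun x hx => by
        obtain ⟨_, he, h⟩ := (h₁ _ (.ctor hx)).ctor_inv
        injection he with _ _ he; exact he ▸ h
      refine ⟨(d₂ i).inst u', fun e' h => ?_⟩
      obtain ⟨_, _, rfl, h, h'⟩ | ⟨j, _, _, _, he, rfl, k, k'⟩ := h.ematch_inv
      · obtain ⟨_, rfl, k⟩ := h.ctor_inv
        exact .ematchR (hu _ k) fun j => h₂ j _ (h' j)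
      · injection he with _ hi he
        obtain rfl := Fin.ext hi
        exact (h₂ _ _ (k' _)).inst hG (hu _ (he ▸ k))
    · refine ⟨.ematch T n d₁ d₂, fun e' h => ?_⟩
      obtain ⟨_, _, rfl, h, h'⟩ | ⟨j, _, _, _, he, rfl, k, k'⟩ := h.ematch_inv
      · exact .ematch (h₁ _ h) fun j => h₂ j _ (h' j)
      · exact absurd ⟨_, _, he⟩ hc

/-- Reduction by `ExtRed` in any number of steps. -/
abbrev ExtReds (G : GCtx) : Expr → Expr → Prop := Relation.ReflTransGen (ExtRed G True)

theorem ExtReds.church_rosser {G : GCtx} (hG : G.Closed) {e a b : Expr}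
    (ha : ExtReds G e a) (hb : ExtReds G e b) : Relation.Join (ExtReds G) a b :=
  Relation.church_rosser (fun x _ _ h₁ h₂ =>
    let ⟨d, hd⟩ := ExtRed.triangle hG x
    ⟨d, .single (hd _ h₁), .single (hd _ h₂)⟩) ha hb

/-- A generator is a single extended step, and composing two joins is an instance of confluence. -/
theorem TyEquiv.join {G : GCtx} (hG : G.Closed) {a b : Expr} (h : TyEquiv G a b) :
    ∃ c, ExtReds G a c ∧ ExtReds G b c := by
  induction h with
  | rel _ _ h => exact ⟨_, .single h.toExt, .refl⟩
  | refl => exact ⟨_, .refl, .refl⟩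
  | symm _ _ _ ih => exact ⟨_, ih.choose_spec.2, ih.choose_spec.1⟩
  | trans _ _ _ _ _ ih₁ ih₂ =>
    obtain ⟨c, h₁, h₂⟩ := ih₁
    obtain ⟨d, h₃, h₄⟩ := ih₂
    obtain ⟨f, h₅, h₆⟩ := ExtReds.church_rosser hG h₂ h₃
    exact ⟨f, h₁.trans h₅, h₄.trans h₆⟩

-- Type equivalence: congruence, and the consequences of joinability.

theorem TyEquiv.refl {G : GCtx} (a : Expr) : TyEquiv G a a := Relation.EqvGen.refl _

theorem TyEquiv.symm {G : GCtx} {a b : Expr} (h : TyEquiv G a b) : TyEquiv G b a :=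
  Relation.EqvGen.symm _ _ h

theorem TyEquiv.trans {G : GCtx} {a b c : Expr} (h : TyEquiv G a b) (h' : TyEquiv G b c) :
    TyEquiv G a c := Relation.EqvGen.trans _ _ _ h h'

theorem ParRed.equiv {G : GCtx} {a b : Expr} (h : ParRed G a b) : TyEquiv G a b :=
  Relation.EqvGen.rel _ _ h

theorem ExtReds.equiv {G : GCtx} (hG : G.Closed) {a b : Expr} (h : ExtReds G a b) :
    TyEquiv G a b := by
  induction h with
  | refl => exact .refl _
  | tail _ h ih =>
    obtain ⟨_, h₁, h₂⟩ := h.exists_parRed hG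
    exact ih.trans (h₁.equiv.trans h₂.equiv)

theorem TyEquiv.of_join {G : GCtx} (hG : G.Closed) {a b c : Expr} (h : ExtReds G a c)
    (h' : ExtReds G b c) : TyEquiv G a b :=
  (h.equiv hG).trans (h'.equiv hG).symm

theorem TyEquiv.map {G : GCtx} {a b : Expr} {f : Expr → Expr}
    (hf : ∀ x y, ParRed G x y → ParRed G (f x) (f y)) (h : TyEquiv G a b) :
    TyEquiv G (f a) (f b) := by
  induction h with
  | rel _ _ h => exact (hf _ _ h).equiv
  | refl => exact .refl _
  | symm _ _ _ ih => exact ih.symm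
  | trans _ _ _ _ _ ih₁ ih₂ => exact ih₁.trans ih₂

theorem TyEquiv.subst {G : GCtx} (hG : G.Closed) {a b : Expr} (h : TyEquiv G a b)
    (σ : ℕ → Expr) : TyEquiv G (a.subst σ) (b.subst σ) :=
  h.map fun _ _ h => h.subst hG σ

theorem TyEquiv.rename {G : GCtx} (hG : G.Closed) {a b : Expr} (h : TyEquiv G a b)
    (ξ : ℕ → ℕ) : TyEquiv G (a.rename ξ) (b.rename ξ) :=
  h.map fun _ _ h => h.rename hG ξ

theorem TyEquiv.inst {G : GCtx} (hG : G.Closed) {a b : Expr} (h : TyEquiv G a b)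
    (u : Expr) : TyEquiv G (a.inst u) (b.inst u) := h.subst hG _

/-- The head of a type that is stable under reduction. -/
inductive TyHead : Type
  | unit | bool | obool | prod | osum | pi
  | psi (T : Name) | adt (T : Name)

/-- The stable head of a type, if it has one. -/
def Expr.head : Expr → Option TyHead
  | .unitT => some .unit
  | .boolT => some .bool
  | .oboolT => some .obool
  | .prodT _ _ => some .prod
  | .osumT _ _ => some .osum
  | .pi _ _ => some .pi
  | .psiT T => some (.psi T)
  | .adt T => some (.adt T)
  | _ => none

theorem ExtRed.head {G : GCtx} {x : Prop} {a b : Expr} {t : TyHead} (h : ExtRed G x a b)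
    (ha : a.head = some t) : b.head = some t := by
  cases h <;> simp_all [Expr.head]

theorem ExtReds.head {G : GCtx} {a b : Expr} {t : TyHead} (h : ExtReds G a b)
    (ha : a.head = some t) : b.head = some t := by
  induction h with
  | refl => exact ha
  | tail _ h ih => exact h.head ih

/-- A stable head persists on both sides down to a common reduct. This rules out impossible
conversions in preservation and in the canonical forms lemma. -/
theorem TyEquiv.head_eq {G : GCtx} (hG : G.Closed) {a b : Expr} {t t' : TyHead}
    (h : TyEquiv G a b) (ha : a.head = some t) (hb : b.head = some t') : t = t' := by
  obtain ⟨c, h₁, h₂⟩ := h.join hG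
  exact Option.some.inj ((h₁.head ha).symm.trans (h₂.head hb))

theorem ExtReds.prodT_inv {G : GCtx} {a b y : Expr} (h : ExtReds G (.prodT a b) y) :
    ∃ a' b', y = .prodT a' b' ∧ ExtReds G a a' ∧ ExtReds G b b' := by
  induction h with
  | refl => exact ⟨_, _, rfl, .refl, .refl⟩
  | tail _ h ih =>
    obtain ⟨_, _, rfl, h₁, h₂⟩ := ih
    obtain ⟨_, _, rfl, h₃, h₄⟩ := h.prodT_inv
    exact ⟨_, _, rfl, h₁.tail h₃, h₂.tail h₄⟩

theorem ExtReds.osumT_inv {G : GCtx} {a b y : Expr} (h : ExtReds G (.osumT a b) y) :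
    ∃ a' b', y = .osumT a' b' ∧ ExtReds G a a' ∧ ExtReds G b b' := by
  induction h with
  | refl => exact ⟨_, _, rfl, .refl, .refl⟩
  | tail _ h ih =>
    obtain ⟨_, _, rfl, h₁, h₂⟩ := ih
    obtain ⟨_, _, rfl, h₃, h₄⟩ := h.osumT_inv
    exact ⟨_, _, rfl, h₁.tail h₃, h₂.tail h₄⟩

theorem ExtReds.pi_inv {G : GCtx} {a b y : Expr} (h : ExtReds G (.pi a b) y) :
    ∃ a' b', y = .pi a' b' ∧ ExtReds G a a' ∧ ExtReds G b b' := by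
  induction h with
  | refl => exact ⟨_, _, rfl, .refl, .refl⟩
  | tail _ h ih =>
    obtain ⟨_, _, rfl, h₁, h₂⟩ := ih
    obtain ⟨_, _, rfl, h₃, h₄⟩ := h.pi_inv
    exact ⟨_, _, rfl, h₁.tail h₃, h₂.tail h₄⟩

theorem TyEquiv.prodT_inj {G : GCtx} (hG : G.Closed) {a b a' b' : Expr}
    (h : TyEquiv G (.prodT a b) (.prodT a' b')) : TyEquiv G a a' ∧ TyEquiv G b b' := by
  obtain ⟨c, h₁, h₂⟩ := h.join hG
  obtain ⟨_, _, rfl, h₃, h₄⟩ := h₁.prodT_inv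
  obtain ⟨_, _, h, h₅, h₆⟩ := h₂.prodT_inv
  cases h
  exact ⟨.of_join hG h₃ h₅, .of_join hG h₄ h₆⟩

theorem TyEquiv.osumT_inj {G : GCtx} (hG : G.Closed) {a b a' b' : Expr}
    (h : TyEquiv G (.osumT a b) (.osumT a' b')) : TyEquiv G a a' ∧ TyEquiv G b b' := by
  obtain ⟨c, h₁, h₂⟩ := h.join hG
  obtain ⟨_, _, rfl, h₃, h₄⟩ := h₁.osumT_inv
  obtain ⟨_, _, h, h₅, h₆⟩ := h₂.osumT_inv
  cases h
  exact ⟨.of_join hG h₃ h₅, .of_join hG h₄ h₆⟩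

/-- A common reduct of two Π-types is again a Π-type whose components are common reducts of the
components. Typing the β-reduct in preservation depends on this. -/
theorem TyEquiv.pi_inj {G : GCtx} (hG : G.Closed) {a b a' b' : Expr}
    (h : TyEquiv G (.pi a b) (.pi a' b')) : TyEquiv G a a' ∧ TyEquiv G b b' := by
  obtain ⟨c, h₁, h₂⟩ := h.join hG
  obtain ⟨_, _, rfl, h₃, h₄⟩ := h₁.pi_inv
  obtain ⟨_, _, h, h₅, h₆⟩ := h₂.pi_inv
  cases h
  exact ⟨.of_join hG h₃ h₅, .of_join hG h₄ h₆⟩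

theorem ExtReds.oTy_inv {G : GCtx} {w : OTy} {y : Expr} (h : ExtReds G w.toExpr y) :
    y = w.toExpr := by
  induction h with
  | refl => rfl
  | tail _ h ih => rw [ih] at h; exact h.oTy_inv

theorem TyEquiv.oTy_inj {G : GCtx} (hG : G.Closed) {w w' : OTy}
    (h : TyEquiv G w.toExpr w'.toExpr) : w = w' := by
  obtain ⟨c, h₁, h₂⟩ := h.join hG
  exact OTy.toExpr_injective (h₁.oTy_inv.symm.trans h₂.oTy_inv)

/-! ### Scoping, weakening and substitution for typing -/

/-- Simultaneous induction on kinding and typing derivations. -/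
theorem judgment_induction {G : GCtx} {P : Mode → Ctx → Expr → Kind → Prop}
    {Q : Mode → Ctx → Expr → Expr → Prop}
    (k_sub : ∀ {m : Mode} {Γ : Ctx} {τ : Expr} {κ κ' : Kind}, Kinding G m Γ τ κ → κ.le κ' →
      P m Γ τ κ → P m Γ τ κ')
    (k_unit : ∀ {m : Mode} {Γ : Ctx}, P m Γ .unitT .any)
    (k_bool : ∀ {m : Mode} {Γ : Ctx}, P m Γ .boolT .pub)
    (k_obool : ∀ {m : Mode} {Γ : Ctx}, P m Γ .oboolT .obl)
    (k_adt : ∀ {m : Mode} {Γ : Ctx} {T : Name} {d : ADTDef}, G.adt T = some d → P m Γ (.adt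
      T) .pub)
    (k_oadt : ∀ {m : Mode} {Γ : Ctx} {T : Name} {d : OADTDef} {e : Expr}, G.oadt T = some d
      → Typing G m Γ e d.view → Q m Γ e d.view → P m Γ (.oadt T e) .obl)
    (k_pi : ∀ {m : Mode} {Γ : Ctx} {τ₁ τ₂ : Expr} {κ₁ κ₂ : Kind}, Kinding G m Γ τ₁ κ₁ →
      Kinding G m (τ₁ :: Γ) τ₂ κ₂ → P m Γ τ₁ κ₁ → P m (τ₁ :: Γ) τ₂ κ₂ → P m Γ (.pi τ₁ τ₂)
      .mixed)
    (k_prod : ∀ {m : Mode} {Γ : Ctx} {τ₁ τ₂ : Expr} {κ : Kind}, Kinding G m Γ τ₁ κ → Kinding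
      G m Γ τ₂ κ → P m Γ τ₁ κ → P m Γ τ₂ κ → P m Γ (.prodT τ₁ τ₂) κ)
    (k_osum : ∀ {m : Mode} {Γ : Ctx} {τ₁ τ₂ : Expr}, Kinding G m Γ τ₁ .obl → Kinding G m Γ
      τ₂ .obl → P m Γ τ₁ .obl → P m Γ τ₂ .obl → P m Γ (.osumT τ₁ τ₂) .obl)
    (k_psi : ∀ {m : Mode} {Γ : Ctx} {T : Name} {d : OADTDef}, G.oadt T = some d → P m Γ
      (.psiT T) .mixed)
    (k_letE : ∀ {m : Mode} {Γ : Ctx} {e τ τ' : Expr}, Typing G m Γ e τ → Kinding G m (τ ::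
      Γ) τ' .obl → Q m Γ e τ → P m (τ :: Γ) τ' .obl → P m Γ (.letE e τ') .obl)
    (k_ite : ∀ {m : Mode} {Γ : Ctx} {e τ₁ τ₂ : Expr}, Typing G m Γ e .boolT → Kinding G m Γ
      τ₁ .obl → Kinding G m Γ τ₂ .obl → Q m Γ e .boolT → P m Γ τ₁ .obl → P m Γ τ₂ .obl → P m
      Γ (.ite e τ₁ τ₂) .obl)
    (k_ematch : ∀ {m : Mode} {Γ : Ctx} {T : Name} {n : ℕ} {arg bs : Fin n → Expr} {e :
      Expr}, G.adt T = some ⟨n, arg⟩ → Typing G m Γ e (.adt T) → (∀ i, Kinding G m (arg i ::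
      Γ) (bs i) .obl) → Q m Γ e (.adt T) → (∀ i, P m (arg i :: Γ) (bs i) .obl) → P m Γ
      (.ematch T n e bs) .obl)
    (t_conv : ∀ {m : Mode} {Γ : Ctx} {e τ τ' : Expr} {κ : Kind}, Typing G m Γ e τ → TyEquiv
      G τ τ' → Kinding G m Γ τ' κ → Q m Γ e τ → P m Γ τ' κ → Q m Γ e τ')
    (t_tt : ∀ {m : Mode} {Γ : Ctx}, Q m Γ .tt .unitT)
    (t_lit : ∀ {m : Mode} {Γ : Ctx} {b : Bool}, Q m Γ (.lit b) .boolT)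
    (t_bvar : ∀ {m : Mode} {Γ : Ctx} {x : ℕ} {τ : Expr} {κ : Kind}, Γ[x]? = some τ → Kinding
      G m Γ (τ.rename (fun y => y + (x + 1))) κ → P m Γ (τ.rename (fun y => y + (x + 1))) κ
      → Q m Γ (.bvar x) (τ.rename (fun y => y + (x + 1))))
    (t_gvar : ∀ {m : Mode} {Γ : Ctx} {f : Name} {d : FnDef}, G.fn f = some d → d.mode.usable
      m → Q m Γ (.gvar f) d.ty)
    (t_abs : ∀ {m : Mode} {Γ : Ctx} {τ₁ τ₂ e : Expr} {κ : Kind}, Kinding G m Γ τ₁ κ → Typing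
      G m (τ₁ :: Γ) e τ₂ → P m Γ τ₁ κ → Q m (τ₁ :: Γ) e τ₂ → Q m Γ (.abs τ₁ e) (.pi τ₁ τ₂))
    (t_app : ∀ {m : Mode} {Γ : Ctx} {τ₁ τ₂ f e : Expr}, Typing G m Γ f (.pi τ₁ τ₂) → Typing
      G m Γ e τ₁ → Q m Γ f (.pi τ₁ τ₂) → Q m Γ e τ₁ → Q m Γ (.app f e) (τ₂.inst e))
    (t_letE : ∀ {m : Mode} {Γ : Ctx} {τ₁ τ₂ e₁ e₂ : Expr}, Typing G m Γ e₁ τ₁ → Typing G m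
      (τ₁ :: Γ) e₂ τ₂ → Q m Γ e₁ τ₁ → Q m (τ₁ :: Γ) e₂ τ₂ → Q m Γ (.letE e₁ e₂) (τ₂.inst
      e₁))
    (t_pair : ∀ {m : Mode} {Γ : Ctx} {τ₁ τ₂ e₁ e₂ : Expr}, Typing G m Γ e₁ τ₁ → Typing G m Γ
      e₂ τ₂ → Q m Γ e₁ τ₁ → Q m Γ e₂ τ₂ → Q m Γ (.pair e₁ e₂) (.prodT τ₁ τ₂))
    (t_proj : ∀ {m : Mode} {Γ : Ctx} {b : Bool} {τ₁ τ₂ e : Expr}, Typing G m Γ e (.prodT τ₁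
      τ₂) → Q m Γ e (.prodT τ₁ τ₂) → Q m Γ (.proj b e) (cond b τ₁ τ₂))
    (t_ite : ∀ {m : Mode} {Γ : Ctx} {e₀ e₁ e₂ τ : Expr} {κ : Kind}, Typing G m Γ e₀ .boolT →
      Typing G m Γ e₁ (τ.inst (.lit true)) → Typing G m Γ e₂ (τ.inst (.lit false)) → Kinding
      G m Γ (τ.inst e₀) κ → Q m Γ e₀ .boolT → Q m Γ e₁ (τ.inst (.lit true)) → Q m Γ e₂
      (τ.inst (.lit false)) → P m Γ (τ.inst e₀) κ → Q m Γ (.ite e₀ e₁ e₂) (τ.inst e₀))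
    (t_ctor : ∀ {m : Mode} {Γ : Ctx} {T : Name} {n : ℕ} {arg : Fin n → Expr} {i : Fin n} {e
      : Expr}, G.adt T = some ⟨n, arg⟩ → Typing G m Γ e (arg i) → Q m Γ e (arg i) → Q m Γ
      (.ctor T i e) (.adt T))
    (t_ematch : ∀ {m : Mode} {Γ : Ctx} {T : Name} {n : ℕ} {arg bs : Fin n → Expr} {e₀ τ :
      Expr} {κ : Kind}, G.adt T = some ⟨n, arg⟩ → Typing G m Γ e₀ (.adt T) → (∀ i : Fin n,
      Typing G m (arg i :: Γ) (bs i) (τ.subst (ctorSub T i))) → Kinding G m Γ (τ.inst e₀) κ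
      → Q m Γ e₀ (.adt T) → (∀ i : Fin n, Q m (arg i :: Γ) (bs i) (τ.subst (ctorSub T i))) →
      P m Γ (τ.inst e₀) κ → Q m Γ (.ematch T n e₀ bs) (τ.inst e₀))
    (t_psiPair : ∀ {m : Mode} {Γ : Ctx} {T : Name} {d : OADTDef} {e₁ e₂ : Expr}, G.oadt T =
      some d → Typing G m Γ e₁ d.view → Typing G m Γ e₂ (.oadt T e₁) → Q m Γ e₁ d.view → Q m
      Γ e₂ (.oadt T e₁) → Q m Γ (.psiPair e₁ e₂) (.psiT T))
    (t_psiProj₁ : ∀ {m : Mode} {Γ : Ctx} {T : Name} {d : OADTDef} {e : Expr}, G.oadt T =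
      some d → Typing G m Γ e (.psiT T) → Q m Γ e (.psiT T) → Q m Γ (.proj true e) d.view)
    (t_psiProj₂ : ∀ {m : Mode} {Γ : Ctx} {T : Name} {d : OADTDef} {e : Expr}, G.oadt T =
      some d → Typing G m Γ e (.psiT T) → Q m Γ e (.psiT T) → Q m Γ (.proj false e) (.oadt T
      (.proj true e)))
    (t_mux : ∀ {m : Mode} {Γ : Ctx} {e₀ e₁ e₂ τ : Expr} {κ : Kind}, Typing G m Γ e₀ .oboolT
      → Kinding G m Γ τ κ → (m = .secure → κ = .obl) → Typing G m Γ e₁ τ → Typing G m Γ e₂ τ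
      → Q m Γ e₀ .oboolT → P m Γ τ κ → Q m Γ e₁ τ → Q m Γ e₂ τ → Q m Γ (.mux e₀ e₁ e₂) τ)
    (t_oinj : ∀ {m : Mode} {Γ : Ctx} {b : Bool} {τ₁ τ₂ e : Expr}, Typing G m Γ e (cond b τ₁
      τ₂) → Kinding G m Γ (.osumT τ₁ τ₂) .obl → Q m Γ e (cond b τ₁ τ₂) → P m Γ (.osumT τ₁
      τ₂) .obl → Q m Γ (.oinj b (.osumT τ₁ τ₂) e) (.osumT τ₁ τ₂))
    (t_omatch : ∀ {m : Mode} {Γ : Ctx} {e₀ e₁ e₂ τ₁ τ₂ τ : Expr} {κ : Kind}, Typing G m Γ e₀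
      (.osumT τ₁ τ₂) → Kinding G m Γ τ κ → (m = .secure → κ = .obl) → Typing G m (τ₁ :: Γ)
      e₁ τ.shift → Typing G m (τ₂ :: Γ) e₂ τ.shift → Q m Γ e₀ (.osumT τ₁ τ₂) → P m Γ τ κ → Q
      m (τ₁ :: Γ) e₁ τ.shift → Q m (τ₂ :: Γ) e₂ τ.shift → Q m Γ (.omatch e₀ e₁ e₂) τ)
    (t_sec : ∀ {m : Mode} {Γ : Ctx} {e : Expr}, Typing G m Γ e .boolT → Q m Γ e .boolT → Q m
      Γ (.sec e) .oboolT)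
    (t_boxedLit : ∀ {m : Mode} {Γ : Ctx} {b : Bool}, Q m Γ (.boxedLit b) .oboolT)
    (t_boxedInj : ∀ {m : Mode} {Γ : Ctx} {b : Bool} {w : OTy} {v : OVal}, OValTy (.boxedInj
      b w v) w → Q m Γ (.boxedInj b w v) w.toExpr) :
    (∀ m Γ τ κ, Kinding G m Γ τ κ → P m Γ τ κ) ∧ (∀ m Γ e τ, Typing G m Γ e τ → Q m Γ e τ) :=
  -- The mode is constant along a derivation, hence a parameter of the recursor; the motives are
  -- taken at the fixed `m`.
  ⟨fun m _ _ _ h =>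
      Kinding.rec (motive_1 := fun Γ τ κ _ => P m Γ τ κ) (motive_2 := fun Γ e τ _ => Q m Γ
        e τ) k_sub k_unit k_bool k_obool k_adt k_oadt k_pi k_prod k_osum k_psi k_letE
        k_ite k_ematch t_conv t_tt t_lit t_bvar t_gvar t_abs t_app t_letE t_pair t_proj
        t_ite t_ctor t_ematch t_psiPair t_psiProj₁ t_psiProj₂ t_mux t_oinj t_omatch t_sec
        t_boxedLit t_boxedInj h,
    fun m _ _ _ h =>
      Typing.rec (motive_1 := fun Γ τ κ _ => P m Γ τ κ) (motive_2 := fun Γ e τ _ => Q m Γ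
        e τ) k_sub k_unit k_bool k_obool k_adt k_oadt k_pi k_prod k_osum k_psi k_letE
        k_ite k_ematch t_conv t_tt t_lit t_bvar t_gvar t_abs t_app t_letE t_pair t_proj
        t_ite t_ctor t_ematch t_psiPair t_psiProj₁ t_psiProj₂ t_mux t_oinj t_omatch t_sec
        t_boxedLit t_boxedInj h⟩

/-- The reason that components of well-typed global definitions can be placed under binders without
shifting. -/
theorem Judgment.scoped {G : GCtx} :
    (∀ m Γ τ κ, Kinding G m Γ τ κ → τ.Scoped Γ.length) ∧
      (∀ m Γ e τ, Typing G m Γ e τ → e.Scoped Γ.length) := by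
  apply judgment_induction <;> intros <;> intro σ ρ hσ <;> have hσ' := upSub_agree hσ
  case t_bvar h _ _ => exact hσ _ (List.getElem?_eq_some_iff.1 h).1
  case k_sub h => exact h _ _ hσ
  case t_conv h _ => exact h _ _ hσ
  case t_oinj h₁ h₂ =>
    have := h₂ _ _ hσ
    simp only [Expr.subst] at this ⊢
    rw [h₁ _ _ hσ, this]
  all_goals simp only [Expr.subst]
  all_goals congr 1
  all_goals first
    | (apply_assumption; assumption)
    | (funext; apply_assumption; assumption)

theorem GCtx.WellTyped.closed {G : GCtx} (hG : G.WellTyped) : G.Closed where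
  ty f d h := Judgment.scoped.1 _ _ _ _ (hG.fn f d h).1.choose_spec
  body f d h := Judgment.scoped.2 _ _ _ _ (hG.fn f d h).2
  arg T n arg h i := Judgment.scoped.1 _ _ _ _ (hG.adt T n arg h i)
  view T d h := Judgment.scoped.1 _ _ _ _ (hG.oadt T d h).1
  obody T d h := Judgment.scoped.1 _ _ _ _ (hG.oadt T d h).2

theorem Typing.closed {G : GCtx} {m : Mode} {e τ : Expr} (h : Typing G m [] e τ) : e.Closed :=
  Judgment.scoped.2 _ _ _ _ h

theorem Mode.usable.trans {m₁ m₂ m₃ : Mode} (h : m₁.usable m₂) (h' : m₂.usable m₃) :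
    m₁.usable m₃ := fun h₃ => h (h' h₃)

/-- Secure derivations are leaky derivations. -/
theorem Judgment.mode {G : GCtx} :
    (∀ m Γ τ κ, Kinding G m Γ τ κ → ∀ m', m.usable m' → Kinding G m' Γ τ κ) ∧
      (∀ m Γ e τ, Typing G m Γ e τ → ∀ m', m.usable m' → Typing G m' Γ e τ) := by
  apply judgment_induction <;> intros
  case k_sub h ih m' hm => exact .sub (ih _ hm) h
  case k_unit => exact .unit
  case k_bool => exact .bool
  case k_obool => exact .obool
  case k_adt h m' hm => exact .adt h
  case k_oadt h _ ih m' hm => exact .oadt h (ih _ hm)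
  case k_pi ih₁ ih₂ m' hm => exact .pi (ih₁ _ hm) (ih₂ _ hm)
  case k_prod ih₁ ih₂ m' hm => exact .prod (ih₁ _ hm) (ih₂ _ hm)
  case k_osum ih₁ ih₂ m' hm => exact .osum (ih₁ _ hm) (ih₂ _ hm)
  case k_psi h m' hm => exact .psi h
  case k_letE ih₁ ih₂ m' hm => exact .letE (ih₁ _ hm) (ih₂ _ hm)
  case k_ite ih₁ ih₂ ih₃ m' hm => exact .ite (ih₁ _ hm) (ih₂ _ hm) (ih₃ _ hm)
  case k_ematch h _ _ ih₁ ih₂ m' hm => exact .ematch h (ih₁ _ hm) fun i => ih₂ i _ hm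
  case t_conv h _ ih₁ ih₂ m' hm => exact .conv (ih₁ _ hm) h (ih₂ _ hm)
  case t_tt => exact .tt
  case t_lit => exact .lit
  case t_bvar h _ ih m' hm => exact .bvar h (ih _ hm)
  case t_gvar h hu m' hm => exact .gvar h (hu.trans hm)
  case t_abs ih₁ ih₂ m' hm => exact .abs (ih₁ _ hm) (ih₂ _ hm)
  case t_app ih₁ ih₂ m' hm => exact .app (ih₁ _ hm) (ih₂ _ hm)
  case t_letE ih₁ ih₂ m' hm => exact .letE (ih₁ _ hm) (ih₂ _ hm)
  case t_pair ih₁ ih₂ m' hm => exact .pair (ih₁ _ hm) (ih₂ _ hm)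
  case t_proj ih m' hm => exact .proj (ih _ hm)
  case t_ite ih₁ ih₂ ih₃ ih₄ m' hm => exact .ite (ih₁ _ hm) (ih₂ _ hm) (ih₃ _ hm) (ih₄ _ hm)
  case t_ctor h _ ih m' hm => exact .ctor h (ih _ hm)
  case t_ematch h _ _ _ ih₁ ih₂ ih₃ m' hm =>
    exact .ematch h (ih₁ _ hm) (fun i => ih₂ i _ hm) (ih₃ _ hm)
  case t_psiPair h _ _ ih₁ ih₂ m' hm => exact .psiPair h (ih₁ _ hm) (ih₂ _ hm)
  case t_psiProj₁ h _ ih m' hm => exact .psiProj₁ h (ih _ hm)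
  case t_psiProj₂ h _ ih m' hm => exact .psiProj₂ h (ih _ hm)
  case t_mux hκ _ _ ih₁ ih₂ ih₃ ih₄ m' hm =>
    exact .mux (ih₁ _ hm) (ih₂ _ hm) (fun h => hκ (hm h)) (ih₃ _ hm) (ih₄ _ hm)
  case t_oinj ih₁ ih₂ m' hm => exact .oinj (ih₁ _ hm) (ih₂ _ hm)
  case t_omatch hκ _ _ ih₁ ih₂ ih₃ ih₄ m' hm =>
    exact .omatch (ih₁ _ hm) (ih₂ _ hm) (fun h => hκ (hm h)) (ih₃ _ hm) (ih₄ _ hm)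
  case t_sec ih m' hm => exact .sec (ih _ hm)
  case t_boxedLit => exact .boxedLit
  case t_boxedInj h m' hm => exact .boxedInj h

/-- `ξ` maps the variables of `Γ` to variables of `Δ` of the corresponding types. -/
def CtxRen (ξ : ℕ → ℕ) (Γ Δ : Ctx) : Prop :=
  ∀ x τ, Γ[x]? = some τ → ∃ τ', Δ[ξ x]? = some τ' ∧
    τ'.rename (fun y => y + (ξ x + 1)) = (τ.rename fun y => y + (x + 1)).rename ξ

theorem CtxRen.up {ξ : ℕ → ℕ} {Γ Δ : Ctx} (h : CtxRen ξ Γ Δ) (a : Expr) :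
    CtxRen (upRen ξ) (a :: Γ) (a.rename ξ :: Δ) := by
  rintro (_ | x) τ hx
  · obtain rfl := Option.some.inj hx
    refine ⟨_, rfl, ?_⟩
    simp only [Expr.rename_rename, upRen, Nat.zero_add]
  · obtain ⟨τ', h₁, h₂⟩ := h x τ hx
    refine ⟨τ', h₁, ?_⟩
    have := congrArg (Expr.rename Nat.succ) h₂
    simp only [Expr.rename_rename] at this ⊢
    exact this

theorem CtxRen.up_closed {ξ : ℕ → ℕ} {Γ Δ : Ctx} (h : CtxRen ξ Γ Δ) {a : Expr}
    (ha : a.Closed) : CtxRen (upRen ξ) (a :: Γ) (a :: Δ) := by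
  simpa only [ha.rename_eq] using h.up a

theorem CtxRen.succ (Γ : Ctx) (a : Expr) : CtxRen Nat.succ Γ (a :: Γ) := fun x τ h =>
  ⟨τ, h, by simp only [Expr.rename_rename]; rfl⟩

theorem CtxRen.nil (ξ : ℕ → ℕ) (Γ : Ctx) : CtxRen ξ [] Γ := fun x τ h => by simp at h

/-- Typing and kinding are stable under renaming. -/
theorem Judgment.rename {G : GCtx} (hG : G.Closed) :
    (∀ m Γ τ κ, Kinding G m Γ τ κ → ∀ ξ Δ, CtxRen ξ Γ Δ → Kinding G m Δ (τ.rename ξ) κ) ∧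
      (∀ m Γ e τ, Typing G m Γ e τ → ∀ ξ Δ, CtxRen ξ Γ Δ →
        Typing G m Δ (e.rename ξ) (τ.rename ξ)) := by
  apply judgment_induction <;> intros
  case k_sub h ih ξ Δ hξ => exact .sub (ih _ _ hξ) h
  case k_unit => exact .unit
  case k_bool => exact .bool
  case k_obool => exact .obool
  case k_adt h ξ Δ hξ => exact .adt h
  case k_oadt h _ ih ξ Δ hξ =>
    exact .oadt h (by simpa only [(hG.view _ _ h).rename_eq] using ih _ _ hξ)
  case k_pi ih₁ ih₂ ξ Δ hξ => exact .pi (ih₁ _ _ hξ) (ih₂ _ _ (hξ.up _))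
  case k_prod ih₁ ih₂ ξ Δ hξ => exact .prod (ih₁ _ _ hξ) (ih₂ _ _ hξ)
  case k_osum ih₁ ih₂ ξ Δ hξ => exact .osum (ih₁ _ _ hξ) (ih₂ _ _ hξ)
  case k_psi h ξ Δ hξ => exact .psi h
  case k_letE ih₁ ih₂ ξ Δ hξ => exact .letE (ih₁ _ _ hξ) (ih₂ _ _ (hξ.up _))
  case k_ite ih₁ ih₂ ih₃ ξ Δ hξ => exact .ite (ih₁ _ _ hξ) (ih₂ _ _ hξ) (ih₃ _ _ hξ)
  case k_ematch h _ _ ih₁ ih₂ ξ Δ hξ =>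
    exact .ematch h (ih₁ _ _ hξ) fun i => ih₂ i _ _ (hξ.up_closed (hG.arg _ _ _ h i))
  case t_conv h _ ih₁ ih₂ ξ Δ hξ => exact .conv (ih₁ _ _ hξ) (h.rename hG ξ) (ih₂ _ _ hξ)
  case t_tt => exact .tt
  case t_lit => exact .lit
  case t_bvar h _ ih ξ Δ hξ =>
    obtain ⟨τ', h₁, h₂⟩ := hξ _ _ h
    have := ih _ _ hξ
    rw [← h₂] at this ⊢
    exact .bvar h₁ this
  case t_gvar h hu ξ Δ hξ => rw [(hG.ty _ _ h).rename_eq]; exact .gvar h hu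
  case t_abs ih₁ ih₂ ξ Δ hξ => exact .abs (ih₁ _ _ hξ) (ih₂ _ _ (hξ.up _))
  case t_app ih₁ ih₂ ξ Δ hξ => rw [Expr.inst_rename]; exact .app (ih₁ _ _ hξ) (ih₂ _ _ hξ)
  case t_letE ih₁ ih₂ ξ Δ hξ =>
    rw [Expr.inst_rename]; exact .letE (ih₁ _ _ hξ) (ih₂ _ _ (hξ.up _))
  case t_pair ih₁ ih₂ ξ Δ hξ => exact .pair (ih₁ _ _ hξ) (ih₂ _ _ hξ)
  case t_proj ih ξ Δ hξ => rw [cond_rename]; exact .proj (ih _ _ hξ)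
  case t_ite ih₁ ih₂ ih₃ ih₄ ξ Δ hξ =>
    simp only [Expr.inst_rename] at *
    exact .ite (ih₁ _ _ hξ) (ih₂ _ _ hξ) (ih₃ _ _ hξ) (ih₄ _ _ hξ)
  case t_ctor h _ ih ξ Δ hξ =>
    exact .ctor h (by simpa only [(hG.arg _ _ _ h _).rename_eq] using ih _ _ hξ)
  case t_ematch h _ _ _ ih₁ ih₂ ih₃ ξ Δ hξ =>
    simp only [Expr.inst_rename] at *
    refine .ematch h (ih₁ _ _ hξ) (fun i => ?_) (ih₃ _ _ hξ)
    rw [← Expr.ctorSub_rename]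
    exact ih₂ i _ _ (hξ.up_closed (hG.arg _ _ _ h i))
  case t_psiPair h _ _ ih₁ ih₂ ξ Δ hξ =>
    exact .psiPair h (by simpa only [(hG.view _ _ h).rename_eq] using ih₁ _ _ hξ) (ih₂ _ _ hξ)
  case t_psiProj₁ h _ ih ξ Δ hξ =>
    rw [(hG.view _ _ h).rename_eq]; exact .psiProj₁ h (ih _ _ hξ)
  case t_psiProj₂ h _ ih ξ Δ hξ => exact .psiProj₂ h (ih _ _ hξ)
  case t_mux hκ _ _ ih₁ ih₂ ih₃ ih₄ ξ Δ hξ =>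
    exact .mux (ih₁ _ _ hξ) (ih₂ _ _ hξ) hκ (ih₃ _ _ hξ) (ih₄ _ _ hξ)
  case t_oinj ih₁ ih₂ ξ Δ hξ =>
    exact .oinj (by simpa only [cond_rename] using ih₁ _ _ hξ) (ih₂ _ _ hξ)
  case t_omatch hκ _ _ ih₁ ih₂ ih₃ ih₄ ξ Δ hξ =>
    refine .omatch (ih₁ _ _ hξ) (ih₂ _ _ hξ) hκ ?_ ?_ <;> rw [← Expr.shift_rename_upRen]
    exacts [ih₃ _ _ (hξ.up _), ih₄ _ _ (hξ.up _)]
  case t_sec ih ξ Δ hξ => exact .sec (ih _ _ hξ)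
  case t_boxedLit => exact .boxedLit
  case t_boxedInj h ξ Δ hξ => rw [OTy.rename_toExpr]; exact .boxedInj h

theorem Typing.shift {G : GCtx} (hG : G.Closed) {m : Mode} {Γ : Ctx} {e τ : Expr}
    (h : Typing G m Γ e τ) (a : Expr) : Typing G m (a :: Γ) e.shift τ.shift :=
  (Judgment.rename hG).2 _ _ _ _ h _ _ (CtxRen.succ Γ a)

theorem Kinding.shift {G : GCtx} (hG : G.Closed) {m : Mode} {Γ : Ctx} {τ : Expr} {κ : Kind}
    (h : Kinding G m Γ τ κ) (a : Expr) : Kinding G m (a :: Γ) τ.shift κ :=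
  (Judgment.rename hG).1 _ _ _ _ h _ _ (CtxRen.succ Γ a)

theorem Kinding.weaken {G : GCtx} (hG : G.Closed) {m m' : Mode} {τ : Expr} {κ : Kind}
    (h : Kinding G m [] τ κ) (hm : m.usable m') (Γ : Ctx) : Kinding G m' Γ τ κ := by
  have hτ : τ.Closed := Judgment.scoped.1 _ _ _ _ h
  -- From the empty context every map is a context renaming; which one is chosen is immaterial
  -- because `τ` is closed.
  have := (Judgment.rename hG).1 _ _ _ _ (Judgment.mode.1 _ _ _ _ h _ hm) id Γ (CtxRen.nil _ _)
  rwa [hτ.rename_eq] at this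

/-- `σ` maps each variable of `Γ` to a variable of `Δ` of the corresponding type, or to a term
of `Δ` of that type. -/
def CtxSub (G : GCtx) (m : Mode) (σ : ℕ → Expr) (Γ Δ : Ctx) : Prop :=
  ∀ x τ, Γ[x]? = some τ →
    (∃ y τ', σ x = .bvar y ∧ Δ[y]? = some τ' ∧
      τ'.rename (fun z => z + (y + 1)) = (τ.rename fun z => z + (x + 1)).subst σ) ∨
    Typing G m Δ (σ x) ((τ.rename fun z => z + (x + 1)).subst σ)

/-- The variable alternative of `CtxSub` is needed here. Typing the new innermost variable would
require a kind for its type in `Δ`, which is not available; in the variable case of the substitution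
lemma that kind is supplied by the induction hypothesis. -/
theorem CtxSub.up {G : GCtx} (hG : G.Closed) {m : Mode} {σ : ℕ → Expr} {Γ Δ : Ctx}
    (h : CtxSub G m σ Γ Δ) (a : Expr) : CtxSub G m (upSub σ) (a :: Γ) (a.subst σ :: Δ) := by
  rintro (_ | x) τ hx
  · obtain rfl := Option.some.inj hx
    exact .inl ⟨0, _, rfl, rfl, (Expr.shift_subst_upSub _ σ).symm⟩
  · have key : (τ.rename fun z => z + (x + 1 + 1)).subst (upSub σ) =
        ((τ.rename fun z => z + (x + 1)).subst σ).shift := by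
      rw [← Expr.shift_subst_upSub, Expr.shift, Expr.rename_rename]; rfl
    rw [key]
    obtain ⟨y, τ', h₁, h₂, h₃⟩ | h := h x τ hx
    · refine .inl ⟨y + 1, τ', by simp only [upSub, h₁, Expr.shift, Expr.rename], h₂, ?_⟩
      rw [← h₃, Expr.shift, Expr.rename_rename]; rfl
    · exact .inr (h.shift hG _)

theorem CtxSub.up_closed {G : GCtx} (hG : G.Closed) {m : Mode} {σ : ℕ → Expr} {Γ Δ : Ctx}
    (h : CtxSub G m σ Γ Δ) {a : Expr} (ha : a.Closed) :
    CtxSub G m (upSub σ) (a :: Γ) (a :: Δ) := by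
  simpa only [ha.subst_eq] using h.up hG a

/-- Typing and kinding are stable under substitution. -/
theorem Judgment.subst {G : GCtx} (hG : G.Closed) :
    (∀ m Γ τ κ, Kinding G m Γ τ κ → ∀ σ Δ, CtxSub G m σ Γ Δ → Kinding G m Δ (τ.subst σ) κ) ∧
      (∀ m Γ e τ, Typing G m Γ e τ → ∀ σ Δ, CtxSub G m σ Γ Δ →
        Typing G m Δ (e.subst σ) (τ.subst σ)) := by
  apply judgment_induction <;> intros
  case k_sub h ih σ Δ hσ => exact .sub (ih _ _ hσ) h
  case k_unit => exact .unit
  case k_bool => exact .bool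
  case k_obool => exact .obool
  case k_adt h σ Δ hσ => exact .adt h
  case k_oadt h _ ih σ Δ hσ =>
    exact .oadt h (by simpa only [(hG.view _ _ h).subst_eq] using ih _ _ hσ)
  case k_pi ih₁ ih₂ σ Δ hσ => exact .pi (ih₁ _ _ hσ) (ih₂ _ _ (hσ.up hG _))
  case k_prod ih₁ ih₂ σ Δ hσ => exact .prod (ih₁ _ _ hσ) (ih₂ _ _ hσ)
  case k_osum ih₁ ih₂ σ Δ hσ => exact .osum (ih₁ _ _ hσ) (ih₂ _ _ hσ)
  case k_psi h σ Δ hσ => exact .psi h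
  case k_letE ih₁ ih₂ σ Δ hσ => exact .letE (ih₁ _ _ hσ) (ih₂ _ _ (hσ.up hG _))
  case k_ite ih₁ ih₂ ih₃ σ Δ hσ => exact .ite (ih₁ _ _ hσ) (ih₂ _ _ hσ) (ih₃ _ _ hσ)
  case k_ematch h _ _ ih₁ ih₂ σ Δ hσ =>
    exact .ematch h (ih₁ _ _ hσ) fun i => ih₂ i _ _ (hσ.up_closed hG (hG.arg _ _ _ h i))
  case t_conv h _ ih₁ ih₂ σ Δ hσ => exact .conv (ih₁ _ _ hσ) (h.subst hG σ) (ih₂ _ _ hσ)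
  case t_tt => exact .tt
  case t_lit => exact .lit
  case t_bvar h _ ih σ Δ hσ =>
    obtain ⟨y, τ', h₁, h₂, h₃⟩ | h := hσ _ _ h
    · have := ih _ _ hσ
      rw [← h₃] at this ⊢
      rw [Expr.subst, h₁]
      exact .bvar h₂ this
    · exact h
  case t_gvar h hu σ Δ hσ => rw [(hG.ty _ _ h).subst_eq]; exact .gvar h hu
  case t_abs ih₁ ih₂ σ Δ hσ => exact .abs (ih₁ _ _ hσ) (ih₂ _ _ (hσ.up hG _))
  case t_app ih₁ ih₂ σ Δ hσ => rw [Expr.inst_subst]; exact .app (ih₁ _ _ hσ) (ih₂ _ _ hσ)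
  case t_letE ih₁ ih₂ σ Δ hσ =>
    rw [Expr.inst_subst]; exact .letE (ih₁ _ _ hσ) (ih₂ _ _ (hσ.up hG _))
  case t_pair ih₁ ih₂ σ Δ hσ => exact .pair (ih₁ _ _ hσ) (ih₂ _ _ hσ)
  case t_proj ih σ Δ hσ => rw [cond_subst]; exact .proj (ih _ _ hσ)
  case t_ite ih₁ ih₂ ih₃ ih₄ σ Δ hσ =>
    simp only [Expr.inst_subst] at *
    exact .ite (ih₁ _ _ hσ) (ih₂ _ _ hσ) (ih₃ _ _ hσ) (ih₄ _ _ hσ)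
  case t_ctor h _ ih σ Δ hσ =>
    exact .ctor h (by simpa only [(hG.arg _ _ _ h _).subst_eq] using ih _ _ hσ)
  case t_ematch h _ _ _ ih₁ ih₂ ih₃ σ Δ hσ =>
    simp only [Expr.inst_subst] at *
    refine .ematch h (ih₁ _ _ hσ) (fun i => ?_) (ih₃ _ _ hσ)
    rw [← Expr.ctorSub_subst]
    exact ih₂ i _ _ (hσ.up_closed hG (hG.arg _ _ _ h i))
  case t_psiPair h _ _ ih₁ ih₂ σ Δ hσ =>
    exact .psiPair h (by simpa only [(hG.view _ _ h).subst_eq] using ih₁ _ _ hσ) (ih₂ _ _ hσ)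
  case t_psiProj₁ h _ ih σ Δ hσ =>
    rw [(hG.view _ _ h).subst_eq]; exact .psiProj₁ h (ih _ _ hσ)
  case t_psiProj₂ h _ ih σ Δ hσ => exact .psiProj₂ h (ih _ _ hσ)
  case t_mux hκ _ _ ih₁ ih₂ ih₃ ih₄ σ Δ hσ =>
    exact .mux (ih₁ _ _ hσ) (ih₂ _ _ hσ) hκ (ih₃ _ _ hσ) (ih₄ _ _ hσ)
  case t_oinj ih₁ ih₂ σ Δ hσ =>
    exact .oinj (by simpa only [cond_subst] using ih₁ _ _ hσ) (ih₂ _ _ hσ)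
  case t_omatch hκ _ _ ih₁ ih₂ ih₃ ih₄ σ Δ hσ =>
    refine .omatch (ih₁ _ _ hσ) (ih₂ _ _ hσ) hκ ?_ ?_ <;> rw [← Expr.shift_subst_upSub]
    exacts [ih₃ _ _ (hσ.up hG _), ih₄ _ _ (hσ.up hG _)]
  case t_sec ih σ Δ hσ => exact .sec (ih _ _ hσ)
  case t_boxedLit => exact .boxedLit
  case t_boxedInj h σ Δ hσ => rw [OTy.subst_toExpr]; exact .boxedInj h

theorem CtxSub.inst {G : GCtx} {m : Mode} {Γ : Ctx} {u a : Expr}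
    (hu : Typing G m Γ u a) : CtxSub G m (instSub u) (a :: Γ) Γ := by
  rintro (_ | x) τ hx
  · obtain rfl := Option.some.inj hx
    refine .inr ?_
    rw [show (a.rename _).subst (instSub u) = a from Expr.shift_inst a u]
    exact hu
  · refine .inl ⟨x, τ, rfl, hx, ?_⟩
    rw [Expr.rename_eq_subst, Expr.rename_eq_subst, Expr.subst_subst]; rfl

theorem Typing.inst {G : GCtx} (hG : G.Closed) {m : Mode} {Γ : Ctx} {e τ u a : Expr}
    (h : Typing G m (a :: Γ) e τ) (hu : Typing G m Γ u a) :
    Typing G m Γ (e.inst u) (τ.inst u) :=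
  (Judgment.subst hG).2 _ _ _ _ h _ _ (CtxSub.inst hu)

theorem Kinding.inst {G : GCtx} (hG : G.Closed) {m : Mode} {Γ : Ctx} {τ u a : Expr} {κ : Kind}
    (h : Kinding G m (a :: Γ) τ κ) (hu : Typing G m Γ u a) : Kinding G m Γ (τ.inst u) κ :=
  (Judgment.subst hG).1 _ _ _ _ h _ _ (CtxSub.inst hu)

/-- Context conversion is the identity substitution in which the innermost variable is retyped by
`conv`. -/
theorem CtxSub.conv_head {G : GCtx} (hG : G.Closed) {m : Mode} {Γ : Ctx} {a b : Expr}
    {κ κ' : Kind} (ha : Kinding G m Γ a κ) (hb : Kinding G m Γ b κ') (h : TyEquiv G b a) :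
    CtxSub G m .bvar (a :: Γ) (b :: Γ) := by
  rintro (_ | x) τ hx
  · obtain rfl := Option.some.inj hx
    rw [Expr.subst_bvar]
    exact .inr (.conv (.bvar (τ := b) rfl (hb.shift hG b)) (h.rename hG _) (ha.shift hG b))
  · exact .inl ⟨x + 1, τ, rfl, hx, (Expr.subst_bvar _).symm⟩

theorem Typing.conv_head {G : GCtx} (hG : G.Closed) {m : Mode} {Γ : Ctx} {a b e τ : Expr}
    {κ κ' : Kind} (h : Typing G m (a :: Γ) e τ) (ha : Kinding G m Γ a κ)
    (hb : Kinding G m Γ b κ') (hab : TyEquiv G b a) : Typing G m (b :: Γ) e τ := by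
  have := (Judgment.subst hG).2 _ _ _ _ h _ _ (CtxSub.conv_head hG ha hb hab)
  rwa [Expr.subst_bvar, Expr.subst_bvar] at this

theorem Kinding.conv_head {G : GCtx} (hG : G.Closed) {m : Mode} {Γ : Ctx} {a b τ : Expr}
    {κ κ' κ'' : Kind} (h : Kinding G m (a :: Γ) τ κ'') (ha : Kinding G m Γ a κ)
    (hb : Kinding G m Γ b κ') (hab : TyEquiv G b a) : Kinding G m (b :: Γ) τ κ'' := by
  have := (Judgment.subst hG).1 _ _ _ _ h _ _ (CtxSub.conv_head hG ha hb hab)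
  rwa [Expr.subst_bvar] at this

/-! ### Inversion of kinding and typing -/

theorem Kinding.mixed {G : GCtx} {m : Mode} {Γ : Ctx} {τ : Expr} {κ : Kind}
    (h : Kinding G m Γ τ κ) : Kinding G m Γ τ .mixed := h.sub (.inr (.inr rfl))

/-- What a kinding derivation says about the components of a type. -/
def Kinding.Inv (G : GCtx) (m : Mode) (Γ : Ctx) (κ : Kind) : Expr → Prop
  | .prodT a b => Kinding G m Γ a κ ∧ Kinding G m Γ b κ
  | .osumT a b => Kinding G m Γ a .obl ∧ Kinding G m Γ b .obl
  | .pi a b => ∃ κ₁ κ₂, Kinding G m Γ a κ₁ ∧ Kinding G m (a :: Γ) b κ₂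
  | .adt T => ∃ d, G.adt T = some d
  | .psiT T => ∃ d, G.oadt T = some d
  | _ => True

/-- What a typing derivation says about the components and the type of an introduction form. -/
def Typing.Inv (G : GCtx) (m : Mode) (Γ : Ctx) (τ : Expr) : Expr → Prop
  | .tt => TyEquiv G .unitT τ
  | .lit _ => TyEquiv G .boolT τ
  | .boxedLit _ => TyEquiv G .oboolT τ
  | .boxedInj b w v => OValTy (.boxedInj b w v) w ∧ TyEquiv G w.toExpr τ
  | .abs a e => ∃ b κ, Kinding G m Γ a κ ∧ Typing G m (a :: Γ) e b ∧ TyEquiv G (.pi a b) τ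
  | .pair e₁ e₂ => ∃ a b, Typing G m Γ e₁ a ∧ Typing G m Γ e₂ b ∧ TyEquiv G (.prodT a b) τ
  | .psiPair e₁ e₂ => ∃ T d, G.oadt T = some d ∧ Typing G m Γ e₁ d.view ∧
      Typing G m Γ e₂ (.oadt T e₁) ∧ TyEquiv G (.psiT T) τ
  | .ctor T i e => ∃ n arg, ∃ j : Fin n, G.adt T = some ⟨n, arg⟩ ∧ i = j ∧
      Typing G m Γ e (arg j) ∧ TyEquiv G (.adt T) τ
  | _ => True

theorem Typing.Inv.conv {G : GCtx} {m : Mode} {Γ : Ctx} {e τ τ' : Expr}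
    (h : Typing.Inv G m Γ τ e) (hτ : TyEquiv G τ τ') : Typing.Inv G m Γ τ' e := by
  cases e <;> try trivial
  case tt | lit | boxedLit => exact TyEquiv.trans h hτ
  case boxedInj => exact ⟨h.1, h.2.trans hτ⟩
  case abs | pair => obtain ⟨_, _, h₁, h₂, h₃⟩ := h; exact ⟨_, _, h₁, h₂, h₃.trans hτ⟩
  case psiPair => obtain ⟨_, _, h₀, h₁, h₂, h₃⟩ := h; exact ⟨_, _, h₀, h₁, h₂, h₃.trans hτ⟩
  case ctor => obtain ⟨_, _, _, h₀, h₁, h₂, h₃⟩ := h; exact ⟨_, _, _, h₀, h₁, h₂, h₃.trans hτ⟩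

theorem Judgment.inv {G : GCtx} :
    (∀ m Γ τ κ, Kinding G m Γ τ κ → Kinding.Inv G m Γ κ τ) ∧
      (∀ m Γ e τ, Typing G m Γ e τ → Typing.Inv G m Γ τ e) := by
  apply judgment_induction
  case k_sub =>
    intro m Γ τ κ κ' h hκ ih
    -- The inversion statement depends on the kind for product types only.
    cases τ <;> try exact ih
    exact ⟨.sub ih.1 hκ, .sub ih.2 hκ⟩
  case t_conv => intro _ _ _ _ _ _ _ hτ _ ih _; exact ih.conv hτ
  all_goals intros
  all_goals first
    | trivial
    | exact TyEquiv.refl _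
    | exact ⟨_, ‹_›⟩
    | exact ⟨‹_›, ‹_›⟩
    | exact ⟨_, _, ‹_›, ‹_›⟩
    | exact ⟨_, _, ‹_›, ‹_›, TyEquiv.refl _⟩
    | exact ⟨_, _, ‹_›, ‹_›, ‹_›, TyEquiv.refl _⟩
    | exact ⟨_, _, _, ‹_›, rfl, ‹_›, TyEquiv.refl _⟩
    | exact ⟨‹_›, TyEquiv.refl _⟩

theorem Kinding.inv {G : GCtx} {m : Mode} {Γ : Ctx} {τ : Expr} {κ : Kind}
    (h : Kinding G m Γ τ κ) : Kinding.Inv G m Γ κ τ := Judgment.inv.1 _ _ _ _ h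

theorem Typing.inv {G : GCtx} {m : Mode} {Γ : Ctx} {e τ : Expr}
    (h : Typing G m Γ e τ) : Typing.Inv G m Γ τ e := Judgment.inv.2 _ _ _ _ h

/-! ### Regularity and preservation -/

theorem OTy.kinding {G : GCtx} {m : Mode} {Γ : Ctx} (w : OTy) :
    Kinding G m Γ w.toExpr .obl := by
  induction w with
  | unit => exact .sub .unit (.inr (.inl rfl))
  | obool => exact .obool
  | prod _ _ h₁ h₂ => exact .prod h₁ h₂
  | osum _ _ h₁ h₂ => exact .osum h₁ h₂

/-- Rules whose result type is not determined by simpler types carry a kinding premise. In the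
application case the kind comes from inverting that of the Π-type, and types of global definitions
are weakened from the empty context. -/
theorem Typing.regular {G : GCtx} (hG : G.WellTyped) {m : Mode} {Γ : Ctx} {e τ : Expr}
    (h : Typing G m Γ e τ) : ∃ κ, Kinding G m Γ τ κ := by
  have hc := hG.closed
  revert h
  suffices (∀ m Γ τ κ, Kinding G m Γ τ κ → True) ∧
      (∀ m Γ e τ, Typing G m Γ e τ → ∃ κ, Kinding G m Γ τ κ) from this.2 _ _ _ _
  apply judgment_induction <;> intros
  case t_conv hk _ _ => exact ⟨_, hk⟩
  case t_tt => exact ⟨_, .unit⟩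
  case t_lit => exact ⟨_, .bool⟩
  case t_bvar hk _ => exact ⟨_, hk⟩
  case t_gvar h hu => exact ⟨_, (hG.fn _ _ h).1.choose_spec.weaken hc hu _⟩
  case t_abs hk _ _ ih => exact ⟨_, .pi hk ih.choose_spec⟩
  case t_app _ he ih _ =>
    obtain ⟨_, _, _, hk⟩ := ih.choose_spec.inv
    exact ⟨_, hk.inst hc he⟩
  case t_letE he _ _ ih => exact ⟨_, ih.choose_spec.inst hc he⟩
  -- Subsumption to `mixed` gives the two factors the common kind that the product rule demands.
  case t_pair ih₁ ih₂ => exact ⟨_, .prod ih₁.choose_spec.mixed ih₂.choose_spec.mixed⟩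
  case t_proj b _ _ _ _ ih =>
    obtain ⟨h₁, h₂⟩ := ih.choose_spec.inv
    cases b
    exacts [⟨_, h₂⟩, ⟨_, h₁⟩]
  case t_ite hk _ _ _ _ => exact ⟨_, hk⟩
  case t_ctor h _ _ => exact ⟨_, .adt h⟩
  case t_ematch hk _ _ _ => exact ⟨_, hk⟩
  case t_psiPair h _ _ _ _ => exact ⟨_, .psi h⟩
  case t_psiProj₁ h _ _ => exact ⟨_, (hG.oadt _ _ h).1.weaken hc (fun _ => rfl) _⟩
  case t_psiProj₂ h he _ => exact ⟨_, .oadt h (.psiProj₁ h he)⟩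
  case t_mux hk _ _ _ _ _ _ _ => exact ⟨_, hk⟩
  case t_oinj hk _ _ => exact ⟨_, hk⟩
  case t_omatch hk _ _ _ _ _ _ _ => exact ⟨_, hk⟩
  case t_sec => exact ⟨_, .obool⟩
  case t_boxedLit => exact ⟨_, .obool⟩
  case t_boxedInj => exact ⟨_, OTy.kinding _⟩
  all_goals trivial

theorem OValTy.typing {G : GCtx} {m : Mode} {Γ : Ctx} {v : OVal} {w : OTy} (h : OValTy v w) :
    Typing G m Γ v.toExpr w.toExpr := by
  induction h with
  | unit => exact .tt
  | obool => exact .boxedLit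
  | prod _ _ h₁ h₂ => exact .pair h₁ h₂
  | osum h _ => exact .boxedInj (.osum h)

/-- Stated up to conversion because inverting a pair determines the component types only up to
equivalence; normality of oblivious type values then recovers the actual type. -/
theorem Typing.oValTy {G : GCtx} (hG : G.Closed) {m : Mode} {Γ : Ctx} {v : OVal} {w : OTy}
    {τ : Expr} (h : Typing G m Γ v.toExpr τ) (hτ : TyEquiv G τ w.toExpr) : OValTy v w := by
  induction v generalizing τ w with
  | tt => obtain rfl := TyEquiv.oTy_inj (w := .unit) hG (TyEquiv.trans h.inv hτ); exact .unit
  | boxedLit =>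
    obtain rfl := TyEquiv.oTy_inj (w := .obool) hG (TyEquiv.trans h.inv hτ); exact .obool _
  | boxedInj =>
    obtain ⟨hv, hw⟩ := h.inv
    obtain rfl := TyEquiv.oTy_inj hG (hw.trans hτ); exact hv
  | pair _ _ ih₁ ih₂ =>
    obtain ⟨a, b, h₁, h₂, h₃⟩ := h.inv
    have h₄ := h₃.trans hτ
    cases w with
    | prod w₁ w₂ =>
      obtain ⟨h₅, h₆⟩ := TyEquiv.prodT_inj hG h₄
      exact .prod (ih₁ h₁ h₅) (ih₂ h₂ h₆)
    | unit => exact nomatch h₄.head_eq hG rfl rfl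
    | obool => exact nomatch h₄.head_eq hG rfl rfl
    | osum => exact nomatch h₄.head_eq hG rfl rfl

theorem Typing.weaken {G : GCtx} (hG : G.WellTyped) {m m' : Mode} {e τ : Expr}
    (h : Typing G m [] e τ) (hm : m.usable m') (Γ : Ctx) : Typing G m' Γ e τ := by
  obtain ⟨_, hk⟩ := h.regular hG
  have hτ : τ.Closed := Judgment.scoped.1 _ _ _ _ hk
  have := (Judgment.rename hG.closed).2 _ _ _ _ (Judgment.mode.2 _ _ _ _ h _ hm) id Γ
    (CtxRen.nil _ _)
  rwa [hτ.rename_eq, h.closed.rename_eq] at this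

theorem Typing.ctor_arg {G : GCtx} {m : Mode} {Γ : Ctx} {T : Name} {n : ℕ} {arg : Fin n → Expr}
    {i : Fin n} {e τ : Expr} (h : Typing G m Γ (.ctor T i e) τ) (hT : G.adt T = some ⟨n, arg⟩) :
    Typing G m Γ e (arg i) := by
  obtain ⟨n', arg', j, hT', hi, he, -⟩ := h.inv
  cases Option.some.inj (hT.symm.trans hT')
  cases Fin.ext hi
  exact he

/-- Unfolding an OADT yields a type of kind `obl`. -/
theorem GCtx.WellTyped.oadt_inst {G : GCtx} (hG : G.WellTyped) {m : Mode} {Γ : Ctx} {T : Name}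
    {d : OADTDef} {e : Expr} (hT : G.oadt T = some d) (he : Typing G m Γ e d.view) :
    Kinding G m Γ (d.body.inst e) .obl := by
  have hc := hG.closed
  have h := Judgment.mode.1 _ _ _ _ (hG.oadt T d hT).2 m fun _ => rfl
  -- Inserting `Γ` outside the parameter leaves all de Bruijn indices unchanged, so the renaming is
  -- the identity.
  have h := (Judgment.rename hc).1 _ _ _ _ h _ _
    ((CtxRen.nil (fun n => n) Γ).up_closed (hc.view T d hT))
  rw [upRen_id, Expr.rename_eq_subst, Expr.subst_bvar] at h
  exact h.inst hc he

theorem ParRed.ematch_inv {G : GCtx} {T : Name} {n : ℕ} {e y : Expr}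
    {bs : Fin n → Expr} (h : ParRed G (.ematch T n e bs) y) :
    (∃ e' bs', y = .ematch T n e' bs' ∧ ParRed G e e' ∧ ∀ j, ParRed G (bs j) (bs' j)) ∨
      ∃ (i : Fin n) (u u' : Expr) (bs' : Fin n → Expr), e = .ctor T i u ∧ y = (bs' i).inst u' ∧
        ParRed G u u' ∧ ∀ j, ParRed G (bs j) (bs' j) := by
  cases h
  case refl => exact .inl ⟨_, _, rfl, .refl _, fun _ => .refl _⟩
  case ematch h₁ h₂ => exact .inl ⟨_, _, rfl, h₁, h₂⟩
  case ematchR h₁ _ _ h₂ => exact .inr ⟨_, _, _, _, rfl, rfl, h₁, h₂⟩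

theorem ParRed.oinj_inv {G : GCtx} {b : Bool} {τ e y : Expr} (h : ParRed G (.oinj b τ e) y) :
    (∃ τ' e', y = .oinj b τ' e' ∧ ParRed G τ τ' ∧ ParRed G e e') ∨
      ∃ (w : OTy) (v : OVal), τ = w.toExpr ∧ e = v.toExpr ∧ y = .boxedInj b w v := by
  cases h
  case refl => exact .inl ⟨_, _, rfl, .refl _, .refl _⟩
  case oinj h₁ h₂ => exact .inl ⟨_, _, rfl, h₁, h₂⟩
  case oinjR => exact .inr ⟨_, _, rfl, rfl, rfl⟩

theorem ParRed.osumT_inv {G : GCtx} {a b y : Expr} (h : ParRed G (.osumT a b) y) :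
    ∃ a' b', y = .osumT a' b' ∧ ParRed G a a' ∧ ParRed G b b' := by
  cases h
  case refl => exact ⟨_, _, rfl, .refl _, .refl _⟩
  case osumT h₁ h₂ => exact ⟨_, _, rfl, h₁, h₂⟩

/-- Parallel reduction preserves kinds and types. -/
theorem Judgment.preservation {G : GCtx} (hG : G.WellTyped) :
    (∀ m Γ τ κ, Kinding G m Γ τ κ → ∀ τ', ParRed G τ τ' → Kinding G m Γ τ' κ) ∧
      (∀ m Γ e τ, Typing G m Γ e τ → ∀ e', ParRed G e e' → Typing G m Γ e' τ) := by
  have hc := hG.closed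
  apply judgment_induction <;> intros
  case k_sub hκ ih τ' h => exact .sub (ih _ h) hκ
  case k_unit h => cases h; exact .unit
  case k_bool h => cases h; exact .bool
  case k_obool h => cases h; exact .obool
  case k_adt hT _ h => cases h; exact .adt hT
  case k_psi hT _ h => cases h; exact .psi hT
  case k_oadt hT he ih τ' h =>
    cases h
    case refl => exact .oadt hT he
    case oadt h => exact .oadt hT (ih _ h)
    case oadtR hT' h =>
      obtain rfl := Option.some.inj (hT.symm.trans hT')
      exact hG.oadt_inst hT (ih _ h)
  case k_pi h₁ h₂ ih₁ ih₂ τ' h =>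
    cases h
    case refl => exact .pi h₁ h₂
    -- The codomain was kinded under the old domain, and context conversion moves it under the
    -- reduced one.
    case pi k₁ k₂ => exact .pi (ih₁ _ k₁) ((ih₂ _ k₂).conv_head hc h₁ (ih₁ _ k₁) k₁.equiv.symm)
  case k_prod h₁ h₂ ih₁ ih₂ τ' h =>
    cases h
    case refl => exact .prod h₁ h₂
    case prodT k₁ k₂ => exact .prod (ih₁ _ k₁) (ih₂ _ k₂)
  case k_osum h₁ h₂ ih₁ ih₂ τ' h =>
    cases h
    case refl => exact .osum h₁ h₂
    case osumT k₁ k₂ => exact .osum (ih₁ _ k₁) (ih₂ _ k₂)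
  case k_letE h₁ h₂ ih₁ ih₂ τ' h =>
    cases h
    case refl => exact .letE h₁ h₂
    case letE k₁ k₂ => exact .letE (ih₁ _ k₁) (ih₂ _ k₂)
    case letR k₁ k₂ => exact (ih₂ _ k₂).inst hc (ih₁ _ k₁)
  case k_ite h₁ h₂ h₃ ih₁ ih₂ ih₃ τ' h =>
    cases h
    case refl => exact .ite h₁ h₂ h₃
    case ite k₁ k₂ k₃ => exact .ite (ih₁ _ k₁) (ih₂ _ k₂) (ih₃ _ k₃)
    case iteR b _ _ k₂ k₃ =>
      cases b
      exacts [ih₃ _ k₃, ih₂ _ k₂]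
  case k_ematch hT h₁ h₂ ih₁ ih₂ τ' h =>
    obtain ⟨_, _, rfl, k₁, k₂⟩ | ⟨i, u, u', _, rfl, rfl, k₁, k₂⟩ := h.ematch_inv
    · exact .ematch hT (ih₁ _ k₁) fun i => ih₂ i _ (k₂ i)
    · exact (ih₂ i _ (k₂ i)).inst hc ((ih₁ _ (.ctor k₁)).ctor_arg hT)
  case t_conv hτ hk ih _ e' h => exact .conv (ih _ h) hτ hk
  case t_tt h => cases h; exact .tt
  case t_lit h => cases h; exact .lit
  case t_bvar hx hk _ _ h => cases h; exact .bvar hx hk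
  case t_boxedLit h => cases h; exact .boxedLit
  case t_boxedInj hv _ h => cases h; exact .boxedInj hv
  case t_gvar hf hu _ h =>
    cases h
    case refl => exact .gvar hf hu
    case fn hf' =>
      obtain rfl := Option.some.inj (hf.symm.trans hf')
      exact (hG.fn _ _ hf).2.weaken hG hu _
  case t_abs hk he ih₁ ih₂ _ h =>
    cases h
    case refl => exact .abs hk he
    case abs k₁ k₂ =>
      exact .conv (.abs (ih₁ _ k₁) ((ih₂ _ k₂).conv_head hc hk (ih₁ _ k₁) k₁.equiv.symm))
        (ParRed.pi k₁ (.refl _)).equiv.symm (.pi hk (he.regular hG).choose_spec)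
  case t_app hf he ih₁ ih₂ _ h =>
    -- Reducing the argument changes the dependent result type. Regularity provides the kind with
    -- which `conv` restores the original type.
    obtain ⟨_, _, -, hk⟩ := (hf.regular hG).choose_spec.inv
    have hk := hk.inst hc he
    cases h
    case refl => exact .app hf he
    case app k₁ k₂ =>
      exact .conv (.app (ih₁ _ k₁) (ih₂ _ k₂)) ((ParRed.refl _).inst hc k₂).equiv.symm hk
    case beta k₁ k₂ =>
      -- The body is reduced inside the abstraction, where the induction hypothesis applies.
      -- Inversion and injectivity of Π then recover the types of the body and its parameter.
      obtain ⟨_, _, h₁, h₂, h₃⟩ := (ih₁ _ (.abs (.refl _) k₁)).inv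
      obtain ⟨h₄, h₅⟩ := h₃.pi_inj hc
      exact .conv (h₂.inst hc (.conv (ih₂ _ k₂) h₄.symm h₁))
        ((h₅.inst hc _).trans ((ParRed.refl _).inst hc k₂).equiv.symm) hk
  case t_letE h₁ h₂ ih₁ ih₂ _ h =>
    have hk := (h₂.regular hG).choose_spec.inst hc h₁
    cases h
    case refl => exact .letE h₁ h₂
    case letE k₁ k₂ =>
      exact .conv (.letE (ih₁ _ k₁) (ih₂ _ k₂)) ((ParRed.refl _).inst hc k₁).equiv.symm hk
    case letR k₁ k₂ =>
      exact .conv ((ih₂ _ k₂).inst hc (ih₁ _ k₁)) ((ParRed.refl _).inst hc k₁).equiv.symm hk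
  case t_pair h₁ h₂ ih₁ ih₂ _ h =>
    cases h
    case refl => exact .pair h₁ h₂
    case pair k₁ k₂ => exact .pair (ih₁ _ k₁) (ih₂ _ k₂)
  case t_proj b _ _ _ he ih _ h =>
    obtain ⟨hk₁, hk₂⟩ := (he.regular hG).choose_spec.inv
    cases h
    case refl => exact .proj he
    case proj k => exact .proj (ih _ k)
    case projPair k₁ k₂ =>
      obtain ⟨_, _, h₁, h₂, h₃⟩ := (ih _ (.pair k₁ k₂)).inv
      obtain ⟨h₄, h₅⟩ := h₃.prodT_inj hc
      cases b
      exacts [.conv h₂ h₅ hk₂, .conv h₁ h₄ hk₁]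
    case projPsi k₁ k₂ =>
      obtain ⟨_, _, _, _, _, h⟩ := (ih _ (.refl _)).inv
      exact nomatch h.head_eq hc rfl rfl
  case t_ite τ _ h₁ h₂ h₃ hk ih₁ ih₂ ih₃ ih₄ _ h =>
    cases h
    case refl => exact .ite h₁ h₂ h₃ hk
    case ite k₁ k₂ k₃ =>
      have k := (ParRed.refl τ).inst hc k₁
      exact .conv (.ite (ih₁ _ k₁) (ih₂ _ k₂) (ih₃ _ k₃) (ih₄ _ k)) k.equiv.symm hk
    case iteR b _ _ k₂ k₃ =>
      cases b
      exacts [ih₃ _ k₃, ih₂ _ k₂]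
  case t_ctor hT h₁ ih _ h =>
    cases h
    case refl => exact .ctor hT h₁
    case ctor k => exact .ctor hT (ih _ k)
  case t_ematch τ _ hT h₁ h₂ hk ih₁ ih₂ ih₃ _ h =>
    obtain ⟨_, _, rfl, k₁, k₂⟩ | ⟨i, u, u', _, rfl, rfl, k₁, k₂⟩ := h.ematch_inv
    · have k := (ParRed.refl τ).inst hc k₁
      exact .conv (.ematch hT (ih₁ _ k₁) (fun i => ih₂ i _ (k₂ i)) (ih₃ _ k)) k.equiv.symm hk
    · have := (ih₂ i _ (k₂ i)).inst hc ((ih₁ _ (.ctor k₁)).ctor_arg hT)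
      -- The branch was typed at the motive for `C_i x`, so its instance has the motive at the
      -- scrutinee's reduct; a conversion leads back to the original scrutinee.
      rw [Expr.ctorSub_inst] at this
      exact .conv this ((ParRed.refl _).inst hc (.ctor k₁)).equiv.symm hk
  case t_psiPair hT h₁ h₂ ih₁ ih₂ _ h =>
    cases h
    case refl => exact .psiPair hT h₁ h₂
    case psiPair k₁ k₂ =>
      exact .psiPair hT (ih₁ _ k₁)
        (.conv (ih₂ _ k₂) (ParRed.oadt k₁).equiv (.oadt hT (ih₁ _ k₁)))
  case t_psiProj₁ hT h₁ ih _ h =>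
    cases h
    case refl => exact .psiProj₁ hT h₁
    case proj k => exact .psiProj₁ hT (ih _ k)
    case projPair k₁ k₂ =>
      obtain ⟨_, _, _, _, h⟩ := (ih _ (.refl _)).inv
      exact nomatch h.head_eq hc rfl rfl
    case projPsi k₁ k₂ =>
      obtain ⟨T', d', hT', h₁, h₂, h⟩ := (ih _ (.psiPair k₁ k₂)).inv
      cases h.head_eq hc rfl rfl
      obtain rfl := Option.some.inj (hT.symm.trans hT')
      exact h₁
  case t_psiProj₂ hT h₁ ih _ h =>
    have hk : Kinding G _ _ _ _ := .oadt hT (.psiProj₁ hT h₁)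
    cases h
    case refl => exact .psiProj₂ hT h₁
    case proj k =>
      exact .conv (.psiProj₂ hT (ih _ k)) (ParRed.oadt (.proj k)).equiv.symm hk
    case projPair k₁ k₂ =>
      obtain ⟨_, _, _, _, h⟩ := (ih _ (.refl _)).inv
      exact nomatch h.head_eq hc rfl rfl
    case projPsi k₁ k₂ =>
      obtain ⟨T', d', hT', h₁, h₂, h⟩ := (ih _ (.psiPair k₁ k₂)).inv
      cases h.head_eq hc rfl rfl
      -- The payload is typed at the first component, whereas the rule asks for the first projection
      -- of the unreduced pair; these are convertible.
      exact .conv h₂ (ParRed.oadt (.projPsi (b := true) k₁ k₂)).equiv.symm hk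
  case t_mux h₁ hk hκ h₂ h₃ ih₁ _ ih₂ ih₃ _ h =>
    cases h
    case refl => exact .mux h₁ hk hκ h₂ h₃
    case mux k₁ k₂ k₃ => exact .mux (ih₁ _ k₁) hk hκ (ih₂ _ k₂) (ih₃ _ k₃)
    case muxR b _ _ k₂ k₃ =>
      cases b
      exacts [ih₃ _ k₃, ih₂ _ k₂]
  case t_oinj b τ₁ τ₂ _ h₁ hk ih₁ ih₂ _ h =>
    obtain ⟨_, _, rfl, k₁, k₂⟩ | ⟨w, v, hw, rfl, rfl⟩ := h.oinj_inv
    · have hk' := ih₂ _ k₁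
      obtain ⟨τ₁', τ₂', rfl, k₃, k₄⟩ := k₁.osumT_inv
      obtain ⟨hk₁, hk₂⟩ := hk'.inv
      refine .conv (.oinj ?_ hk') k₁.equiv.symm hk
      cases b
      exacts [.conv (ih₁ _ k₂) k₄.equiv hk₂, .conv (ih₁ _ k₂) k₃.equiv hk₁]
    · cases w <;> cases hw
      refine Typing.boxedInj (.osum ?_)
      apply h₁.oValTy hc
      cases b <;> exact .refl _
  case t_omatch τ₁ τ₂ τ _ h₁ hk hκ h₂ h₃ ih₁ _ ih₂ ih₃ _ h =>
    cases h
    case refl => exact .omatch h₁ hk hκ h₂ h₃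
    case omatch k₁ k₂ k₃ => exact .omatch (ih₁ _ k₁) hk hκ (ih₂ _ k₂) (ih₃ _ k₃)
    case omatchR b w₁ w₂ v v₁ v₂ _ _ hv₁ hv₂ k₂ k₃ =>
      obtain ⟨hk₁, hk₂⟩ := (h₁.regular hG).choose_spec.inv
      obtain ⟨hv, hw⟩ := h₁.inv
      obtain ⟨hw₁, hw₂⟩ := TyEquiv.osumT_inj hc hw
      -- A branch is well-typed for any oblivious value of its component type, so the dummy values
      -- cause no trouble. The side condition of the resulting `mux` is that of the match.
      have hl : ∀ u : OVal, OValTy u w₁ → Typing G _ _ (Expr.inst _ u.toExpr) τ := fun u hu => by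
        simpa only [Expr.shift_inst] using (ih₂ _ k₂).inst hc (.conv hu.typing hw₁ hk₁)
      have hr : ∀ u : OVal, OValTy u w₂ → Typing G _ _ (Expr.inst _ u.toExpr) τ := fun u hu => by
        simpa only [Expr.shift_inst] using (ih₃ _ k₃).inst hc (.conv hu.typing hw₂ hk₂)
      cases hv with
      | osum hv =>
        cases b
        · exact .mux .boxedLit hk hκ (hl _ hv₁) (hr _ hv)
        · exact .mux .boxedLit hk hκ (hl _ hv) (hr _ hv₂)
  case t_sec h₁ ih _ h =>
    cases h
    case refl => exact .sec h₁
    case sec k => exact .sec (ih _ k)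
    case secR => exact .boxedLit

/-! ### Values, evaluation contexts and deterministic steps -/

theorem Step.parRed {G : GCtx} {e e' : Expr} (h : Step G e e') : ParRed G e e' := by
  induction h
  case fn h => exact .fn h
  case oadt h _ => exact .oadtR h (.refl _)
  case beta => exact .beta (.refl _) (.refl _)
  case letV => exact .letR (.refl _) (.refl _)
  case iteLit => exact .iteR (.refl _) (.refl _)
  case muxLit => exact .muxR (.refl _) (.refl _)
  case matchCtor => exact .ematchR (.refl _) fun _ => .refl _
  case projPair => exact .projPair (.refl _) (.refl _)
  case projPsi => exact .projPsi (.refl _) (.refl _)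
  case secLit => exact .secR
  case oinjVal => exact .oinjR
  case omatchInj h₁ h₂ => exact .omatchR h₁ h₂ (.refl _) (.refl _)
  case prodL ih => exact .prodT ih (.refl _)
  case prodR ih => exact .prodT (.refl _) ih
  case osumL ih => exact .osumT ih (.refl _)
  case osumR ih => exact .osumT (.refl _) ih
  case letC ih => exact .letE ih (.refl _)
  case appR ih => exact .app (.refl _) ih
  case appL ih => exact .app ih (.refl _)
  case ctorC ih => exact .ctor ih
  case oadtC ih => exact .oadt ih
  case iteC ih => exact .ite ih (.refl _) (.refl _)
  case mux₀ ih => exact .mux ih (.refl _) (.refl _)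
  case mux₁ ih => exact .mux (.refl _) ih (.refl _)
  case mux₂ ih => exact .mux (.refl _) (.refl _) ih
  case pairL ih => exact .pair ih (.refl _)
  case pairR ih => exact .pair (.refl _) ih
  case psiL ih => exact .psiPair ih (.refl _)
  case psiR ih => exact .psiPair (.refl _) ih
  case projC ih => exact .proj ih
  case oinjT ih => exact .oinj ih (.refl _)
  case oinjC ih => exact .oinj (.refl _) ih
  case omatchC ih => exact .omatch ih (.refl _) (.refl _)
  case ematchC ih => exact .ematch ih fun _ => .refl _
  case secC ih => exact .sec ih

theorem Typing.steps {G : GCtx} (hG : G.WellTyped) {m : Mode} {Γ : Ctx} {e e' τ : Expr}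
    (he : Typing G m Γ e τ) (h : Steps G e e') : Typing G m Γ e' τ := by
  induction h with
  | refl => exact he
  | tail _ h ih => exact (Judgment.preservation hG).2 _ _ _ _ ih _ h.parRed

theorem Steps.equiv {G : GCtx} {e e' : Expr} (h : Steps G e e') : TyEquiv G e e' := by
  induction h with
  | refl => exact .refl _
  | tail _ h ih => exact ih.trans h.parRed.equiv

theorem IsVal.not_step {G : GCtx} {v e : Expr} (hv : IsVal v) : ¬ Step G v e := by
  induction hv generalizing e <;> intro h <;> cases h
  case pair.pairL ih _ _ h => exact ih h
  case pair.pairR ih _ _ h => exact ih h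
  case psiPair.psiL ih _ _ h => exact ih h
  case psiPair.psiR ih _ _ h => exact ih h
  case ctor.ctorC ih _ h => exact ih h

theorem StepN.steps {G : GCtx} {n : ℕ} {e e' : Expr} (h : StepN G n e e') : Steps G e e' := by
  induction h with
  | zero => exact .refl
  | succ h _ ih => exact ih.head h

theorem Steps.stepN {G : GCtx} {e e' : Expr} (h : Steps G e e') : ∃ n, StepN G n e e' := by
  induction h using Relation.ReflTransGen.head_induction_on with
  | refl => exact ⟨0, .zero _⟩
  | head h _ ih => exact ⟨_, .succ h ih.choose_spec⟩

theorem IsVal.steps_eq {G : GCtx} {v e : Expr} (hv : IsVal v) (h : Steps G v e) : e = v := by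
  cases h using Relation.ReflTransGen.head_induction_on with
  | refl => rfl
  | head h _ => exact absurd h hv.not_step

/-- `K` is a call-by-value evaluation context. -/
structure IsCtx (G : GCtx) (K : Expr → Expr) : Prop where
  step : ∀ e e', Step G e e' → Step G (K e) (K e')
  inv : ∀ e x, ¬ IsVal e → Step G (K e) x → ∃ e', x = K e' ∧ Step G e e'
  not_val : ∀ e, ¬ IsVal e → ¬ IsVal (K e)

theorem IsCtx.comp {G : GCtx} {K K' : Expr → Expr} (h : IsCtx G K) (h' : IsCtx G K') :
    IsCtx G fun e => K (K' e) where
  step e e' he := h.step _ _ (h'.step _ _ he)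
  inv e x he hx := by
    obtain ⟨_, rfl, hy⟩ := h.inv _ _ (h'.not_val _ he) hx
    obtain ⟨_, rfl, hz⟩ := h'.inv _ _ he hy
    exact ⟨_, rfl, hz⟩
  not_val e he := h.not_val _ (h'.not_val _ he)

-- Frames of the call-by-value evaluation contexts.

theorem IsCtx.appR {G : GCtx} (f : Expr) : IsCtx G (.app f) where
  step _ _ h := .appR h
  inv e x he h := by
    cases h
    case beta h => exact absurd h he
    case appR h => exact ⟨_, rfl, h⟩
    case appL _ h => exact absurd h he
  not_val _ _ h := nomatch h

theorem IsCtx.appL {G : GCtx} {v : Expr} (hv : IsVal v) : IsCtx G fun f => .app f v where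
  step _ _ h := .appL hv h
  inv e x he h := by
    cases h
    case beta => exact absurd (.abs _ _) he
    case appR h => exact absurd h hv.not_step
    case appL h _ => exact ⟨_, rfl, h⟩
  not_val _ _ h := nomatch h

theorem IsCtx.letE {G : GCtx} (b : Expr) : IsCtx G fun e => .letE e b where
  step _ _ h := .letC h
  inv e x he h := by
    cases h
    case letV h => exact absurd h he
    case letC h => exact ⟨_, rfl, h⟩
  not_val _ _ h := nomatch h

theorem IsCtx.ctor {G : GCtx} (T : Name) (i : ℕ) : IsCtx G (.ctor T i) where
  step _ _ h := .ctorC h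
  inv e x he h := by
    cases h
    case ctorC h => exact ⟨_, rfl, h⟩
  not_val _ he h := by cases h; contradiction

theorem IsCtx.ite {G : GCtx} (a b : Expr) : IsCtx G fun e => .ite e a b where
  step _ _ h := .iteC h
  inv e x he h := by
    cases h
    case iteLit => exact absurd (.lit _) he
    case iteC h => exact ⟨_, rfl, h⟩
  not_val _ _ h := nomatch h

theorem IsCtx.mux₁ {G : GCtx} {v : Expr} (hv : IsVal v) (b : Expr) :
    IsCtx G fun e => .mux v e b where
  step _ _ h := .mux₁ hv h
  inv e x he h := by
    cases h
    case muxLit h _ => exact absurd h he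
    case mux₀ h => exact absurd h hv.not_step
    case mux₁ h => exact ⟨_, rfl, h⟩
    case mux₂ h _ => exact absurd h he
  not_val _ _ h := nomatch h

theorem IsCtx.mux₂ {G : GCtx} {v w : Expr} (hv : IsVal v) (hw : IsVal w) :
    IsCtx G (.mux v w) where
  step _ _ h := .mux₂ hv hw h
  inv e x he h := by
    cases h
    case muxLit h => exact absurd h he
    case mux₀ h => exact absurd h hv.not_step
    case mux₁ h => exact absurd h hw.not_step
    case mux₂ h => exact ⟨_, rfl, h⟩
  not_val _ _ h := nomatch h

theorem IsCtx.pairL {G : GCtx} (b : Expr) : IsCtx G fun e => .pair e b where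
  step _ _ h := .pairL h
  inv e x he h := by
    cases h
    case pairL h => exact ⟨_, rfl, h⟩
    case pairR h _ => exact absurd h he
  not_val _ he h := by cases h; contradiction

theorem IsCtx.pairR {G : GCtx} {v : Expr} (hv : IsVal v) : IsCtx G (.pair v) where
  step _ _ h := .pairR hv h
  inv e x he h := by
    cases h
    case pairL h => exact absurd h hv.not_step
    case pairR h => exact ⟨_, rfl, h⟩
  not_val _ he h := by cases h; contradiction

theorem IsCtx.psiL {G : GCtx} (b : Expr) : IsCtx G fun e => .psiPair e b where
  step _ _ h := .psiL h
  inv e x he h := by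
    cases h
    case psiL h => exact ⟨_, rfl, h⟩
    case psiR h _ => exact absurd h he
  not_val _ he h := by cases h; contradiction

theorem IsCtx.psiR {G : GCtx} {v : Expr} (hv : IsVal v) : IsCtx G (.psiPair v) where
  step _ _ h := .psiR hv h
  inv e x he h := by
    cases h
    case psiL h => exact absurd h hv.not_step
    case psiR h => exact ⟨_, rfl, h⟩
  not_val _ he h := by cases h; contradiction

theorem IsCtx.proj {G : GCtx} (b : Bool) : IsCtx G (.proj b) where
  step _ _ h := .projC h
  inv e x he h := by
    cases h
    case projPair h h' => exact absurd (.pair h h') he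
    case projPsi h h' => exact absurd (.psiPair h h') he
    case projC h => exact ⟨_, rfl, h⟩
  not_val _ _ h := nomatch h

theorem Step.ematch_inv {G : GCtx} {T : Name} {n : ℕ} {e x : Expr} {bs : Fin n → Expr}
    (h : Step G (.ematch T n e bs) x) :
    (∃ (i : Fin n) (v : Expr), e = .ctor T i v ∧ IsVal v ∧ x = (bs i).inst v) ∨
      ∃ e', x = .ematch T n e' bs ∧ Step G e e' := by
  cases h
  case matchCtor h _ => exact .inl ⟨_, _, rfl, h, rfl⟩
  case ematchC h => exact .inr ⟨_, rfl, h⟩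

theorem IsCtx.ematch {G : GCtx} (T : Name) (n : ℕ) (bs : Fin n → Expr) :
    IsCtx G fun e => .ematch T n e bs where
  step _ _ h := .ematchC h
  inv e x he h := by
    obtain ⟨_, _, rfl, h, -⟩ | h := h.ematch_inv
    · exact absurd (.ctor _ _ h) he
    · exact h
  not_val _ _ h := nomatch h

/-- As long as the hole is not a value, every step happens inside it, so a reduction to a value
first evaluates the hole. Determinism is not used, and the step counts add up exactly, as the
indexed relation requires. -/
theorem StepN.ctx_inv {G : GCtx} {K : Expr → Expr} (hK : IsCtx G K) {i : ℕ} {e v : Expr}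
    (h : StepN G i (K e) v) (hv : IsVal v) :
    ∃ j k w, i = j + k ∧ IsVal w ∧ StepN G j e w ∧ StepN G k (K w) v := by
  induction i generalizing e with
  | zero =>
    by_cases he : IsVal e
    · exact ⟨0, 0, e, rfl, he, .zero _, h⟩
    · cases h; exact absurd hv (hK.not_val _ he)
  | succ i ih =>
    by_cases he : IsVal e
    · exact ⟨0, i + 1, e, by omega, he, .zero _, h⟩
    · cases h with
      | succ h h' =>
        obtain ⟨_, rfl, hs⟩ := hK.inv _ _ he h
        obtain ⟨j, k, w, rfl, hw, h₁, h₂⟩ := ih h'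
        exact ⟨j + 1, k, w, by omega, hw, .succ hs h₁, h₂⟩

theorem Steps.ctx_inv {G : GCtx} {K : Expr → Expr} (hK : IsCtx G K) {e v : Expr}
    (h : Steps G (K e) v) (hv : IsVal v) : ∃ w, IsVal w ∧ Steps G e w ∧ Steps G (K w) v := by
  obtain ⟨i, hi⟩ := h.stepN
  obtain ⟨_, _, w, -, hw, h₁, h₂⟩ := hi.ctx_inv hK hv
  exact ⟨w, hw, h₁.steps, h₂.steps⟩

theorem Steps.ctx {G : GCtx} {K : Expr → Expr} (hK : IsCtx G K) {e e' : Expr}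
    (h : Steps G e e') : Steps G (K e) (K e') := by
  induction h with
  | refl => exact .refl
  | tail _ h ih => exact ih.tail (hK.step _ _ h)

/-- `e` is not a value and steps to `e'` only. -/
structure Det (G : GCtx) (e e' : Expr) : Prop where
  not_val : ¬ IsVal e
  step : Step G e e'
  uniq : ∀ x, Step G e x → x = e'

theorem Det.ctx {G : GCtx} {K : Expr → Expr} (hK : IsCtx G K) {e e' : Expr} (h : Det G e e') :
    Det G (K e) (K e') where
  not_val := hK.not_val _ h.not_val
  step := hK.step _ _ h.step
  uniq x hx := by
    obtain ⟨_, rfl, hs⟩ := hK.inv _ _ h.not_val hx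
    rw [h.uniq _ hs]

-- Redexes with a unique reduct.

theorem Det.beta {G : GCtx} {τ e v : Expr} (hv : IsVal v) :
    Det G (.app (.abs τ e) v) (e.inst v) where
  not_val h := nomatch h
  step := .beta hv
  uniq x hx := by
    cases hx
    case beta => rfl
    case appR h => exact absurd h hv.not_step
    case appL h _ => exact absurd h (IsVal.abs _ _).not_step

theorem Det.letV {G : GCtx} {e v : Expr} (hv : IsVal v) : Det G (.letE v e) (e.inst v) where
  not_val h := nomatch h
  step := .letV hv
  uniq x hx := by
    cases hx
    case letV => rfl
    case letC h => exact absurd h hv.not_step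

theorem Det.iteLit {G : GCtx} {b : Bool} {e₁ e₂ : Expr} :
    Det G (.ite (.lit b) e₁ e₂) (cond b e₁ e₂) where
  not_val h := nomatch h
  step := .iteLit
  uniq x hx := by
    cases hx
    case iteLit => rfl
    case iteC h => exact absurd h (IsVal.lit _).not_step

theorem Det.muxLit {G : GCtx} {b : Bool} {v w : Expr} (hv : IsVal v) (hw : IsVal w) :
    Det G (.mux (.boxedLit b) v w) (cond b v w) where
  not_val h := nomatch h
  step := .muxLit hv hw
  uniq x hx := by
    cases hx
    case muxLit => rfl
    case mux₀ h => exact absurd h (IsVal.boxedLit _).not_step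
    case mux₁ h => exact absurd h hv.not_step
    case mux₂ h => exact absurd h hw.not_step

theorem Det.projPair {G : GCtx} {b : Bool} {v w : Expr} (hv : IsVal v) (hw : IsVal w) :
    Det G (.proj b (.pair v w)) (cond b v w) where
  not_val h := nomatch h
  step := .projPair hv hw
  uniq x hx := by
    cases hx
    case projPair => rfl
    case projC h => exact absurd h (IsVal.pair hv hw).not_step

theorem Det.projPsi {G : GCtx} {b : Bool} {v w : Expr} (hv : IsVal v) (hw : IsVal w) :
    Det G (.proj b (.psiPair v w)) (cond b v w) where
  not_val h := nomatch h
  step := .projPsi hv hw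
  uniq x hx := by
    cases hx
    case projPsi => rfl
    case projC h => exact absurd h (IsVal.psiPair hv hw).not_step

theorem Det.secLit {G : GCtx} {b : Bool} : Det G (.sec (.lit b)) (.boxedLit b) where
  not_val h := nomatch h
  step := .secLit
  uniq x hx := by
    cases hx
    case secLit => rfl
    case secC h => exact absurd h (IsVal.lit _).not_step

theorem Det.matchCtor {G : GCtx} {T : Name} {n : ℕ} {i : Fin n} {v : Expr} {bs : Fin n → Expr}
    (hv : IsVal v) : Det G (.ematch T n (.ctor T i v) bs) ((bs i).inst v) where
  not_val h := nomatch h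
  step := .matchCtor hv
  uniq x hx := by
    obtain ⟨j, u, he, -, rfl⟩ | ⟨_, -, h⟩ := hx.ematch_inv
    · injection he with _ hij he
      rw [Fin.ext hij, he]
    · exact absurd h (IsVal.ctor _ _ hv).not_step

theorem Det.fn {G : GCtx} {f : Name} {d : FnDef} (h : G.fn f = some d) :
    Det G (.gvar f) d.body where
  not_val h := nomatch h
  step := .fn h
  uniq x hx := by
    cases hx
    case fn h' => rw [Option.some.inj (h.symm.trans h')]

/-- Deterministic reduction in any number of steps. -/
abbrev Dets (G : GCtx) : Expr → Expr → Prop := Relation.ReflTransGen (Det G)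

theorem Dets.steps {G : GCtx} {e e' : Expr} (h : Dets G e e') : Steps G e e' := by
  induction h with
  | refl => exact .refl
  | tail _ h ih => exact ih.tail h.step

/-- A reduction to a value cannot stop at a term of the deterministic prefix that still has to step,
and it has no other way to continue. The result holds even though reduction as a whole is
nondeterministic. -/
theorem Dets.steps_inv {G : GCtx} {e e' v : Expr} (h : Dets G e e') (hs : Steps G e v)
    (hv : IsVal v) : Steps G e' v := by
  induction h with
  | refl => exact hs
  | tail _ h ih =>
    cases ih using Relation.ReflTransGen.head_induction_on with
    | refl => exact absurd hv h.not_val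
    | head h₁ h₂ => rwa [h.uniq _ h₁] at h₂

/-! ### Canonical forms -/

/-- The values of a type with a given head. -/
def TyHead.Canon : TyHead → Expr → Prop
  | .unit, v => v = .tt
  | .bool, v => ∃ b, v = .lit b
  | .obool, v => ∃ b, v = .boxedLit b
  | .prod, v => ∃ v₁ v₂, v = .pair v₁ v₂ ∧ IsVal v₁ ∧ IsVal v₂
  | .osum, v => ∃ b w u, v = .boxedInj b w u
  | .pi, v => ∃ τ e, v = .abs τ e
  | .psi _, v => ∃ v₁ v₂, v = .psiPair v₁ v₂ ∧ IsVal v₁ ∧ IsVal v₂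
  | .adt T, v => ∃ i u, v = .ctor T i u ∧ IsVal u

/-- Inverting the typing of an introduction form gives a stable head equivalent to `τ`, and
equivalent types have at most one stable head. -/
theorem IsVal.canon {G : GCtx} (hG : G.Closed) {m : Mode} {Γ : Ctx} {v τ : Expr} {t : TyHead}
    (hv : IsVal v) (h : Typing G m Γ v τ) (ht : τ.head = some t) : t.Canon v := by
  cases hv
  case tt => cases TyEquiv.head_eq hG h.inv rfl ht; rfl
  case lit b => cases TyEquiv.head_eq hG h.inv rfl ht; exact ⟨_, rfl⟩
  case boxedLit b => cases TyEquiv.head_eq hG h.inv rfl ht; exact ⟨_, rfl⟩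
  case boxedInj =>
    obtain ⟨hv, hw⟩ := h.inv
    cases hv
    cases TyEquiv.head_eq hG hw rfl ht; exact ⟨_, _, _, rfl⟩
  case pair h₁ h₂ =>
    obtain ⟨_, _, _, _, hτ⟩ := h.inv
    cases TyEquiv.head_eq hG hτ rfl ht; exact ⟨_, _, rfl, h₁, h₂⟩
  case psiPair h₁ h₂ =>
    obtain ⟨_, _, _, _, _, hτ⟩ := h.inv
    cases TyEquiv.head_eq hG hτ rfl ht; exact ⟨_, _, rfl, h₁, h₂⟩
  case abs =>
    obtain ⟨_, _, _, _, hτ⟩ := h.inv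
    cases TyEquiv.head_eq hG hτ rfl ht; exact ⟨_, _, rfl⟩
  case ctor h₁ =>
    obtain ⟨_, _, _, _, _, _, hτ⟩ := h.inv
    cases TyEquiv.head_eq hG hτ rfl ht; exact ⟨_, _, rfl, h₁⟩

theorem Typing.pair_types {G : GCtx} (hG : G.WellTyped) {m : Mode} {Γ : Ctx} {e₁ e₂ a b : Expr}
    (h : Typing G m Γ (.pair e₁ e₂) (.prodT a b)) : Typing G m Γ e₁ a ∧ Typing G m Γ e₂ b := by
  obtain ⟨hk₁, hk₂⟩ := (h.regular hG).choose_spec.inv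
  obtain ⟨_, _, h₁, h₂, hτ⟩ := h.inv
  obtain ⟨h₃, h₄⟩ := hτ.prodT_inj hG.closed
  exact ⟨.conv h₁ h₃ hk₁, .conv h₂ h₄ hk₂⟩

theorem Typing.psiPair_types {G : GCtx} (hG : G.Closed) {m : Mode} {Γ : Ctx} {k u : Expr}
    {T : Name} {d : OADTDef} (hT : G.oadt T = some d) (h : Typing G m Γ (.psiPair k u) (.psiT T)) :
    Typing G m Γ k d.view ∧ Typing G m Γ u (.oadt T k) := by
  obtain ⟨_, _, hT', h₁, h₂, hτ⟩ := h.inv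
  cases hτ.head_eq hG rfl rfl
  obtain rfl := Option.some.inj (hT.symm.trans hT')
  exact ⟨h₁, h₂⟩

/-! ### Public types -/

/-- The types of kind `pub`. -/
inductive IsPub : Expr → Prop
  | unit : IsPub .unitT
  | bool : IsPub .boolT
  | adt (T : Name) : IsPub (.adt T)
  | prod {a b : Expr} : IsPub a → IsPub b → IsPub (.prodT a b)

theorem Kinding.isPub {G : GCtx} {m : Mode} {Γ : Ctx} {τ : Expr} (h : Kinding G m Γ τ .pub) :
    IsPub τ := by
  -- The kind `any` has to be included because subsumption reaches `pub` from it.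
  suffices (∀ m Γ τ κ, Kinding G m Γ τ κ → κ = .any ∨ κ = .pub → IsPub τ) ∧
      (∀ m Γ e τ, Typing G m Γ e τ → True) from this.1 _ _ _ _ h (.inr rfl)
  apply judgment_induction <;> intros
  case k_sub hκ ih hκ' =>
    apply ih
    rcases hκ with rfl | rfl | rfl
    · exact hκ'
    · exact .inl rfl
    · exact nomatch hκ'
  case k_unit => exact .unit
  case k_bool => exact .bool
  case k_adt => exact .adt _
  case k_prod ih₁ ih₂ hκ => exact .prod (ih₁ hκ) (ih₂ hκ)
  all_goals first
    | trivial
    | (rename_i h; exact nomatch h)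

theorem IsPub.head {τ : Expr} (h : IsPub τ) :
    ∃ t, τ.head = some t ∧ (t = .unit ∨ t = .bool ∨ t = .prod ∨ ∃ T, t = .adt T) := by
  cases h
  exacts [⟨_, rfl, .inl rfl⟩, ⟨_, rfl, .inr (.inl rfl)⟩, ⟨_, rfl, .inr (.inr (.inr ⟨_, rfl⟩))⟩,
    ⟨_, rfl, .inr (.inr (.inl rfl))⟩]

/-- Parallel reduction could change a value under an abstraction, but a value of public type
contains none: abstractions and Psi-pairs have the wrong head, and constructor arguments are public
because the global context is well-typed. -/
theorem IsVal.pub_normal {G : GCtx} (hG : G.WellTyped) {v τ : Expr} (hv : IsVal v)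
    (h : Typing G .secure [] v τ) (hτ : Kinding G .secure [] τ .pub) {x : Prop} {y : Expr}
    (hy : ExtRed G x v y) : y = v := by
  have hc := hG.closed
  induction hv generalizing τ y
  case tt | lit | boxedLit | boxedInj => cases hy; rfl
  case pair ih₁ ih₂ =>
    obtain ⟨_, _, h₁, h₂, he⟩ := h.inv
    obtain ⟨_, _, rfl, k₁, k₂⟩ := hy.pair_inv
    cases hτ.isPub
    case prod =>
      obtain ⟨h₃, h₄⟩ := Typing.pair_types hG h
      rw [ih₁ h₃ hτ.inv.1 k₁, ih₂ h₄ hτ.inv.2 k₂]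
    all_goals exact nomatch he.head_eq hc rfl rfl
  case psiPair =>
    obtain ⟨_, _, _, _, _, he⟩ := h.inv
    obtain ⟨t, ht, h⟩ := hτ.isPub.head
    cases he.head_eq hc rfl ht
    simp at h
  case abs =>
    obtain ⟨_, _, _, _, he⟩ := h.inv
    obtain ⟨t, ht, h⟩ := hτ.isPub.head
    cases he.head_eq hc rfl ht
    simp at h
  case ctor ih =>
    obtain ⟨_, _, _, hT, _, h₁, _⟩ := h.inv
    obtain ⟨_, rfl, k⟩ := hy.ctor_inv
    rw [ih h₁ (hG.adt _ _ _ hT _) k]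

/-- Equivalent values of a public type are equal. -/
theorem IsVal.pub_eq {G : GCtx} (hG : G.WellTyped) {v w τ : Expr} (hv : IsVal v) (hw : IsVal w)
    (htv : Typing G .secure [] v τ) (htw : Typing G .secure [] w τ)
    (hτ : Kinding G .secure [] τ .pub) (h : TyEquiv G v w) : v = w := by
  have : ∀ {u c}, IsVal u → Typing G .secure [] u τ → ExtReds G u c → c = u := by
    intro u c hu ht hr
    induction hr with
    | refl => rfl
    | tail _ h ih => rw [ih] at h; exact hu.pub_normal hG ht hτ h
  obtain ⟨c, h₁, h₂⟩ := h.join hG.closed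
  exact (this hv htv h₁).symm.trans (this hw htw h₂)

/-! ### Typing of the lifting -/

/-- All ADTs and OADTs of a specification type are defined. -/
def SpecTy.Defined (G : GCtx) : SpecTy → Prop
  | .adt T => ∃ d, G.adt T = some d
  | .psi T => ∃ d, G.oadt T = some d
  | .prod a b => a.Defined G ∧ b.Defined G
  | .arrow a b => a.Defined G ∧ b.Defined G
  | _ => True

/-- Specification types contain no terms, so being well-kinded is just definedness of their names.
It depends on neither mode nor context, which spares all weakening arguments for them. -/
theorem Kinding.specTy_defined {G : GCtx} {m : Mode} {θ : SpecTy} {Γ : Ctx} {κ : Kind}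
    (h : Kinding G m Γ θ.toExpr κ) : θ.Defined G := by
  induction θ generalizing Γ κ with
  | unit | bool | obool => trivial
  | adt | psi => exact h.inv
  | prod _ _ ih₁ ih₂ => exact ⟨ih₁ h.inv.1, ih₂ h.inv.2⟩
  | arrow _ _ ih₁ ih₂ =>
    obtain ⟨_, _, h₁, h₂⟩ := h.inv
    exact ⟨ih₁ h₁, ih₂ h₂⟩

theorem SpecTy.Defined.kinding {G : GCtx} {θ : SpecTy} (h : θ.Defined G) (m : Mode) (Γ : Ctx) :
    Kinding G m Γ θ.toExpr .mixed := by
  induction θ generalizing Γ with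
  | unit => exact Kinding.mixed .unit
  | bool => exact Kinding.mixed .bool
  | obool => exact Kinding.mixed .obool
  | adt => exact Kinding.mixed (.adt h.choose_spec)
  | psi => exact .psi h.choose_spec
  | prod _ _ ih₁ ih₂ => exact .prod (ih₁ h.1 Γ) (ih₂ h.2 Γ)
  | arrow _ _ ih₁ ih₂ => exact .pi (ih₁ h.1 Γ) (ih₂ h.2 _)

theorem Typing.specTy_defined {G : GCtx} (hG : G.WellTyped) {m : Mode} {θ : SpecTy} {Γ : Ctx}
    {e : Expr} (h : Typing G m Γ e θ.toExpr) : θ.Defined G :=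
  (h.regular hG).choose_spec.specTy_defined

theorem SpecTy.Defined.erase {G : GCtx} {S : PsiCtx} (hS : S.Valid G) {θ : SpecTy}
    (h : θ.Defined G) : (θ.erase S).Defined G := by
  induction θ with
  | unit | bool | obool => trivial
  | adt => exact h
  | psi => exact (hS.oadt _ _ h.choose_spec).pub_kind.inv
  | prod _ _ ih₁ ih₂ | arrow _ _ ih₁ ih₂ => exact ⟨ih₁ h.1, ih₂ h.2⟩

theorem SpecTy.closed (θ : SpecTy) : θ.toExpr.Closed := fun σ ρ _ => by
  simp only [SpecTy.subst_toExpr]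

-- Non-dependent typing rules for closed specification types, and applications of the structure
-- operations.

section Rules

variable {G : GCtx} {m : Mode} {Γ : Ctx}

theorem Typing.appS {a b : SpecTy} {f e : Expr} (hf : Typing G m Γ f (SpecTy.arrow a b).toExpr)
    (he : Typing G m Γ e a.toExpr) : Typing G m Γ (.app f e) b.toExpr := by
  simpa only [SpecTy.inst_toExpr] using Typing.app hf he

theorem Typing.letS {a b : SpecTy} {e₁ e₂ : Expr} (h₁ : Typing G m Γ e₁ a.toExpr)
    (h₂ : Typing G m (a.toExpr :: Γ) e₂ b.toExpr) : Typing G m Γ (.letE e₁ e₂) b.toExpr := by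
  simpa only [SpecTy.inst_toExpr] using Typing.letE h₁ h₂

theorem Typing.projS {a b : SpecTy} {c : Bool} {e : Expr}
    (h : Typing G m Γ e (SpecTy.prod a b).toExpr) :
    Typing G m Γ (.proj c e) (cond c a b).toExpr := by
  cases c
  · exact Typing.proj (b := false) h
  · exact Typing.proj (b := true) h

theorem Typing.iteS {θ : SpecTy} {e₀ e₁ e₂ : Expr} (h₀ : Typing G m Γ e₀ .boolT)
    (h₁ : Typing G m Γ e₁ θ.toExpr) (h₂ : Typing G m Γ e₂ θ.toExpr) (hθ : θ.Defined G) :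
    Typing G m Γ (.ite e₀ e₁ e₂) θ.toExpr := by
  have := Typing.ite (G := G) (m := m) (Γ := Γ) (τ := θ.toExpr) (κ := .mixed) (e₀ := e₀)
    (e₁ := e₁) (e₂ := e₂)
  simp only [SpecTy.inst_toExpr] at this
  exact this h₀ h₁ h₂ (hθ.kinding _ _)

theorem Typing.ematchS {T : Name} {n : ℕ} {arg bs : Fin n → Expr} {θ : SpecTy} {e₀ : Expr}
    (hT : G.adt T = some ⟨n, arg⟩) (h₀ : Typing G m Γ e₀ (.adt T))
    (h : ∀ i, Typing G m (arg i :: Γ) (bs i) θ.toExpr) (hθ : θ.Defined G) :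
    Typing G m Γ (.ematch T n e₀ bs) θ.toExpr := by
  have := Typing.ematch (G := G) (m := m) (Γ := Γ) (τ := θ.toExpr) (κ := .mixed) (e₀ := e₀)
    (bs := bs) hT h₀
  simp only [SpecTy.inst_toExpr, SpecTy.subst_toExpr] at this
  exact this h (hθ.kinding _ _)

theorem Typing.varS {x : ℕ} {θ : SpecTy} (h : Γ[x]? = some θ.toExpr) (hθ : θ.Defined G) :
    Typing G m Γ (.bvar x) θ.toExpr := by
  have := Typing.bvar (G := G) (m := m) (κ := .mixed) h
  simp only [SpecTy.rename_toExpr] at this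
  exact this (hθ.kinding _ _)

theorem Typing.app_closed {a b f e : Expr} (hb : b.Closed) (hf : Typing G m Γ f (.pi a b))
    (he : Typing G m Γ e a) : Typing G m Γ (.app f e) b := by
  have := Typing.app hf he
  rwa [hb.inst_eq] at this

theorem Typing.app_view {d : OADTDef} {T : Name} {k e f c : Expr} (hc : c.Closed)
    (hf : Typing G m Γ f (.pi d.view (.pi c (.oadt T (.bvar 1)))))
    (hk : Typing G m Γ k d.view) (he : Typing G m Γ e c) :
    Typing G m Γ (.app (.app f k) e) (.oadt T k) := by
  have h₁ := Typing.app hf hk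
  have h₂ : Typing G m Γ (.app f k) (.pi c (.oadt T k.shift)) := by
    have : (Expr.pi c (.oadt T (.bvar 1))).inst k = .pi c (.oadt T k.shift) := by
      show Expr.pi (c.inst k) _ = _
      rw [hc.inst_eq]; rfl
    rwa [this] at h₁
  have h₃ := Typing.app h₂ he
  have : (Expr.oadt T k.shift).inst e = .oadt T k := by
    show Expr.oadt T (k.shift.inst e) = _
    rw [Expr.shift_inst]
  rwa [this] at h₃

/-- The two occurrences of index `1` in the type of `f` denote different variables: in the domain of
the innermost Π it is the old view `k`, in its codomain the new view `k'`. -/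
theorem Typing.app_reshape {d : OADTDef} {T : Name} {k k' u f : Expr} (hd : d.view.Closed)
    (hf : Typing G m Γ f
      (.pi d.view (.pi d.view (.pi (.oadt T (.bvar 1)) (.oadt T (.bvar 1))))))
    (hk : Typing G m Γ k d.view) (hk' : Typing G m Γ k' d.view)
    (hu : Typing G m Γ u (.oadt T k)) :
    Typing G m Γ (app3 f k k' u) (.oadt T k') := by
  have h₁ := Typing.app hf hk
  have h₂ : Typing G m Γ (.app f k)
      (.pi d.view (.pi (.oadt T k.shift) (.oadt T (.bvar 1)))) := by
    have : (Expr.pi d.view (.pi (.oadt T (.bvar 1)) (.oadt T (.bvar 1)))).inst k =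
        .pi d.view (.pi (.oadt T k.shift) (.oadt T (.bvar 1))) := by
      show Expr.pi (d.view.inst k) _ = _
      rw [hd.inst_eq]; rfl
    rwa [this] at h₁
  have h₃ := Typing.app h₂ hk'
  have h₄ : Typing G m Γ (.app (.app f k) k') (.pi (.oadt T k) (.oadt T k'.shift)) := by
    have : (Expr.pi (.oadt T k.shift) (.oadt T (.bvar 1))).inst k' =
        .pi (.oadt T k) (.oadt T k'.shift) := by
      show Expr.pi (.oadt T (k.shift.inst k')) _ = _
      rw [Expr.shift_inst]; rfl
    rwa [this] at h₃
  have h₅ := Typing.app h₄ hu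
  have : (Expr.oadt T k'.shift).inst u = .oadt T k' := by
    show Expr.oadt T (k'.shift.inst u) = _
    rw [Expr.shift_inst]
  rwa [this] at h₅

end Rules

/-- The type of the mergeability witness of `θ`. -/
abbrev SpecTy.iteTy (θ : SpecTy) : SpecTy := .arrow .obool (.arrow θ (.arrow θ θ))

theorem Typing.app_iteS {G : GCtx} {m : Mode} {Γ : Ctx} {θ : SpecTy} {ite b x y : Expr}
    (h : Typing G m Γ ite θ.iteTy.toExpr) (hb : Typing G m Γ b .oboolT)
    (hx : Typing G m Γ x θ.toExpr) (hy : Typing G m Γ y θ.toExpr) :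
    Typing G m Γ (app3 ite b x y) θ.toExpr :=
  .appS (a := θ) (.appS (a := θ) (.appS (a := .obool) h hb) hx) hy

theorem Typing.iteFunS {G : GCtx} {m : Mode} {Γ : Ctx} {θ : SpecTy} (hθ : θ.Defined G)
    {body : Expr} (h : Typing G m (θ.toExpr :: θ.toExpr :: .oboolT :: Γ) body θ.toExpr) :
    Typing G m Γ (iteFun θ body) θ.iteTy.toExpr :=
  .abs .obool (.abs (hθ.kinding _ _) (.abs (hθ.kinding _ _) h))

/-- The witnesses are secure because every `mux` sits at an oblivious type: `unit`, `obool`, or `T̂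
k` with one and the same `k`. For the last, the Psi witness computes the joined view publicly and
reshapes both payloads before selecting. -/
theorem Mergeable.typing {G : GCtx} {S : PsiCtx} (hG : G.WellTyped) (hS : S.Valid G)
    {θ : SpecTy} {ite : Expr} (h : Mergeable S θ ite) (hθ : θ.Defined G) (m : Mode) (Γ : Ctx) :
    Typing G m Γ ite θ.iteTy.toExpr := by
  have hc := hG.closed
  have us : Mode.usable .secure m := fun _ => rfl
  have v {Δ : Ctx} {x : ℕ} {θ : SpecTy} (h : Δ[x]? = some θ.toExpr) (hθ : θ.Defined G) :=
    Typing.varS (m := m) h hθ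
  induction h generalizing Γ with
  | unit =>
    exact .iteFunS hθ (.mux (v (θ := .obool) rfl trivial) (.sub .unit (.inr (.inl rfl)))
      (fun _ => rfl) (v (θ := .unit) rfl trivial) (v (θ := .unit) rfl trivial))
  | obool =>
    exact .iteFunS hθ (.mux (v (θ := .obool) rfl trivial) .obool
      (fun _ => rfl) (v (θ := .obool) rfl trivial) (v (θ := .obool) rfl trivial))
  | @psi j hj =>
    obtain ⟨d, hd, hj⟩ := hS.join j hj
    have hv := hc.view _ _ hd
    have hk := (hG.oadt _ _ hd).1
    refine .iteFunS hθ ?_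
    have p {Δ : Ctx} {x : ℕ} (h : Δ[x]? = some (.psiT j.oadt)) :
        Typing G m Δ (.proj true (.bvar x)) d.view := .psiProj₁ hd (v (θ := .psi _) h hθ)
    have q {Δ : Ctx} {x : ℕ} (h : Δ[x]? = some (.psiT j.oadt)) :
        Typing G m Δ (.proj false (.bvar x)) (.oadt j.oadt (.proj true (.bvar x))) :=
      .psiProj₂ hd (v (θ := .psi _) h hθ)
    have hk0 {Δ : Ctx} : Typing G m (d.view :: Δ) (.bvar 0) d.view := by
      have := Typing.bvar (G := G) (m := m) (Γ := d.view :: Δ) (x := 0) (κ := .pub) rfl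
      rw [hv.rename_eq] at this
      exact this (hk.weaken hc us _)
    refine Typing.letE (τ₁ := d.view) (τ₂ := .psiT j.oadt) ?_ ?_
    · refine .app_closed hv (.app_closed (b := .pi d.view d.view) ?_
        (hj.join_ty.weaken hG us _) (p rfl)) (p rfl)
      intro σ ρ _
      show Expr.pi _ _ = Expr.pi _ _
      simp only [hv.subst_eq]
    · exact .psiPair hd hk0 (.mux (v (θ := .obool) rfl trivial) (.oadt hd hk0) (fun _ => rfl)
        (.app_reshape hv (hj.reshape_ty.weaken hG us _) (p rfl) hk0 (q rfl))
        (.app_reshape hv (hj.reshape_ty.weaken hG us _) (p rfl) hk0 (q rfl)))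
  | @prod θ₁ θ₂ _ _ _ _ ih₁ ih₂ =>
    have p (b : Bool) {Δ : Ctx} {x : ℕ} (h : Δ[x]? = some (SpecTy.prod θ₁ θ₂).toExpr) :
        Typing G m Δ (.proj b (.bvar x)) (cond b θ₁ θ₂).toExpr := .projS (v h hθ)
    exact .iteFunS hθ (.pair
      (.app_iteS (ih₁ hθ.1 _) (v (θ := .obool) rfl trivial) (p true rfl) (p true rfl))
      (.app_iteS (ih₂ hθ.2 _) (v (θ := .obool) rfl trivial) (p false rfl) (p false rfl)))
  | @arrow θ₁ θ₂ _ _ ih =>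
    have w {Δ : Ctx} {x : ℕ} (h : Δ[x]? = some (SpecTy.arrow θ₁ θ₂).toExpr)
        (h₀ : Δ[0]? = some θ₁.toExpr) :
        Typing G m Δ (.app (.bvar x) (.bvar 0)) θ₂.toExpr := .appS (v h hθ) (v h₀ hθ.1)
    exact .iteFunS hθ (.abs (hθ.1.kinding _ _)
      (.app_iteS (ih hθ.2 _) (v (θ := .obool) rfl trivial) (w rfl rfl) (w rfl rfl)))

/-- Coercions leave the erased type alone, so they are invisible on the source side. Definedness is
transported in both directions because arrows are contravariant in their domain. -/
theorem Coercible.typing {G : GCtx} {S : PsiCtx} (hG : G.WellTyped) (hS : S.Valid G)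
    {θ θ' : SpecTy} {c : Expr} (h : Coercible G S θ θ' c) :
    θ'.erase S = θ.erase S ∧ (θ.Defined G ↔ θ'.Defined G) ∧
      (θ.Defined G → ∀ m Γ, Typing G m Γ c (SpecTy.arrow θ θ').toExpr) := by
  have hc := hG.closed
  have us {m : Mode} : Mode.usable .secure m := fun _ => rfl
  have v {m : Mode} {Δ : Ctx} {x : ℕ} {θ : SpecTy} (h : Δ[x]? = some θ.toExpr)
    (hθ : θ.Defined G) := Typing.varS (m := m) h hθ
  induction h with
  | refl θ => exact ⟨rfl, .rfl, fun h m Γ => .abs (h.kinding _ _) (v rfl h)⟩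
  | bool => exact ⟨rfl, .rfl, fun h m Γ => .abs .bool (.sec (v (θ := .bool) rfl trivial))⟩
  | @adt T d hd =>
    have ho := hS.oadt _ _ hd
    have hv := hc.view _ _ hd
    refine ⟨rfl, ⟨fun _ => ⟨_, hd⟩, fun _ => ho.pub_kind.inv⟩, fun h m Γ => ?_⟩
    have hx : Typing G m (.adt (S.oadt T).pub :: Γ) (.bvar 0) (.adt (S.oadt T).pub) :=
      v (θ := .adt _) rfl h
    have hk := Typing.app_closed hv (ho.view_ty.weaken hG us _) hx
    exact .abs (ho.pub_kind.weaken hc us _) (.psiPair hd hk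
      (.app_view (SpecTy.closed (.adt _)) (ho.s_ty.weaken hG us _) hk hx))
  | @psi c h =>
    have h := hS.coer c h
    refine ⟨?_, ⟨fun _ => h.tgt_def, fun _ => h.src_def⟩, fun _ m Γ => h.fn_ty.weaken hG us _⟩
    simp only [SpecTy.erase, h.compat]
  | prod _ _ ih₁ ih₂ =>
    obtain ⟨h₁, h₂, h₃⟩ := ih₁
    obtain ⟨k₁, k₂, k₃⟩ := ih₂
    refine ⟨?_, and_congr h₂ k₂, fun h m Γ => .abs (h.kinding _ _) (.pair ?_ ?_)⟩
    · simp only [SpecTy.erase, h₁, k₁]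
    · exact .appS (h₃ h.1 _ _) (.projS (c := true) (v rfl h))
    · exact .appS (k₃ h.2 _ _) (.projS (c := false) (v rfl h))
  | @arrow θ₁ θ₂ θ₁' θ₂' _ _ _ _ ih₁ ih₂ =>
    obtain ⟨h₁, h₂, h₃⟩ := ih₁
    obtain ⟨k₁, k₂, k₃⟩ := ih₂
    refine ⟨?_, and_congr h₂.symm k₂, fun h m Γ => .abs (h.kinding _ _)
      (.abs ((h₂.2 h.1).kinding _ _) ?_)⟩
    · simp only [SpecTy.erase, h₁, k₁]
    · exact .appS (k₃ h.2 _ _) (.appS (v (θ := .arrow θ₁ θ₂) rfl h)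
        (.appS (h₃ (h₂.2 h.1) _ _) (v rfl (h₂.2 h.1))))

theorem Typing.foldl_app {G : GCtx} {m : Mode} {Γ : Ctx} {r : SpecTy} {ts : List SpecTy}
    {as : List Expr} (h : List.Forall₂ (fun t a => Typing G m Γ a t.toExpr) ts as) {f : Expr}
    (hf : Typing G m Γ f (ts.foldr SpecTy.arrow r).toExpr) :
    Typing G m Γ (as.foldl Expr.app f) r.toExpr := by
  induction h generalizing f with
  | nil => exact hf
  | cons h _ ih => exact ih (.appS hf h)

theorem Typing.apps {G : GCtx} {m : Mode} {Γ : Ctx} {r : SpecTy} {n : ℕ} {ts : Fin n → SpecTy}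
    {as : Fin n → Expr} (h : ∀ i, Typing G m Γ (as i) (ts i).toExpr) {f : Expr}
    (hf : Typing G m Γ f ((List.ofFn ts).foldr SpecTy.arrow r).toExpr) :
    Typing G m Γ (OADT.apps f as) r.toExpr := by
  refine .foldl_app (List.forall₂_iff_get.2 ⟨by simp, fun i _ _ => ?_⟩) hf
  simpa using h _

/-- The type of the method is well-kinded by regularity and mentions the return type and all
argument types. -/
theorem ElimStr.Valid.ret_defined {G : GCtx} {S : PsiCtx} (hG : G.WellTyped) {c : ElimStr}
    (h : c.Valid G S) : c.ret.Defined G ∧ ∀ i, (c.arg i).Defined G := by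
  have := (Typing.specTy_defined hG h.fn_ty).2
  have key : ∀ ts : List SpecTy, (ts.foldr SpecTy.arrow c.ret).Defined G →
      c.ret.Defined G ∧ ∀ t ∈ ts, t.Defined G := by
    intro ts
    induction ts with
    | nil => exact fun h => ⟨h, by simp⟩
    | cons t ts ih => exact fun h => ⟨(ih h.2).1, by simpa using ⟨h.1, (ih h.2).2⟩⟩
  refine ⟨(key _ this).1, fun i => ?_⟩
  exact ((key _ this).2 (.arrow (c.arg i) c.ret) (List.mem_ofFn.2 ⟨i, rfl⟩)).1

/-- A public specification type contains no oblivious components. -/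
theorem SpecTy.erase_pub {G : GCtx} {S : PsiCtx} {θ : SpecTy} {m : Mode} {Γ : Ctx}
    (h : Kinding G m Γ θ.toExpr .pub) : θ.erase S = θ := by
  replace h := h.isPub
  induction θ with
  | unit | bool | adt => rfl
  | obool | psi | arrow => exact nomatch h
  | prod _ _ ih₁ ih₂ =>
    cases h with
    | prod h₁ h₂ => simp only [SpecTy.erase, ih₁ h₁, ih₂ h₂]

/-- Lifted expressions and their sources are well-typed. -/
theorem Lifts.typing {G : GCtx} {S : PsiCtx} {L : Set LiftEntry} (hG : G.WellTyped)
    (hS : S.Valid G) (hL : ∀ l ∈ L, l.ty.Defined G ∧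
      (∀ Γ, Typing G .secure Γ (.gvar l.src) (l.ty.erase S).toExpr) ∧
      ∀ Γ, Typing G .secure Γ (.gvar l.tgt) l.ty.toExpr)
    {Γ : List SpecTy} {e e' : Expr} {θ : SpecTy} (h : Lifts G S L Γ e θ e')
    (hΓ : ∀ t ∈ Γ, t.Defined G) :
    θ.Defined G ∧
      Typing G .secure (Γ.map fun t => (t.erase S).toExpr) e (θ.erase S).toExpr ∧
      Typing G .secure (Γ.map fun t => t.toExpr) e' θ.toExpr := by
  have hc := hG.closed
  have us : Mode.usable .secure .secure := fun _ => rfl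
  have cons {Γ : List SpecTy} {t : SpecTy} (ht : t.Defined G) (hΓ : ∀ t ∈ Γ, t.Defined G) :
      ∀ s ∈ t :: Γ, s.Defined G := by simpa using ⟨ht, hΓ⟩
  induction h with
  | unit => exact ⟨trivial, .tt, .tt⟩
  | lit => exact ⟨trivial, .lit, .lit⟩
  | var h =>
    have hθ := hΓ _ (List.mem_of_getElem? h)
    exact ⟨hθ, .varS (by simp [h]) (hθ.erase hS), .varS (by simp [h]) hθ⟩
  | fn h => exact ⟨(hL _ h).1, (hL _ h).2.1 _, (hL _ h).2.2 _⟩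
  | abs h _ ih =>
    have h := h.choose_spec.specTy_defined
    obtain ⟨h₁, h₂, h₃⟩ := ih (cons h hΓ)
    exact ⟨⟨h, h₁⟩, .abs ((h.erase hS).kinding _ _) h₂, .abs (h.kinding _ _) h₃⟩
  | app _ _ ih₁ ih₂ =>
    obtain ⟨h₁, h₂, h₃⟩ := ih₁ hΓ
    obtain ⟨-, k₂, k₃⟩ := ih₂ hΓ
    exact ⟨h₁.2, .appS h₂ k₂, .appS h₃ k₃⟩
  | letE _ _ ih₁ ih₂ =>
    obtain ⟨h₁, h₂, h₃⟩ := ih₁ hΓ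
    obtain ⟨k₁, k₂, k₃⟩ := ih₂ (cons h₁ hΓ)
    exact ⟨k₁, .letS h₂ k₂, .letS h₃ k₃⟩
  | pair _ _ ih₁ ih₂ =>
    obtain ⟨h₁, h₂, h₃⟩ := ih₁ hΓ
    obtain ⟨k₁, k₂, k₃⟩ := ih₂ hΓ
    exact ⟨⟨h₁, k₁⟩, .pair h₂ k₂, .pair h₃ k₃⟩
  | @proj _ b _ _ _ _ _ ih =>
    obtain ⟨h₁, h₂, h₃⟩ := ih hΓ
    have := Typing.projS (c := b) h₂
    cases b
    · exact ⟨h₁.2, this, h₃.projS (c := false)⟩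
    · exact ⟨h₁.1, this, h₃.projS (c := true)⟩
  | ite₁ _ _ _ ih₀ ih₁ ih₂ =>
    obtain ⟨-, h₂, h₃⟩ := ih₀ hΓ
    obtain ⟨k₁, k₂, k₃⟩ := ih₁ hΓ
    obtain ⟨-, l₂, l₃⟩ := ih₂ hΓ
    exact ⟨k₁, .iteS h₂ k₂ l₂ (k₁.erase hS), .iteS h₃ k₃ l₃ k₁⟩
  | ite₂ _ hm _ _ ih₀ ih₁ ih₂ =>
    obtain ⟨-, h₂, h₃⟩ := ih₀ hΓ
    obtain ⟨k₁, k₂, k₃⟩ := ih₁ hΓ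
    obtain ⟨-, l₂, l₃⟩ := ih₂ hΓ
    exact ⟨k₁, .iteS h₂ k₂ l₂ (k₁.erase hS), .app_iteS (hm.typing hG hS k₁ _ _) h₃ k₃ l₃⟩
  | ctor₁ hT hη _ ih =>
    obtain ⟨-, h₂, h₃⟩ := ih hΓ
    -- Declared constructor arguments are public, hence equal to their erasures, and source and
    -- target use the same constructor rule.
    rw [SpecTy.erase_pub (hη ▸ hG.adt _ _ _ hT _)] at h₂
    exact ⟨⟨_, hT⟩, .ctor hT (hη ▸ h₂), .ctor hT (hη ▸ h₃)⟩
  | ctor₂ h _ ih =>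
    obtain ⟨-, h₂, h₃⟩ := ih hΓ
    have h := hS.intro _ h
    obtain ⟨n, arg, i, hT, hi, ha⟩ := h.compat
    rw [hi]
    exact ⟨h.oadt_def, .ctor hT (ha ▸ h₂), .appS (h.fn_ty.weaken hG us _) h₃⟩
  | ematch₁ hT hη hθ _ _ ih₀ ih =>
    obtain ⟨-, h₂, h₃⟩ := ih₀ hΓ
    have hθ := hθ.choose_spec.specTy_defined
    have hk := fun i => (hη i).symm ▸ hG.adt _ _ _ hT i
    have ih := fun i => ih i (cons (hk i).specTy_defined hΓ)
    refine ⟨hθ, .ematchS hT h₂ (fun i => ?_) (hθ.erase hS), .ematchS hT h₃ (fun i => ?_) hθ⟩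
    · have := (ih i).2.1
      rw [List.map_cons, SpecTy.erase_pub (hk i), hη] at this
      exact this
    · have := (ih i).2.2
      rw [List.map_cons, hη] at this
      exact this
  | ematch₂ h _ _ ih₀ ih =>
    obtain ⟨-, h₂, h₃⟩ := ih₀ hΓ
    have h := hS.elim _ h
    obtain ⟨arg, hT, ha⟩ := h.compat
    obtain ⟨hr, hd⟩ := h.ret_defined hG
    have ih := fun i => ih i (cons (hd i) hΓ)
    refine ⟨hr, .ematchS hT h₂ (fun i => ?_) (hr.erase hS), .apps (fun i => ?_)
      (.appS (h.fn_ty.weaken hG us _) h₃)⟩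
    · have := (ih i).2.1
      rw [List.map_cons, ha] at this
      exact this
    · exact .abs ((hd i).kinding _ _) (ih i).2.2
  | coerce _ hc ih =>
    obtain ⟨h₁, h₂, h₃⟩ := ih hΓ
    obtain ⟨k₁, k₂, k₃⟩ := hc.typing hG hS
    exact ⟨k₂.1 h₁, k₁ ▸ h₂, .appS (k₃ h₁ _ _) h₃⟩

/-! ### The refinement relation -/

/-- The part of the expression interpretation that concerns evaluation. -/
def Refines (G : GCtx) (S : PsiCtx) (θ : SpecTy) (n : ℕ) (e e' : Expr) : Prop :=
  ∀ i < n, ∀ v', IsVal v' → StepN G i e' v' →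
    ∃ v, IsVal v ∧ Steps G e v ∧ interpV G S θ (n - i) v v'

section Refines

variable {G : GCtx} {S : PsiCtx}

theorem interpV.valPair {θ : SpecTy} {n : ℕ} {v v' : Expr} (h : interpV G S θ n v v') :
    valPair G S θ v v' := by
  cases θ <;> exact h.1

/-- The index occurs only as a guard `0 < n` or as a bound `i < n`, so lowering it weakens the
requirement. -/
theorem interpV.mono {θ : SpecTy} {m n : ℕ} {v v' : Expr} (h : interpV G S θ n v v')
    (hm : m ≤ n) : interpV G S θ m v v' := by
  induction θ generalizing v v' with
  | unit | bool | adt => exact ⟨h.1, fun h' => h.2 (h'.trans_le hm)⟩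
  | obool =>
    obtain ⟨h₁, b, b', h₂, h₃, h⟩ := h
    exact ⟨h₁, b, b', h₂, h₃, fun h' => h (h'.trans_le hm)⟩
  | psi =>
    obtain ⟨h₁, k, u, h₂, h⟩ := h
    exact ⟨h₁, k, u, h₂, fun h' => h (h'.trans_le hm)⟩
  | prod _ _ ih₁ ih₂ =>
    obtain ⟨h₁, v₁, v₂, v₁', v₂', h₂, h₃, h₄, h₅⟩ := h
    exact ⟨h₁, v₁, v₂, v₁', v₂', h₂, h₃, ih₁ h₄, ih₂ h₅⟩
  | arrow =>
    obtain ⟨h₁, τ, e, τ', e', h₂, h₃, h⟩ := h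
    exact ⟨h₁, τ, e, τ', e', h₂, h₃, fun i hi => h i (hi.trans_le hm)⟩

theorem Refines.mono {θ : SpecTy} {m n : ℕ} {e e' : Expr} (h : Refines G S θ n e e')
    (hm : m ≤ n) : Refines G S θ m e e' := by
  intro i hi v' hv' hs
  obtain ⟨v, hv, hs, h⟩ := h i (hi.trans_le hm) v' hv' hs
  exact ⟨v, hv, hs, h.mono (by omega)⟩

/-- Index `0` asks for nothing, so one may assume a positive index, which discharges the guards in
the value interpretation. -/
theorem Refines.of_pos {θ : SpecTy} {n : ℕ} {e e' : Expr} (h : 0 < n → Refines G S θ n e e') :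
    Refines G S θ n e e' := fun i hi => h (Nat.zero_lt_of_lt hi) i hi

/-- For results such as Psi-pairs, where the structure axioms give the relation at every index, the
number of steps taken is irrelevant. -/
theorem Refines.of_steps {θ : SpecTy} {n : ℕ} {e e' : Expr}
    (h : 0 < n → ∀ v', IsVal v' → Steps G e' v' →
      ∃ v, IsVal v ∧ Steps G e v ∧ ∀ m, interpV G S θ m v v') : Refines G S θ n e e' := by
  intro i hi v' hv' hs
  obtain ⟨v, hv, hs, h⟩ := h (Nat.zero_lt_of_lt hi) v' hv' hs.steps
  exact ⟨v, hv, hs, h _⟩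

theorem interpV.refines {θ : SpecTy} {n : ℕ} {v v' : Expr} (h : interpV G S θ n v v') :
    Refines G S θ n v v' := by
  intro i hi w hw hs
  cases hs with
  | zero => exact ⟨v, h.valPair.1.1, .refl, h⟩
  | succ hs _ => exact absurd hs h.valPair.2.1.not_step

/-- Source steps are not counted, so the relation is closed under expansion of the source. -/
theorem Refines.src {θ : SpecTy} {n : ℕ} {e e₁ e' : Expr} (h : Refines G S θ n e₁ e')
    (he : Steps G e e₁) : Refines G S θ n e e' := by
  intro i hi v' hv' hs
  obtain ⟨v, hv, hs, h⟩ := h i hi v' hv' hs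
  exact ⟨v, hv, he.trans hs, h⟩

/-- A deterministic target step pays for one unit of the index: `i + 1 < n` leaves `i < n - 1`, and
`n - (i + 1) ≤ n - 1 - i`. The gain is spent at β-reductions and at the unfolding of global
functions. -/
theorem Refines.det_pred {θ : SpecTy} {n : ℕ} {e e₁ e' : Expr} (h : Refines G S θ (n - 1) e e₁)
    (he : Det G e' e₁) : Refines G S θ n e e' := by
  intro i hi v' hv' hs
  cases hs with
  | zero => exact absurd hv' he.not_val
  | @succ i _ _ _ hs hs' =>
    obtain rfl := he.uniq _ hs
    obtain ⟨v, hv, hs, h⟩ := h i (by omega) v' hv' hs'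
    exact ⟨v, hv, hs, h.mono (by omega)⟩

theorem Refines.det {θ : SpecTy} {n : ℕ} {e e₁ e' : Expr} (h : Refines G S θ n e e₁)
    (he : Det G e' e₁) : Refines G S θ n e e' := (h.mono (Nat.sub_le _ _)).det_pred he

theorem Refines.dets {θ : SpecTy} {n : ℕ} {e e₁ e' : Expr} (h : Refines G S θ n e e₁)
    (he : Dets G e' e₁) : Refines G S θ n e e' := by
  induction he using Relation.ReflTransGen.head_induction_on with
  | refl => exact h
  | head h₁ _ ih => exact ih.det h₁

/-- A target reduction splits into `j` steps that evaluate the hole and a rest with budget `n - j`.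
The source `s` need not have the shape of `K`: the continuation only learns that `e` evaluates to
the related source value. -/
theorem Refines.bind {θ₁ θ₂ : SpecTy} {n : ℕ} {e e' s : Expr} (h : Refines G S θ₁ n e e')
    {K : Expr → Expr} (hK : IsCtx G K)
    (hs : ∀ m ≤ n, 0 < m → ∀ v v', Steps G e v → interpV G S θ₁ m v v' →
      Refines G S θ₂ m s (K v')) : Refines G S θ₂ n s (K e') := by
  intro i hi v' hv' hst
  obtain ⟨j, k, w, rfl, hw, h₁, h₂⟩ := hst.ctx_inv hK hv'
  obtain ⟨v, hv, h₃, h₄⟩ := h j (by omega) w hw h₁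
  have := hs _ (Nat.sub_le _ _) (by omega) v w h₃ h₄ k (by omega) v' hv' h₂
  rwa [Nat.sub_sub] at this

/-- The typing half of the relation between instantiated bodies comes from the typing of the
abstractions by application and preservation, which leaves only the evaluation half. -/
theorem interpV.abs (hG : G.WellTyped) {a b : SpecTy} {n : ℕ} {τ τ' e e' : Expr}
    (ht : Typing G .secure [] (.abs τ e) ((SpecTy.arrow a b).erase S).toExpr)
    (ht' : Typing G .secure [] (.abs τ' e') (SpecTy.arrow a b).toExpr)
    (h : ∀ i < n, ∀ u u', interpV G S a i u u' → Refines G S b i (e.inst u) (e'.inst u')) :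
    interpV G S (.arrow a b) n (.abs τ e) (.abs τ' e') := by
  refine ⟨⟨⟨.abs _ _, ht⟩, .abs _ _, ht'⟩, τ, e, τ', e', rfl, rfl, fun i hi u u' hu => ?_⟩
  obtain ⟨⟨h₁, h₂⟩, h₃, h₄⟩ := hu.valPair
  exact ⟨Typing.steps hG (Typing.appS ht h₂) (.single (.beta h₁)),
    Typing.steps hG (Typing.appS ht' h₄) (.single (.beta h₃)), h i hi u u' hu⟩

/-- Functions at index `n` are tested only at strictly smaller indices. The β-step on the target
lowers `m ≤ n` to `m - 1 < n`, which is exactly enough. -/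
theorem interpV.app {a b : SpecTy} {m n : ℕ} {f f' u u' : Expr}
    (hf : interpV G S (.arrow a b) n f f') (hm : m ≤ n) (hu : interpV G S a m u u') :
    Refines G S b m (.app f u) (.app f' u') := by
  obtain ⟨-, τ, e, τ', e', rfl, rfl, h⟩ := hf
  refine Refines.of_pos fun hp => Refines.det_pred (Refines.src ?_ (.single (.beta hu.valPair.1.1)))
    (.beta hu.valPair.2.1)
  exact (h (m - 1) (by omega) u u' (hu.mono (Nat.sub_le _ _))).2.2

theorem interpV.pair {a b : SpecTy} {n : ℕ} {v w v' w' : Expr} (hv : interpV G S a n v v')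
    (hw : interpV G S b n w w') : interpV G S (.prod a b) n (.pair v w) (.pair v' w') := by
  obtain ⟨⟨h₁, h₂⟩, h₃, h₄⟩ := hv.valPair
  obtain ⟨⟨k₁, k₂⟩, k₃, k₄⟩ := hw.valPair
  exact ⟨⟨⟨.pair h₁ k₁, .pair h₂ k₂⟩, .pair h₃ k₃, .pair h₄ k₄⟩, v, w, v', w', rfl, rfl, hv, hw⟩

/-- Related values of a public type are equal. -/
theorem interpV.pub_eq {θ : SpecTy} {n : ℕ} (hn : 0 < n) {v v' : Expr}
    (h : interpV G S θ n v v') (hθ : IsPub θ.toExpr) : v = v' := by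
  induction θ generalizing v v' with
  | unit | bool | adt => exact h.2 hn
  | obool | psi | arrow => exact nomatch hθ
  | prod _ _ ih₁ ih₂ =>
    obtain ⟨-, v₁, v₂, v₁', v₂', rfl, rfl, h₁, h₂⟩ := h
    cases hθ with
    | prod k₁ k₂ => rw [ih₁ h₁ k₁, ih₂ h₂ k₂]

/-- Values of a public type are related to themselves. -/
theorem ValOf.interpV_self (hG : G.WellTyped) {θ : SpecTy} (hθ : Kinding G .secure [] θ.toExpr .pub)
    {v : Expr} (hv : ValOf G v θ.toExpr) (n : ℕ) : interpV G S θ n v v := by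
  have he := SpecTy.erase_pub (S := S) hθ
  have hp : OADT.valPair G S θ v v := by rw [OADT.valPair, he]; exact ⟨hv, hv⟩
  induction θ generalizing v with
  | unit | bool | adt => exact ⟨hp, fun _ => rfl⟩
  | obool | psi | arrow => exact nomatch hθ.isPub
  | prod _ _ ih₁ ih₂ =>
    obtain ⟨v₁, v₂, rfl, h₁, h₂⟩ := IsVal.canon hG.closed hv.1 hv.2 (t := .prod) rfl
    obtain ⟨t₁, t₂⟩ := Typing.pair_types hG hv.2
    obtain ⟨k₁, k₂⟩ := hθ.inv
    have e₁ := SpecTy.erase_pub (S := S) k₁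
    have e₂ := SpecTy.erase_pub (S := S) k₂
    exact .pair (ih₁ k₁ ⟨h₁, t₁⟩ e₁ (by rw [OADT.valPair, e₁]; exact ⟨⟨h₁, t₁⟩, h₁, t₁⟩))
      (ih₂ k₂ ⟨h₂, t₂⟩ e₂ (by rw [OADT.valPair, e₂]; exact ⟨⟨h₂, t₂⟩, h₂, t₂⟩))

end Refines

/-! ### Coercions and mergeability -/

section Witness

variable {G : GCtx} {S : PsiCtx}

theorem interpV.psi_mk {T : Name} {v k u : Expr} (hv : ValOf G v (.adt (S.oadt T).pub))
    (hu : ValOf G (.psiPair k u) (.psiT T))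
    (h : Steps G (.app (.app (S.oadt T).r k) u) v) (n : ℕ) :
    interpV G S (.psi T) n v (.psiPair k u) := ⟨⟨hv, hu⟩, k, u, rfl, fun _ => h⟩

theorem IsVal.psiPair_inv {k u : Expr} (h : IsVal (.psiPair k u)) : IsVal k ∧ IsVal u := by
  cases h
  case psiPair h₁ h₂ => exact ⟨h₁, h₂⟩

theorem ValOf.psi_inv (hG : G.Closed) {T : Name} {d : OADTDef} (hT : G.oadt T = some d)
    {k u : Expr} (h : ValOf G (.psiPair k u) (.psiT T)) :
    ValOf G k d.view ∧ ValOf G u (.oadt T k) :=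
  ⟨⟨h.1.psiPair_inv.1, (Typing.psiPair_types hG hT h.2).1⟩,
    h.1.psiPair_inv.2, (Typing.psiPair_types hG hT h.2).2⟩

/-- Source and target types have the same erasure, so the coerced target is compared with the same
source value. Induction over the coercion passes through products componentwise and through arrows
by coercing the argument, applying the function and coercing the result. -/
theorem Coercible.refines (hG : G.WellTyped) (hS : S.Valid G) {θ θ' : SpecTy} {c : Expr}
    (h : Coercible G S θ θ' c) (hθ : θ.Defined G) {n : ℕ} {v v' : Expr}
    (hv : interpV G S θ n v v') : Refines G S θ' n v (.app c v') := by
  have hc := hG.closed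
  induction h generalizing n v v' with
  | refl θ => exact hv.refines.det (.beta hv.valPair.2.1)
  | bool =>
    refine Refines.of_pos fun hn => ?_
    obtain rfl := hv.2 hn
    obtain ⟨b, rfl⟩ := IsVal.canon hc hv.valPair.2.1 hv.valPair.2.2 (t := .bool) rfl
    refine Refines.det (Refines.det ?_ .secLit) (.beta hv.valPair.2.1)
    exact interpV.refines ⟨⟨hv.valPair.1, .boxedLit _, .boxedLit⟩, b, b, rfl, rfl, fun _ => rfl⟩
  | @adt T d hd =>
    refine .of_steps fun hn w hw hs => ?_
    obtain rfl := hv.2 hn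
    have hv := hv.valPair.2
    have ho := hS.oadt _ _ hd
    have hview := hc.view _ _ hd
    have hw' := Typing.steps hG
      (.appS (((Coercible.adt hd).typing hG hS).2.2 hθ .secure []) hv.2) hs
    replace hs : Steps G (.psiPair (.app (S.oadt T).view v)
        (.app (.app (S.oadt T).s (.app (S.oadt T).view v)) v)) w := by
      have := Dets.steps_inv (.single (.beta hv.1)) hs hw
      simpa only [Expr.inst, Expr.subst, instSub, ho.view_ty.closed.subst_eq,
        ho.s_ty.closed.subst_eq] using this
    obtain ⟨k, hk, h₁, hs⟩ := hs.ctx_inv (.psiL _) hw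
    obtain ⟨u, hu, h₂, hs⟩ := hs.ctx_inv (.psiR hk) hw
    obtain rfl := IsVal.steps_eq (.psiPair hk hu) hs
    obtain ⟨k', hk', h₃, h₄⟩ := h₂.ctx_inv ((IsCtx.appL hv.1).comp (.appR _)) hu
    have tv := Typing.app_closed hview ho.view_ty hv.2
    have tk := Typing.steps hG tv h₁
    have tk' := Typing.steps hG tv h₃
    -- The view function is run twice, once for the first component and once for the section's
    -- argument. Both results are convertible values of the public view type, so they coincide.
    obtain rfl := IsVal.pub_eq hG hk hk' tk tk' (hG.oadt _ _ hd).1 (h₁.equiv.symm.trans h₃.equiv)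
    refine ⟨v, hv.1, .refl, interpV.psi_mk hv ⟨.psiPair hk hu, hw'⟩ ?_⟩
    exact ho.ret_sec v k u hv ⟨hk, tk⟩ ⟨hu, (Typing.psiPair_types hc hd hw').2⟩
      (ho.view_view v k hv ⟨hk, tk⟩ h₁) h₄
  | @psi c h =>
    have h := hS.coer c h
    refine .of_steps fun hn w hw hs => ?_
    have hw' := Typing.steps hG (.appS h.fn_ty hv.valPair.2.2) hs
    obtain ⟨k', u', rfl, -, -⟩ := IsVal.canon hc hw hw' (t := .psi _) rfl
    obtain ⟨⟨hv, hv'⟩, k, u, rfl, hr⟩ := hv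
    refine ⟨v, hv.1, .refl, interpV.psi_mk (h.compat ▸ hv) ⟨hw, hw'⟩ ?_⟩
    exact h.coerces v k u k' u' hv hv' ⟨hw, hw'⟩ (hr hn) hs
  | @prod θ₁ θ₂ θ₁' θ₂' c₁ c₂ h₁ h₂ ih₁ ih₂ =>
    have t₁ := ((h₁.typing hG hS).2.2 hθ.1 .secure []).closed
    have t₂ := ((h₂.typing hG hS).2.2 hθ.2 .secure []).closed
    obtain ⟨-, v₁, v₂, v₁', v₂', rfl, rfl, k₁, k₂⟩ := hv
    have p₁ := k₁.valPair.2.1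
    have p₂ := k₂.valPair.2.1
    refine Refines.det ?_ (.beta (.pair p₁ p₂))
    simp only [Expr.inst, Expr.subst, instSub, t₁.subst_eq, t₂.subst_eq]
    refine Refines.bind ((ih₁ hθ.1 k₁).det (Det.ctx (.appR c₁) (.projPair p₁ p₂))) (.pairL _)
      fun m hm _ w₁ w₁' s₁ r₁ => ?_
    refine Refines.bind
      ((ih₂ hθ.2 (k₂.mono hm)).det (Det.ctx (.appR c₂) (.projPair p₁ p₂)))
      (.pairR r₁.valPair.2.1) fun m' hm' _ w₂ w₂' s₂ r₂ => ?_
    -- The source components are already values, so the source values supplied by the refinement are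
    -- these components.
    obtain rfl := k₁.valPair.1.1.steps_eq s₁
    obtain rfl := k₂.valPair.1.1.steps_eq s₂
    exact (interpV.pair (r₁.mono hm') r₂).refines
  | @arrow θ₁ θ₂ θ₁' θ₂' c₁ c₂ h₁ h₂ ih₁ ih₂ =>
    obtain ⟨e₁, d₁, k₁⟩ := h₁.typing hG hS
    obtain ⟨e₂, d₂, k₂⟩ := h₂.typing hG hS
    have t₁ := (k₁ (d₁.2 hθ.1) .secure []).closed
    have t₂ := (k₂ hθ.2 .secure []).closed
    have tv := hv.valPair.2.2
    have htgt : Typing G .secure [] (.app _ v') _ :=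
      .appS (((Coercible.arrow h₁ h₂).typing hG hS).2.2 hθ .secure []) tv
    have hst := Det.beta (G := G) (τ := (SpecTy.arrow θ₁ θ₂).toExpr)
      (e := .abs θ₁'.toExpr (.app c₂ (.app (.bvar 1) (.app c₁ (.bvar 0))))) hv.valPair.2.1
    have key : (Expr.abs θ₁'.toExpr (.app c₂ (.app (.bvar 1) (.app c₁ (.bvar 0))))).inst v' =
        .abs θ₁'.toExpr (.app c₂ (.app v' (.app c₁ (.bvar 0)))) := by
      simp only [Expr.inst, Expr.subst, upSub, instSub, t₁.subst_eq, t₂.subst_eq,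
        SpecTy.subst_toExpr, tv.closed.shift_eq]
    rw [key] at hst
    refine Refines.det ?_ hst
    have htv := hv.valPair.1.2
    have hf := hv
    obtain ⟨-, τ, e, τ', e', rfl, rfl, -⟩ := hv
    refine (interpV.abs hG ?_ (Typing.steps hG htgt (.single hst.step))
      fun i hi u u' hu => ?_).refines
    · simpa only [SpecTy.erase, e₁, e₂] using htv
    · have : (Expr.app c₂ (.app (.abs τ' e') (.app c₁ (.bvar 0)))).inst u' =
          .app c₂ (.app (.abs τ' e') (.app c₁ u')) := by
        show Expr.app (c₂.subst _) (.app ((Expr.abs τ' e').subst _) (.app (c₁.subst _) _)) = _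
        rw [t₁.subst_eq, t₂.subst_eq, tv.closed.subst_eq]; rfl
      rw [this]
      refine Refines.bind (ih₁ (d₁.2 hθ.1) hu) ((IsCtx.appR _).comp (.appR _))
        fun m hm _ w w' sw rw' => ?_
      obtain rfl := hu.valPair.1.1.steps_eq sw
      refine Refines.bind (hf.app (by omega) rw') (.appR _) fun m' hm' _ z z' sz rz => ?_
      obtain ⟨hz, -⟩ := rz.valPair.1
      -- Function refinement speaks of the source application, whereas the goal starts at its
      -- β-reduct; the first step is deterministic and can be stripped.
      exact (ih₂ hθ.2 rz).src (Dets.steps_inv (.single (.beta hu.valPair.1.1)) sz hz)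

theorem Expr.shift_subst_cons (e u : Expr) (σ : ℕ → Expr) :
    e.shift.subst (consSub u σ) = e.subst σ := by
  simp only [shift, rename_subst, consSub]

/-- Three β-steps collapse into one simultaneous substitution; the last argument is the innermost
variable. -/
theorem Dets.iteFun {θ : SpecTy} {body b x y : Expr} (hb : IsVal b) (hx : IsVal x)
    (hy : IsVal y) : Dets G (app3 (iteFun θ body) b x y)
      (body.subst (consSub y (consSub x (consSub b .bvar)))) := by
  have h₁ : Det G (app3 (OADT.iteFun θ body) b x y) _ :=
    Det.ctx ((IsCtx.appL hy).comp (.appL hx)) (.beta hb)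
  have h₂ : Det G (.app (.app (.abs (θ.toExpr.subst (instSub b))
      (.abs (θ.toExpr.subst (upSub (instSub b)))
        (body.subst (upSub (upSub (instSub b)))))) x) y) _ :=
    Det.ctx (.appL hy) (.beta hx)
  suffices h : body.subst (consSub y (consSub x (consSub b .bvar))) =
      ((body.subst (upSub (upSub (instSub b)))).subst (upSub (instSub x))).inst y by
    rw [h]
    exact ((Relation.ReflTransGen.single h₁).tail h₂).tail (.beta hy)
  rw [Expr.subst_upSub_inst, Expr.subst_subst]
  congr 1
  funext n
  match n with
  | 0 => rfl
  | 1 => rfl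
  | n + 2 =>
    show _ = ((instSub b n).shift.shift).subst (consSub y (instSub x))
    rw [Expr.shift_subst_cons]
    show _ = (instSub b n).shift.inst x
    rw [Expr.shift_inst]
    cases n <;> rfl

/-- Applications evaluate from right to left, so the projection in the last argument fires first. -/
theorem Dets.projs {c : Bool} {f b x y x' y' : Expr} (hx : IsVal x)
    (hy : IsVal y) (hx' : IsVal x') (hy' : IsVal y') :
    Dets G (app3 f b (.proj c (.pair x y)) (.proj c (.pair x' y')))
      (app3 f b (cond c x y) (cond c x' y')) := by
  have hc : IsVal (cond c x' y') := by cases c <;> assumption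
  have h₁ : Det G (app3 f b (.proj c (.pair x y)) (.proj c (.pair x' y')))
      (app3 f b (.proj c (.pair x y)) (cond c x' y')) := Det.ctx (.appR _) (.projPair hx' hy')
  have h₂ : Det G (app3 f b (.proj c (.pair x y)) (cond c x' y'))
      (app3 f b (cond c x y) (cond c x' y')) :=
    Det.ctx ((IsCtx.appL hc).comp (.appR _)) (.projPair hx hy)
  exact (Relation.ReflTransGen.single h₁).tail h₂

/-- The boxed Boolean of the target equals the Boolean that selects the source value. The merge
preserves the refinement of each branch, and its final selection is then the same on both sides. -/
theorem Mergeable.refines (hG : G.WellTyped) (hS : S.Valid G) {θ : SpecTy} {ite : Expr}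
    (h : Mergeable S θ ite) (hθ : θ.Defined G) {n : ℕ} {b : Bool} {v₁ v₁' v₂ v₂' : Expr}
    (h₁ : interpV G S θ n v₁ v₁') (h₂ : interpV G S θ n v₂ v₂') :
    Refines G S θ n (cond b v₁ v₂) (app3 ite (.boxedLit b) v₁' v₂') := by
  have hc := hG.closed
  have mux {θ : SpecTy} {n : ℕ} {v₁ v₁' v₂ v₂' : Expr} (h₁ : interpV G S θ n v₁ v₁')
      (h₂ : interpV G S θ n v₂ v₂') : Refines G S θ n (cond b v₁ v₂)
        (app3 (iteFun θ (.mux (.bvar 2) (.bvar 1) (.bvar 0))) (.boxedLit b) v₁' v₂') := by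
    have p₁ := h₁.valPair.2.1
    have p₂ := h₂.valPair.2.1
    refine Refines.dets (Refines.det ?_ (.muxLit p₁ p₂)) (.iteFun (.boxedLit b) p₁ p₂)
    cases b
    · exact h₂.refines
    · exact h₁.refines
  induction h generalizing n v₁ v₁' v₂ v₂' with
  | unit | obool => exact mux h₁ h₂
  | @psi j hj =>
    have ht := Typing.app_iteS (b := .boxedLit b) ((Mergeable.psi hj).typing hG hS hθ .secure [])
      .boxedLit h₁.valPair.2.2 h₂.valPair.2.2
    obtain ⟨d, hd, hj⟩ := hS.join j hj
    have ho := hS.oadt _ _ hd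
    have hview := hc.view _ _ hd
    refine .of_steps fun hn w hw hs => ?_
    replace ht := ht.steps hG hs
    obtain ⟨⟨hv₁, p₁⟩, k₁, u₁, rfl, r₁⟩ := h₁
    obtain ⟨⟨hv₂, p₂⟩, k₂, u₂, rfl, r₂⟩ := h₂
    obtain ⟨q₁, q₁'⟩ := p₁.psi_inv hc hd
    obtain ⟨q₂, q₂'⟩ := p₂.psi_inv hc hd
    replace hs := Dets.steps_inv (.iteFun (.boxedLit b) p₁.1 p₂.1) hs hw
    simp only [app3, Expr.subst, consSub, upSub, hj.join_ty.closed.subst_eq,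
      hj.reshape_ty.closed.subst_eq, p₁.2.closed.shift_eq, p₂.2.closed.shift_eq] at hs
    obtain ⟨k, hk, hjoin, hs⟩ := hs.ctx_inv (.letE _) hw
    -- The two first projections reduce deterministically, the right one first, which leaves the
    -- join applied to the actual views.
    replace hjoin := Dets.steps_inv ((Relation.ReflTransGen.single
      (Det.ctx (.appR _) (.projPsi q₂.1 q₂'.1))).tail
      (Det.ctx ((IsCtx.appL q₂.1).comp (.appR _)) (.projPsi q₁.1 q₁'.1))) hjoin hk
    have tk : Typing G .secure [] k d.view :=
      (Typing.app_closed hview (.app_closed (b := .pi d.view d.view)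
        (fun σ ρ _ => by simp only [Expr.subst, hview.subst_eq]) hj.join_ty q₁.2) q₂.2).steps hG
        hjoin
    replace hs := Dets.steps_inv (.single (.letV hk)) hs hw
    simp only [Expr.inst, Expr.subst, instSub, hj.reshape_ty.closed.subst_eq,
      q₁.2.closed.subst_eq, q₁'.2.closed.subst_eq, q₂.2.closed.subst_eq,
      q₂'.2.closed.subst_eq] at hs
    replace hs : Steps G (.psiPair k (.mux (.boxedLit b)
        (app3 j.reshape (.proj true (.psiPair k₁ u₁)) k (.proj false (.psiPair k₁ u₁)))
        (app3 j.reshape (.proj true (.psiPair k₂ u₂)) k (.proj false (.psiPair k₂ u₂))))) w := hs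
    obtain ⟨u, hu, hmux, hs⟩ := hs.ctx_inv (.psiR hk) hw
    obtain rfl := IsVal.steps_eq (.psiPair hk hu) hs
    obtain ⟨x, hx, hs₁, hmux⟩ := hmux.ctx_inv (.mux₁ (.boxedLit b) _) hu
    obtain ⟨y, hy, hs₂, hmux⟩ := hmux.ctx_inv (.mux₂ (.boxedLit b) hx) hu
    obtain ⟨l₁, l₂⟩ := hj.join_upper k₁ k₂ k q₁ q₂ ⟨hk, tk⟩ hjoin
    -- The retraction to `v` at `k₁` gives `v ≼ k₁`, the upper bound property lifts this to `v ≼ k`,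
    -- and the reshaping axiom carries the retraction over to the key `k`. The same argument serves
    -- both branches.
    have reshape {v k₁ u₁ x : Expr} (hv : ValOf G v (.adt (S.oadt j.oadt).pub))
        (q : ValOf G k₁ d.view) (q' : ValOf G u₁ (.oadt j.oadt k₁)) (hx : IsVal x)
        (hr : Steps G (.app (.app (S.oadt j.oadt).r k₁) u₁) v) (hl : j.le k₁ k)
        (hs : Steps G (app3 j.reshape (.proj true (.psiPair k₁ u₁)) k
          (.proj false (.psiPair k₁ u₁))) x) :
        Steps G (.app (.app (S.oadt j.oadt).r k) x) v := by
      replace hs := Dets.steps_inv ((Relation.ReflTransGen.single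
        (Det.ctx (.appR _) (.projPsi q.1 q'.1))).tail
        (Det.ctx ((IsCtx.appL q'.1).comp ((IsCtx.appL hk).comp (.appR _)))
          (.projPsi q.1 q'.1))) hs hx
      exact hj.reshape_ret v k₁ k u₁ x hv q ⟨hk, tk⟩ q'
        ⟨hx, (Typing.app_reshape hview hj.reshape_ty q.2 tk q'.2).steps hG hs⟩ hr
        (hj.view_mono v k₁ k hv q ⟨hk, tk⟩ (ho.ret_view v k₁ u₁ hv q q' hr) hl) hs
    have z₁ := reshape hv₁ q₁ q₁' hx (r₁ hn) l₁ hs₁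
    have z₂ := reshape hv₂ q₂ q₂' hy (r₂ hn) l₂ hs₂
    replace hmux := Dets.steps_inv (.single (.muxLit hx hy)) hmux hu
    cases b
    · obtain rfl := hy.steps_eq hmux
      exact ⟨v₂, hv₂.1, .refl, interpV.psi_mk hv₂ ⟨hw, ht⟩ z₂⟩
    · obtain rfl := hx.steps_eq hmux
      exact ⟨v₁, hv₁.1, .refl, interpV.psi_mk hv₁ ⟨hw, ht⟩ z₁⟩
  | @prod θ₁ θ₂ i₁ i₂ m₁ m₂ ih₁ ih₂ =>
    have t₁ := (m₁.typing hG hS hθ.1 .secure []).closed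
    have t₂ := (m₂.typing hG hS hθ.2 .secure []).closed
    refine Refines.dets ?_ (.iteFun (.boxedLit b) h₁.valPair.2.1 h₂.valPair.2.1)
    obtain ⟨-, a₁, b₁, a₁', b₁', rfl, rfl, k₁, l₁⟩ := h₁
    obtain ⟨-, a₂, b₂, a₂', b₂', rfl, rfl, k₂, l₂⟩ := h₂
    simp only [app3, Expr.subst, consSub, t₁.subst_eq, t₂.subst_eq]
    rw [show cond b (Expr.pair a₁ b₁) (.pair a₂ b₂) = .pair (cond b a₁ a₂) (cond b b₁ b₂) by
      cases b <;> rfl]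
    have ha : IsVal (cond b a₁ a₂) := by cases b; exacts [k₂.valPair.1.1, k₁.valPair.1.1]
    have hb : IsVal (cond b b₁ b₂) := by cases b; exacts [l₂.valPair.1.1, l₁.valPair.1.1]
    refine Refines.bind ((ih₁ hθ.1 k₁ k₂).dets (.projs (c := true) k₁.valPair.2.1 l₁.valPair.2.1
      k₂.valPair.2.1 l₂.valPair.2.1)) (.pairL _) fun m hm _ w w' s r => ?_
    refine Refines.bind ((ih₂ hθ.2 (l₁.mono hm) (l₂.mono hm)).dets (.projs (c := false)
      k₁.valPair.2.1 l₁.valPair.2.1 k₂.valPair.2.1 l₂.valPair.2.1)) (.pairR r.valPair.2.1)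
      fun m' hm' _ z z' s' r' => ?_
    obtain rfl := ha.steps_eq s
    obtain rfl := hb.steps_eq s'
    exact (interpV.pair (r.mono hm') r').refines
  | @arrow θ₁ θ₂ i₂ m₂ ih =>
    have t₂ := (m₂.typing hG hS hθ.2 .secure []).closed
    have ht := Typing.app_iteS (b := .boxedLit b) (m₂.arrow.typing hG hS hθ .secure [])
      .boxedLit h₁.valPair.2.2 h₂.valPair.2.2
    have c₁ := h₁.valPair.2.2.closed
    have c₂ := h₂.valPair.2.2.closed
    have hd := Dets.iteFun (G := G) (θ := .arrow θ₁ θ₂) (body := .abs θ₁.toExpr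
      (app3 i₂ (.bvar 3) (.app (.bvar 2) (.bvar 0)) (.app (.bvar 1) (.bvar 0))))
      (.boxedLit b) h₁.valPair.2.1 h₂.valPair.2.1
    have hb (u : Expr) : app3 i₂ (.boxedLit b) (.app v₁' u) (.app v₂' u) =
        (app3 i₂ (.boxedLit b) (.app v₁' (.bvar 0)) (.app v₂' (.bvar 0))).inst u := by
      simp only [app3, Expr.inst, Expr.subst, instSub, t₂.subst_eq, c₁.subst_eq, c₂.subst_eq]
    replace hd : Dets G (app3 (iteFun (.arrow θ₁ θ₂) (.abs θ₁.toExpr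
        (app3 i₂ (.bvar 3) (.app (.bvar 2) (.bvar 0)) (.app (.bvar 1) (.bvar 0)))))
        (.boxedLit b) v₁' v₂') (.abs θ₁.toExpr
        (app3 i₂ (.boxedLit b) (.app v₁' (.bvar 0)) (.app v₂' (.bvar 0)))) := by
      simpa only [app3, Expr.subst, consSub, upSub, SpecTy.subst_toExpr, t₂.subst_eq,
        Expr.shift, c₁.rename_eq, c₂.rename_eq, Expr.rename] using hd
    refine Refines.dets ?_ hd
    have hs : Typing G .secure [] (cond b v₁ v₂) ((SpecTy.arrow θ₁ θ₂).erase S).toExpr := by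
      cases b; exacts [h₂.valPair.1.2, h₁.valPair.1.2]
    have f₁ := h₁
    have f₂ := h₂
    obtain ⟨-, τ₁, e₁, τ₁', e₁', rfl, rfl, -⟩ := h₁
    obtain ⟨-, τ₂, e₂, τ₂', e₂', rfl, rfl, -⟩ := h₂
    rw [show cond b (Expr.abs τ₁ e₁) (.abs τ₂ e₂) = .abs (cond b τ₁ τ₂) (cond b e₁ e₂) by
      cases b <;> rfl] at hs ⊢
    refine (interpV.abs hG hs (ht.steps hG hd.steps) fun i hi u u' hu => ?_).refines
    have hu' := hu.valPair.1.1
    rw [← hb u']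
    -- The target runs both applications, the right one first. Each yields a source value, and only
    -- the selected one has to be reached by the source.
    refine Refines.bind (f₂.app hi.le hu) (.appR _) fun m hm _ z z' s r => ?_
    refine Refines.bind (f₁.app (hm.trans hi.le) (hu.mono hm))
      ((IsCtx.appL r.valPair.2.1).comp (.appR _)) fun m' hm' _ w w' s' r' => ?_
    refine (ih hθ.2 r' (r.mono hm')).src ?_
    replace s := Dets.steps_inv (.single (.beta hu')) s r.valPair.1.1
    replace s' := Dets.steps_inv (.single (.beta hu')) s' r'.valPair.1.1
    cases b
    · exact s
    · exact s'

end Witness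

/-! ### The fundamental theorem -/

/-- The substitutions `γ` and `γ'` map the variables of `Γ` to related values. -/
def SubRel (G : GCtx) (S : PsiCtx) (n : ℕ) (Γ : List SpecTy) (γ γ' : ℕ → Expr) : Prop :=
  ∀ x θ, Γ[x]? = some θ → interpV G S θ n (γ x) (γ' x)

section Fundamental

variable {G : GCtx} {S : PsiCtx}

theorem SubRel.mono {m n : ℕ} {Γ : List SpecTy} {γ γ' : ℕ → Expr} (h : SubRel G S n Γ γ γ')
    (hm : m ≤ n) : SubRel G S m Γ γ γ' := fun x θ hx => (h x θ hx).mono hm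

theorem SubRel.cons {n : ℕ} {Γ : List SpecTy} {γ γ' : ℕ → Expr} (h : SubRel G S n Γ γ γ')
    {θ : SpecTy} {u u' : Expr} (hu : interpV G S θ n u u') :
    SubRel G S n (θ :: Γ) (consSub u γ) (consSub u' γ') := by
  rintro (_ | x) t hx
  · obtain rfl := Option.some.inj hx
    exact hu
  · exact h x t hx

theorem SubRel.ctxSub {n : ℕ} {Γ : List SpecTy} {γ γ' : ℕ → Expr} (h : SubRel G S n Γ γ γ') :
    CtxSub G .secure γ (Γ.map fun t => (t.erase S).toExpr) [] ∧
      CtxSub G .secure γ' (Γ.map fun t => t.toExpr) [] := by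
  constructor <;> intro x τ hx <;> rw [List.getElem?_map, Option.map_eq_some_iff] at hx <;>
    obtain ⟨θ, hx, rfl⟩ := hx <;> right <;> rw [SpecTy.rename_toExpr, SpecTy.subst_toExpr]
  · exact (h x θ hx).valPair.1.2
  · exact (h x θ hx).valPair.2.2

theorem SubRel.typing (hG : G.Closed) {n : ℕ} {Γ : List SpecTy} {γ γ' : ℕ → Expr}
    (h : SubRel G S n Γ γ γ') {e e' : Expr} {θ : SpecTy}
    (ht : Typing G .secure (Γ.map fun t => (t.erase S).toExpr) e (θ.erase S).toExpr)
    (ht' : Typing G .secure (Γ.map fun t => t.toExpr) e' θ.toExpr) :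
    Typing G .secure [] (e.subst γ) (θ.erase S).toExpr ∧
      Typing G .secure [] (e'.subst γ') θ.toExpr := by
  have h₁ := (Judgment.subst hG).2 _ _ _ _ ht _ _ h.ctxSub.1
  have h₂ := (Judgment.subst hG).2 _ _ _ _ ht' _ _ h.ctxSub.2
  rw [SpecTy.subst_toExpr] at h₁ h₂
  exact ⟨h₁, h₂⟩

/-- Arguments are evaluated before functions, so the head of a spine is an evaluation position once
all arguments are values. For an elimination method the arguments are abstractions. -/
theorem IsCtx.foldl_app {as : List Expr} (h : ∀ a ∈ as, IsVal a) :
    IsCtx G fun f => as.foldl Expr.app f := by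
  induction as with
  | nil => exact ⟨fun _ _ h => h, fun _ x _ h => ⟨x, rfl, h⟩, fun _ h => h⟩
  | cons a as ih =>
    exact (ih fun b hb => h b (List.mem_cons_of_mem _ hb)).comp (.appL (h a List.mem_cons_self))

theorem Expr.apps_subst {n : ℕ} (f : Expr) (as : Fin n → Expr) (σ : ℕ → Expr) :
    (apps f as).subst σ = apps (f.subst σ) fun i => (as i).subst σ := by
  have key : ∀ (l : List Expr) (f : Expr), (l.foldl Expr.app f).subst σ =
      (l.map (Expr.subst σ)).foldl Expr.app (f.subst σ) := by
    intro l
    induction l with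
    | nil => exact fun _ => rfl
    | cons a l ih => exact fun f => ih _
  rw [apps, key, List.map_ofFn]; rfl

/-- Typing of the entries of a lifting context. -/
def LiftEntry.Typed (G : GCtx) (S : PsiCtx) (l : LiftEntry) : Prop :=
  l.ty.Defined G ∧ (∀ Γ, Typing G .secure Γ (.gvar l.src) (l.ty.erase S).toExpr) ∧
    ∀ Γ, Typing G .secure Γ (.gvar l.tgt) l.ty.toExpr

/-- A related argument extends the related closing substitutions, so the hypothesis on the body at
all smaller indices yields related abstractions. -/
theorem SubRel.abs (hG : G.WellTyped) {n : ℕ} {Γ : List SpecTy} {γ γ' : ℕ → Expr}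
    (h : SubRel G S n Γ γ γ') {a b : SpecTy} {τ τ' e e' : Expr}
    (ht : Typing G .secure [] (.abs τ (e.subst (upSub γ))) ((SpecTy.arrow a b).erase S).toExpr)
    (ht' : Typing G .secure [] (.abs τ' (e'.subst (upSub γ'))) (SpecTy.arrow a b).toExpr)
    (ih : ∀ m ≤ n, ∀ δ δ', SubRel G S m (a :: Γ) δ δ' →
      Refines G S b m (e.subst δ) (e'.subst δ')) :
    interpV G S (.arrow a b) n (.abs τ (e.subst (upSub γ))) (.abs τ' (e'.subst (upSub γ'))) := by
  refine interpV.abs hG ht ht' fun i hi u u' hu => ?_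
  rw [Expr.subst_upSub_inst, Expr.subst_upSub_inst]
  exact ih i hi.le _ _ ((h.mono hi.le).cons hu)

/-- Related closing substitutions map a lifted expression to related expressions. -/
theorem Lifts.refines (hG : G.WellTyped) (hS : S.Valid G) {L : Set LiftEntry}
    (hL : ∀ l ∈ L, l.Typed G S) {N : ℕ} (hN : NValid G S N L)
    {Γ : List SpecTy} {e e' : Expr} {θ : SpecTy} (h : Lifts G S L Γ e θ e')
    (hΓ : ∀ t ∈ Γ, t.Defined G) {n : ℕ} (hn : n ≤ N) {γ γ' : ℕ → Expr}
    (hγ : SubRel G S n Γ γ γ') : Refines G S θ n (e.subst γ) (e'.subst γ') := by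
  have hc := hG.closed
  have cons {Γ : List SpecTy} {t : SpecTy} (ht : t.Defined G) (hΓ : ∀ t ∈ Γ, t.Defined G) :
      ∀ s ∈ t :: Γ, s.Defined G := by simpa using ⟨ht, hΓ⟩
  have typing {Γ : List SpecTy} {e e' : Expr} {θ : SpecTy} (h : Lifts G S L Γ e θ e')
      (hΓ : ∀ t ∈ Γ, t.Defined G) {n : ℕ} {γ γ' : ℕ → Expr} (hγ : SubRel G S n Γ γ γ') :=
    hγ.typing hc (h.typing hG hS hL hΓ).2.1 (h.typing hG hS hL hΓ).2.2
  induction h generalizing n γ γ' with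
  | unit =>
    exact interpV.refines ⟨⟨⟨.tt, .tt⟩, .tt, .tt⟩, fun _ => rfl⟩
  | lit =>
    exact interpV.refines ⟨⟨⟨.lit _, .lit⟩, .lit _, .lit⟩, fun _ => rfl⟩
  | var hx => exact (hγ _ _ hx).refines
  | fn hl => exact Refines.mono (hN _ hl).2.2 hn
  | abs hθ hl ih =>
    obtain ⟨t, t'⟩ := typing (.abs hθ hl) hΓ hγ
    have := cons hθ.choose_spec.specTy_defined hΓ
    exact (hγ.abs hG t t' fun m hm δ δ' hδ => ih this (hm.trans hn) hδ).refines
  | app _ _ ih₁ ih₂ =>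
    refine Refines.bind (ih₂ hΓ hn hγ) (.appR _) fun m hm _ v v' s r => ?_
    refine Refines.bind (ih₁ hΓ (hm.trans hn) (hγ.mono hm)) (.appL r.valPair.2.1)
      fun m' hm' _ w w' s' r' => ?_
    exact (r'.app le_rfl (r.mono hm')).src
      ((s.ctx (.appR _)).trans (s'.ctx (.appL r.valPair.1.1)))
  | letE h₁ _ ih₁ ih₂ =>
    have hd := cons (h₁.typing hG hS hL hΓ).1 hΓ
    refine Refines.bind (ih₁ hΓ hn hγ) (.letE _) fun m hm _ v v' s r => ?_
    refine Refines.det ?_ (.letV r.valPair.2.1)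
    refine Refines.src ?_ ((s.ctx (.letE _)).tail (.letV r.valPair.1.1))
    rw [Expr.subst_upSub_inst, Expr.subst_upSub_inst]
    exact ih₂ hd (hm.trans hn) ((hγ.mono hm).cons r)
  | pair _ _ ih₁ ih₂ =>
    refine Refines.bind (ih₁ hΓ hn hγ) (.pairL _) fun m hm _ v v' s r => ?_
    refine Refines.bind (ih₂ hΓ (hm.trans hn) (hγ.mono hm)) (.pairR r.valPair.2.1)
      fun m' hm' _ w w' s' r' => ?_
    exact ((r.mono hm').pair r').refines.src
      ((s.ctx (.pairL _)).trans (s'.ctx (.pairR r.valPair.1.1)))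
  | @proj _ b _ _ _ _ _ ih =>
    refine Refines.bind (ih hΓ hn hγ) (.proj b) fun m hm _ v v' s r => ?_
    obtain ⟨-, v₁, v₂, v₁', v₂', rfl, rfl, r₁, r₂⟩ := r
    refine Refines.det ?_ (.projPair r₁.valPair.2.1 r₂.valPair.2.1)
    refine Refines.src ?_
      ((s.ctx (.proj b)).tail (.projPair r₁.valPair.1.1 r₂.valPair.1.1))
    cases b
    · exact r₂.refines
    · exact r₁.refines
  | ite₁ _ _ _ ih₀ ih₁ ih₂ =>
    refine Refines.bind (ih₀ hΓ hn hγ) (.ite _ _) fun m hm hp v v' s r => ?_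
    obtain rfl := r.2 hp
    obtain ⟨b, rfl⟩ := IsVal.canon hc r.valPair.2.1 r.valPair.2.2 (t := .bool) rfl
    refine Refines.det (Refines.src ?_ ((s.ctx (.ite _ _)).tail .iteLit)) .iteLit
    cases b
    · exact ih₂ hΓ (hm.trans hn) (hγ.mono hm)
    · exact ih₁ hΓ (hm.trans hn) (hγ.mono hm)
  | @ite₂ _ _ _ _ _ _ _ _ ite _ hm₀ h₁ _ ih₀ ih₁ ih₂ =>
    have hθ := (h₁.typing hG hS hL hΓ).1
    have hi := (hm₀.typing hG hS hθ .secure []).closed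
    simp only [app3, Expr.subst, hi.subst_eq]
    -- Unlike the source `if`, the target evaluates both branches before its condition, from right
    -- to left. The induction hypotheses provide source values for both branches, and the Boolean
    -- later tells which of the two source reductions to use.
    refine Refines.bind (ih₂ hΓ hn hγ) (.appR _) fun m hm _ v₂ v₂' s₂ r₂ => ?_
    refine Refines.bind (ih₁ hΓ (hm.trans hn) (hγ.mono hm))
      ((IsCtx.appL r₂.valPair.2.1).comp (.appR _)) fun m' hm' _ v₁ v₁' s₁ r₁ => ?_
    have hm'' := hm'.trans hm
    refine Refines.bind (ih₀ hΓ (hm''.trans hn) (hγ.mono hm''))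
      ((IsCtx.appL r₂.valPair.2.1).comp ((IsCtx.appL r₁.valPair.2.1).comp (.appR _)))
      fun k hk hp v v' s r => ?_
    obtain ⟨-, b, b', rfl, rfl, r⟩ := r
    obtain rfl := r hp
    refine (hm₀.refines hG hS hθ (r₁.mono hk) (r₂.mono (hk.trans hm'))).src
      (((s.ctx (.ite _ _)).tail .iteLit).trans ?_)
    cases b
    · exact s₂
    · exact s₁
  | @ctor₁ _ T _ arg i η _ _ hT hη _ ih =>
    have hk := hη ▸ hG.adt _ _ _ hT i
    refine Refines.bind (ih hΓ hn hγ) (.ctor T i) fun m hm hp v v' s r => ?_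
    -- Constructor arguments are public, so at a positive index the related values are equal, as
    -- required at an ADT type.
    obtain rfl := r.pub_eq hp hk.isPub
    refine Refines.src (interpV.refines ?_) (s.ctx (.ctor T i))
    have ht := r.valPair.2.2
    rw [hη] at ht
    have hv : ValOf G (.ctor T i v) (.adt T) := ⟨.ctor _ _ r.valPair.2.1, .ctor hT ht⟩
    exact ⟨⟨hv, hv⟩, fun _ => rfl⟩
  | @ctor₂ _ c _ _ hi _ ih =>
    have hi := hS.intro _ hi
    simp only [Expr.subst, hi.fn_ty.closed.subst_eq]
    refine Refines.bind (ih hΓ hn hγ) (.appR _) fun m hm hp v v' s r => ?_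
    exact Refines.src (hi.refines m v v' r).2.2 (s.ctx (.ctor _ _))
  | @ematch₁ _ T k arg η θ _ _ bs bs' hT hη hθ _ _ ih₀ ih =>
    refine Refines.bind (ih₀ hΓ hn hγ) (.ematch T k _) fun m hm hp v v' s r => ?_
    obtain rfl := r.2 hp
    obtain ⟨_, v, rfl, hv⟩ := IsVal.canon hc r.valPair.2.1 r.valPair.2.2 (t := .adt T) rfl
    obtain ⟨_, _, i, hT', rfl, tv, -⟩ := r.valPair.2.2.inv
    cases Option.some.inj (hT.symm.trans hT')
    have hk := (hη i).symm ▸ hG.adt _ _ _ hT i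
    refine Refines.det (Refines.src ?_ ((s.ctx (.ematch T k _)).tail (.matchCtor hv)))
      (.matchCtor hv)
    rw [Expr.subst_upSub_inst, Expr.subst_upSub_inst]
    -- Equality of the scrutinees gives equal payloads; being of public type, the payload is related
    -- to itself and may extend the closing substitutions.
    exact ih i (cons hk.specTy_defined hΓ) (hm.trans hn)
      ((hγ.mono hm).cons (ValOf.interpV_self hG hk ⟨hv, hη i ▸ tv⟩ m))
  | @ematch₂ Γ c e₀ e₀' bs bs' hi h₀ h ih₀ ih =>
    have hi := hS.elim _ hi
    obtain ⟨arg, hT, ha⟩ := hi.compat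
    have hd := (hi.ret_defined hG).2
    rw [Expr.apps_subst]
    simp only [Expr.subst, hi.fn_ty.closed.subst_eq, SpecTy.subst_toExpr]
    refine Refines.bind (ih₀ hΓ hn hγ) ((IsCtx.foldl_app fun a ha => ?_).comp (.appR _))
      fun m hm hp v v' s r => ?_
    · obtain ⟨i, rfl⟩ := List.mem_ofFn.1 ha
      exact .abs _ _
    obtain ⟨⟨hv, hv'⟩, k, u, rfl, hr⟩ := r
    obtain ⟨_, w, rfl, hw⟩ := IsVal.canon hc hv.1 hv.2 (t := .adt (S.oadt c.oadt).pub) rfl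
    obtain ⟨_, _, i, hT', rfl, tw, -⟩ := hv.2.inv
    cases Option.some.inj (hT.symm.trans hT')
    refine Refines.src ?_ ((s.ctx (.ematch _ _ _)).tail (.matchCtor hw))
    -- The retraction of the target scrutinee exposes the constructor matched by the source. The
    -- elimination axiom is then applied to the closed branches, related as functions by the
    -- induction hypotheses.
    refine (hi.refines m i w k u (fun j => (bs j).subst (upSub γ))
      (fun j => (bs' j).subst (upSub γ')) ⟨hw, (ha i).symm ▸ tw⟩ hv' (hr hp) fun j => ?_).2.2
    have hγ' := hγ.mono hm
    obtain ⟨-, t, t'⟩ := (Lifts.abs ⟨_, (hd j).kinding .secure []⟩ (h j)).typing hG hS hL hΓ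
    obtain ⟨t, t'⟩ := hγ'.typing hc t t'
    simp only [Expr.subst, SpecTy.subst_toExpr] at t t'
    exact hγ'.abs hG t t' fun m' hm' δ δ' hδ =>
      ih j (cons (hd j) hΓ) (hm'.trans (hm.trans hn)) hδ
  | @coerce _ _ _ _ _ c hl hco ih =>
    have hθ := (hl.typing hG hS hL hΓ).1
    have hcl := ((hco.typing hG hS).2.2 hθ .secure []).closed
    simp only [Expr.subst, hcl.subst_eq]
    refine Refines.bind (ih hΓ hn hγ) (.appR _) fun m hm hp v v' s r => ?_
    exact (hco.refines hG hS hθ r).src s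

/-- Only the declared types in the well-typed global context are used, so no typing of the lifted
bodies is involved. -/
theorem Derivable.typed (hG : G.WellTyped) {L : Set LiftEntry} (hL : Derivable G S L)
    (l : LiftEntry) (hl : l ∈ L) : l.Typed G S := by
  obtain ⟨e, e', h₁, h₂, -⟩ := hL l hl
  exact ⟨(hG.fn _ _ h₂).1.choose_spec.specTy_defined,
    fun Γ => .gvar (d := ⟨.secure, _, e⟩) h₁ fun _ => rfl,
    fun Γ => .gvar (d := ⟨.secure, _, e'⟩) h₂ fun _ => rfl⟩

end Fundamental

end OADT

theorem theorem4 (G : OADT.GCtx) (S : OADT.PsiCtx) (L : Set OADT.LiftEntry)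
    (hG : G.WellTyped) (hS : S.Valid G) (hL : OADT.Derivable G S L) :
    OADT.ValidCtx G S L := by
  intro n
  have ht := hL.typed hG
  induction n with
  | zero => exact fun l hl => ⟨(ht l hl).2.1 _, (ht l hl).2.2 _, fun i hi => absurd hi i.not_lt_zero⟩
  | succ n ih =>
    intro l hl
    obtain ⟨e, e', h₁, h₂, h⟩ := hL l hl
    refine ⟨(ht l hl).2.1 _, (ht l hl).2.2 _, ?_⟩
    -- The bodies are closed, so any substitutions are related over the empty context and the
    -- identity leaves the bodies unchanged.
    have := h.refines hG hS ht ih (by simp) le_rfl (γ := .bvar) (γ' := .bvar)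
      (fun x θ hx => by simp at hx)
    rw [OADT.Expr.subst_bvar, OADT.Expr.subst_bvar] at this
    -- Unfolding the target name costs the one step that turns index `n` into `n + 1`; unfolding the
    -- source name is free.
    exact OADT.Refines.det_pred (this.src (.single (.fn h₁))) (.fn h₂)
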